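/- Setting. Let $\mathcal N\subset\mathbf Z^2$ be finite with $0\in\mathcal N=-\mathcal N$. A random rule is a map $\pi:2^{\mathcal N}\to[0,1]$ that is monotone ($S_1\subset S_2\Rightarrow\pi(S_1)\le\pi(S_2)$), symmetric ($\pi(-S)=\pi(S)$), grows by contact ($\pi(\emptyset)=0$) and solidifies ($\pi(S)=1$ if $0\in S$). A CA is such a rule with values in $\{0,1\}$; its deterministic dynamics iterates $\mathcal T(A)=\{x:\pi((A-x)\cap\mathcal N)=1\}$. A set $A\subset\mathbf Z^2$ fills space if $\bigcup_{t\ge 0}\mathcal T^t(A)=\mathbf Z^2$. The random rule $\pi$ is a $p$-perturbation of the CA $\mathcal T$ if $\mathcal T$ is given by $\mathbf 1_{\{\pi(S)>0\}}$ and $p=\min\{\pi(S):\pi(S)>0\}$. The random dynamics is driven by i.i.d. vectors $\xi_{x,t}=(\xi_{x,t}(S))_{S\subset\mathcal N}$, $x\in\mathbf Z^2$, $t=0,1,\dots$, where $\xi_{x,t}(S)$ is Bernoulli($\pi(S)$) and $\xi_{x,t}(S)$ is almost surely nondecreasing in $S$; given $A_0$, put $A_{t+1}=\{x:\xi_{x,t}((A_t-x)\cap\mathcal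 N)=1\}$. The CA $\mathcal T$ is locally regular if for every initial state $A_0\subset\mathbf Z^2$ (finite or infinite) that fills space there is a constant $C$ such that the following holds for every deterministic $0/1$ assignment of the $\xi_{x,t}(S)$ that is nondecreasing in $S$, equals $0$ when $S$ is not sufficient for $\mathcal T$, and equals $1$ when $0\in S$: for all $t$, every $x\in A_t$ at distance at least $C$ from $A_0$ has a set $G\subset A_t$ within distance $C$ of $x$ that fills space. For a unit vector $u\in S^1$ let $H_u^-=\{x\in\mathbf R^2:\langle x,u\rangle\le 0\}$. Statement. Let $\pi$ be a $p$-perturbation of a locally regular CA $\mathcal T$ for which some finite set fills space. Then there is a deterministic function $w_\pi:S^1\to(0,\infty)$, depending only on $\pi$, which is the half-space speed of the random dynamics: for every $\varepsilon>0$ there is $c_\varepsilon>0$ such that for all $u\in S^1$ and $t=0,1,2,\dots$, if $A_0=H_u^-\cap\mathbf Z^2$, then $$H_u^-+t(w_\pi(u)-\varepsilon)u\;\subset\;A_t\;\subset\;H_u^-+t(w_\pi(u)+\varepsilon)u$$ within the lattice ball of radius $t^2$ with probability at least $1-\exp(-c_\varepsilon t)$; and, for every finite initial set $A_0$ which fills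 space, $$\frac{A_t}{t}\longrightarrow L_p=K_{1/w_\pi}^*\quad\text{almost surely, in the Hausdorff metric,}$$ where $K_{1/w_\pi}=\bigcup\{[0,1/w_\pi(u)]\cdot u:u\in S^1\}$ and $K^*=\{x\in\mathbf R^2:\langle x,y\rangle\le 1\text{ for all }y\in K\}$ is the polar of $K$. -/

import Mathlib

open MeasureTheory ProbabilityTheory Filter Topology

noncomputable section

namespace RandomGrowth

/-- The sites of the lattice `ℤ²`. -/
abbrev Site : Type := ℤ × ℤ

/-- The Euclidean plane `ℝ²`. -/
abbrev Plane : Type := EuclideanSpace ℝ (Fin 2)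

/-- The inclusion of the lattice `ℤ²` into the plane `ℝ²`. -/
def toPlane (x : Site) : Plane := !₂[(x.1 : ℝ), (x.2 : ℝ)]

/-- The configurations `S ⊆ 𝒩` that a site can see in its neighborhood, ordered by inclusion. -/
abbrev Config (N : Finset Site) : Type := ↥N.powerset

open Classical in
/-- The configuration `(A - x) ∩ 𝒩` of occupied sites seen from `x` when `A` is occupied. -/
def localConfig (N : Finset Site) (A : Set Site) (x : Site) : Config N :=
  ⟨N.filter fun y => x + y ∈ A, Finset.mem_powerset.2 (Finset.filter_subset _ _)⟩

/-- A monotone two-state cellular automaton with finite neighborhood `N`, growing by contact,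
symmetric and solidifying. `suff S` says that `S` is a sufficient configuration for occupancy. -/
structure CellularAutomaton (N : Finset Site) where
  suff : Config N → Prop
  zero_mem : (0 : Site) ∈ N
  neg_mem : ∀ y ∈ N, -y ∈ N
  mono : ∀ S₁ S₂ : Config N, S₁ ≤ S₂ → suff S₁ → suff S₂
  contact : ∀ S : Config N, S.1 = ∅ → ¬ suff S
  symmetric : ∀ S₁ S₂ : Config N, (∀ y, y ∈ S₂.1 ↔ -y ∈ S₁.1) → (suff S₁ ↔ suff S₂)
  solidifies : ∀ S : Config N, (0 : Site) ∈ S.1 → suff S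

/-- A random monotone rule with finite neighborhood `N`, growing by contact, symmetric and
solidifying: a site that sees `S` becomes occupied with probability `prob S`. -/
structure RandomRule (N : Finset Site) where
  prob : Config N → ℝ
  nonneg : ∀ S, 0 ≤ prob S
  le_one : ∀ S, prob S ≤ 1
  zero_mem : (0 : Site) ∈ N
  neg_mem : ∀ y ∈ N, -y ∈ N
  mono : ∀ S₁ S₂ : Config N, S₁ ≤ S₂ → prob S₁ ≤ prob S₂
  contact : ∀ S : Config N, S.1 = ∅ → prob S = 0
  symmetric : ∀ S₁ S₂ : Config N, (∀ y, y ∈ S₂.1 ↔ -y ∈ S₁.1) → prob S₁ = prob S₂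
  solidifies : ∀ S : Config N, (0 : Site) ∈ S.1 → prob S = 1

/-- `π` is a `p`-perturbation of the automaton `T`: the sufficient configurations of `T` are
those with `π(S) > 0`, and `p = min {π(S) : π(S) > 0}`. -/
def IsPerturbation {N : Finset Site} (p : ℝ) (π : RandomRule N) (T : CellularAutomaton N) : Prop :=
  (∀ S, T.suff S ↔ 0 < π.prob S) ∧ IsLeast {q : ℝ | 0 < q ∧ ∃ S, π.prob S = q} p

/-- The iteration transform `𝒯` of the automaton. Sites of `A` belong to `𝒯 A` because the
automaton solidifies. -/
def CellularAutomaton.step {N : Finset Site} (T : CellularAutomaton N) (A : Set Site) : Set Site :=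
  {x | T.suff (localConfig N A x)}

/-- `A` fills space: every site is eventually occupied by the deterministic dynamics from `A`. -/
def CellularAutomaton.FillsSpace {N : Finset Site} (T : CellularAutomaton N) (A : Set Site) : Prop :=
  ⋃ t : ℕ, T.step^[t] A = Set.univ

/-- The occupied sets `A_0, A_1, …` driven by the 0/1 variables `η x t S`:
`A_{t+1} = {x : η_{x,t}((A_t - x) ∩ 𝒩) = 1}`. -/
def occupied {N : Finset Site} (η : Site → ℕ → Config N → Bool) (A₀ : Set Site) : ℕ → Set Site
  | 0 => A₀
  | t + 1 => {x | η x t (localConfig N (occupied η A₀ t) x) = true}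

/-- The deterministic assignments of the variables `ξ_{x,t}(S)` that a perturbation of `T` allows:
they are monotone in `S`, vanish on the configurations that are not sufficient for `T`, and equal
`1` on the configurations that contain the origin. -/
def CellularAutomaton.IsAssignment {N : Finset Site} (T : CellularAutomaton N)
    (η : Site → ℕ → Config N → Bool) : Prop :=
  ∀ x t, Monotone (η x t) ∧
    (∀ S, η x t S = true → T.suff S) ∧ ∀ S : Config N, (0 : Site) ∈ S.1 → η x t S = true

/-- Local regularity: for every initial state `A₀` (finite or infinite) that fills space there is a
constant `C` such that, for every assignment, every `x ∈ A_t` at distance at least `C` from `A₀`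
has within distance `C` a set `G ⊆ A_t` that fills space. -/
def CellularAutomaton.LocallyRegular {N : Finset Site} (T : CellularAutomaton N) : Prop :=
  ∀ A₀ : Set Site, T.FillsSpace A₀ → ∃ C : ℝ, ∀ η, T.IsAssignment η → ∀ t : ℕ,
    ∀ x ∈ occupied η A₀ t, (∀ a ∈ A₀, C ≤ dist (toPlane x) (toPlane a)) →
      ∃ G ⊆ occupied η A₀ t,
        (∀ y ∈ G, dist (toPlane x) (toPlane y) ≤ C) ∧ T.FillsSpace G

/-- The random input of the dynamics with rule `π`: the vectors `ξ_{x,t}` are i.i.d., the coordinate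
`ξ_{x,t}(S)` is Bernoulli(`π(S)`), and almost surely `ξ_{x,t}(S)` is nondecreasing in `S`. -/
structure IsNoise {N : Finset Site} (π : RandomRule N) {Ω : Type*} [MeasurableSpace Ω]
    (μ : Measure Ω) (ξ : Site → ℕ → Ω → Config N → Bool) : Prop where
  measurable : ∀ x t, Measurable (ξ x t)
  indep : iIndepFun (fun i : Site × ℕ => ξ i.1 i.2) μ
  ident : ∀ x t, IdentDistrib (ξ x t) (ξ 0 0) μ μ
  bernoulli : ∀ x t S, μ.real {ω | ξ x t ω S = true} = π.prob S
  coupled : ∀ x t, ∀ᵐ ω ∂μ, Monotone (ξ x t ω)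

/-- The closed half-plane `H_u^- + a u = {x : ⟨x, u⟩ ≤ a}`, for a unit vector `u`. -/
def halfPlane (u : Plane) (a : ℝ) : Set Plane := {x | inner ℝ x u ≤ a}

/-- `w` is the half-space speed function of the random dynamics driven by `ξ`: it is positive, and
started from `A_0 = H_u^- ∩ ℤ²` one has
`H_u^- + t (w(u) - ε) u ⊆ A_t ⊆ H_u^- + t (w(u) + ε) u` within the lattice ball of radius `t²`
with probability at least `1 - exp(-c_ε t)`. These bounds determine `w`. -/
def IsHalfSpaceSpeed {N : Finset Site} {Ω : Type*} [MeasurableSpace Ω]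
    (μ : Measure Ω) (ξ : Site → ℕ → Ω → Config N → Bool)
    (w : Metric.sphere (0 : Plane) 1 → ℝ) : Prop :=
  (∀ u, 0 < w u) ∧
    ∀ ε : ℝ, 0 < ε → ∃ c : ℝ, 0 < c ∧ ∀ (u : Metric.sphere (0 : Plane) 1) (t : ℕ),
      1 - Real.exp (-c * t) ≤ μ.real {ω | ∀ x : Site, ‖toPlane x‖ ≤ (t : ℝ) ^ 2 →
        (toPlane x ∈ halfPlane u (t * (w u - ε)) →
          x ∈ occupied (fun y s => ξ y s ω) (toPlane ⁻¹' halfPlane u 0) t) ∧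
        (x ∈ occupied (fun y s => ξ y s ω) (toPlane ⁻¹' halfPlane u 0) t →
          toPlane x ∈ halfPlane u (t * (w u + ε)))}

/-- The set `K_{1/w} = ⋃ {[0, 1/w(u)] · u : u ∈ S¹}`. -/
def inverseSpeedRegion (w : Metric.sphere (0 : Plane) 1 → ℝ) : Set Plane :=
  ⋃ u : Metric.sphere (0 : Plane) 1, (fun s : ℝ => s • (u : Plane)) '' Set.Icc 0 (1 / w u)

/-- The polar `K^* = {x : ⟨x, y⟩ ≤ 1 for all y ∈ K}`. -/
def polarSet (K : Set Plane) : Set Plane := {x | ∀ y ∈ K, inner ℝ x y ≤ 1}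

/-- The rescaled set `A / t` in the plane. -/
def rescaled (A : Set Site) (t : ℕ) : Set Plane :=
  (fun x : Site => (t : ℝ)⁻¹ • toPlane x) '' A

end RandomGrowth

end

open RandomGrowth

/-!
The front of a half-plane advances at a deterministic speed with exponentially small errors, and
the asymptotic shape from a finite filling set is the polar of the region of inverse speeds. No
subadditivity of the shape is used; everything rests on the following three facts.

*Uniform local regularity* (`CellularAutomaton.LocallyRegular.uniform`, `exists_filling_near`). The
constant in local regularity can be chosen the same for all initial states, because counterexamples
for larger and larger constants, placed far apart, would form a single filling counterexample. Hence
every occupied site of a process started from a half-plane has a filling subset of the occupied set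
nearby, and so its surroundings are soon occupied with high probability (`exists_tries`).

*Sharp transition* (`exists_sharp_transition`). Consider the time at which the origin becomes
occupied in the process from a half-plane at level `b`. By the first fact, one step of
the process changes the expected remaining time by much less than `ℓ ^ (1/2)` (`exists_meanVacant_le`),
so this time is concentrated (`IsSureNoise.hasSubgaussianMGF_vacantTime`). Therefore, at a large scale `ℓ` and
for every direction, the probability that the origin is occupied at time `ℓ` passes from close to
`0` to close to `1` when `b` changes by `ε * ℓ`.

*Defects* (`real_defectCount_ge_le`). In the process observed at multiples of `ℓ`, a single-site
error at scale `ℓ` is a defect, that costs a bounded displacement of the front. Chains of defects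
are controlled by a first-moment bound, which lifts the transition at one scale to exponential
bounds at all large times (`IsSureNoise.block_lower`, `IsSureNoise.block_upper`) and produces the
speed `w` (`IsSureNoise.exists_speed`).

For the half-space bounds at all times (`IsSiteSpeed.exists_halfSpace_bounds`), a union bound handles
large times. The finitely many small times only need a positive probability, uniformly in the
direction: in one step a site at distance at most `w u` from a half-plane may become occupied, and a
site at a larger distance may stay vacant, so the front may move exactly by `w u` in each step.

The upper half of the shape theorem is a union of finitely many half-plane bounds. For the lower
half (`IsSiteSpeed.exists_roundedShape_growth`), the limit shape is replaced by a slightly smaller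
union of balls of comparable radius; near a boundary point such a set of size `R` contains
a half-plane cut off at distance of order `δ * R`, up to an error of order `δ ^ 2 * R`, so in `δ * R`
steps it grows almost at the half-plane speed, and finitely many such steps suffice.

A rule determines the law of the occupied set at a fixed time, although not the joint law of the
vectors `ξ x t` (`real_occupied_eq`); this makes `w` independent of the noise.
-/

namespace RandomGrowth

set_option linter.unusedSectionVars false

/-! ### Deterministic dynamics -/

/-- An environment: a 0/1 value for every site, time and local configuration. -/
abbrev Env (N : Finset Site) : Type := Site → ℕ → Config N → Bool

variable {N : Finset Site}

lemma mem_localConfig {A : Set Site} {x y : Site} :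
    y ∈ (localConfig N A x).1 ↔ y ∈ N ∧ x + y ∈ A := by
  simp [localConfig]

lemma localConfig_congr {A A' : Set Site} {x x' : Site}
    (h : ∀ y ∈ N, x + y ∈ A ↔ x' + y ∈ A') : localConfig N A x = localConfig N A' x' := by
  apply Subtype.ext
  ext y
  rw [mem_localConfig, mem_localConfig]
  constructor
  · rintro ⟨h1, h2⟩; exact ⟨h1, (h y h1).1 h2⟩
  · rintro ⟨h1, h2⟩; exact ⟨h1, (h y h1).2 h2⟩

lemma localConfig_mono {A A' : Set Site} {x x' : Site}
    (h : ∀ y ∈ N, x + y ∈ A → x' + y ∈ A') : localConfig N A x ≤ localConfig N A' x' := by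
  change (localConfig N A x).1 ≤ (localConfig N A' x').1
  intro y hy
  rw [mem_localConfig] at hy ⊢
  exact ⟨hy.1, h y hy.1 hy.2⟩

lemma eq_true_of_monotone {f : Config N → Bool} (hf : Monotone f) {S S' : Config N} (h : S ≤ S')
    (hS : f S = true) : f S' = true := by
  exact Bool.le_iff_imp.1 (hf h) hS

/-- The environment seen from the space-time point `(v, s)`. -/
def shiftEnv (v : Site) (s : ℕ) (η : Env N) : Env N := fun x t => η (v + x) (s + t)

lemma mem_occupied_succ {η : Env N} {A : Set Site} {t : ℕ} {x : Site} :
    x ∈ occupied η A (t + 1) ↔ η x t (localConfig N (occupied η A t) x) = true := Iff.rfl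

lemma occupied_congr_env {η η' : Env N} {A : Set Site} {t : ℕ}
    (h : ∀ s < t, ∀ x, η x s = η' x s) : occupied η A t = occupied η' A t := by
  induction t with
  | zero => rfl
  | succ t ih =>
    have := ih fun s hs => h s (by omega)
    ext x
    rw [mem_occupied_succ, mem_occupied_succ, this, h t (by omega)]

/-- The process restarted at time `s` continues the original one. -/
lemma occupied_add (η : Env N) (A : Set Site) (s t : ℕ) :
    occupied η A (s + t) = occupied (shiftEnv 0 s η) (occupied η A s) t := by
  induction t with
  | zero => rfl
  | succ t ih =>
    ext x
    rw [← add_assoc, mem_occupied_succ, mem_occupied_succ, ih]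
    simp [shiftEnv]

lemma occupied_shift (η : Env N) (A : Set Site) (v : Site) (s t : ℕ) :
    occupied (shiftEnv v s η) {y | v + y ∈ A} t =
      {y | v + y ∈ occupied (shiftEnv 0 s η) A t} := by
  induction t with
  | zero => rfl
  | succ t ih =>
    ext x
    rw [mem_occupied_succ, ih, Set.mem_ofPred_eq, mem_occupied_succ]
    have : localConfig N {y | v + y ∈ occupied (shiftEnv 0 s η) A t} x =
        localConfig N (occupied (shiftEnv 0 s η) A t) (v + x) :=
      localConfig_congr fun y _ => by simp [add_assoc]
    rw [this]
    simp [shiftEnv]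

lemma shiftEnv_zero (η : Env N) : shiftEnv 0 0 η = η := by
  funext x t; simp [shiftEnv]

/-- Comparison of two processes: a larger initial state and larger input give larger states. -/
lemma occupied_mono {η η' : Env N} (hη' : ∀ x t, Monotone (η' x t))
    (hle : ∀ x t S, η x t S = true → η' x t S = true) {A A' : Set Site} (h : A ⊆ A') (t : ℕ) :
    occupied η A t ⊆ occupied η' A' t := by
  induction t with
  | zero => exact h
  | succ t ih =>
    intro x hx
    rw [mem_occupied_succ] at hx ⊢
    exact eq_true_of_monotone (hη' x t) (localConfig_mono fun y _ hy => ih hy) (hle _ _ _ hx)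

lemma occupied_subset {η : Env N} (hη : ∀ x t, Monotone (η x t)) {A A' : Set Site} (h : A ⊆ A')
    (t : ℕ) : occupied η A t ⊆ occupied η A' t :=
  occupied_mono hη (fun _ _ _ h => h) h t

variable {T : CellularAutomaton N}

lemma CellularAutomaton.IsAssignment.shift {η : Env N} (h : T.IsAssignment η) (v : Site) (s : ℕ) :
    T.IsAssignment (shiftEnv v s η) := fun x t => h (v + x) (s + t)

lemma CellularAutomaton.IsAssignment.monotone {η : Env N} (h : T.IsAssignment η) (x : Site)
    (t : ℕ) : Monotone (η x t) := (h x t).1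

lemma occupied_subset_succ {η : Env N} (h : T.IsAssignment η) (A : Set Site) (t : ℕ) :
    occupied η A t ⊆ occupied η A (t + 1) := by
  intro x hx
  rw [mem_occupied_succ]
  exact (h x t).2.2 _ (mem_localConfig.2 ⟨T.zero_mem, by simpa using hx⟩)

lemma occupied_monotone {η : Env N} (h : T.IsAssignment η) (A : Set Site) :
    Monotone (occupied η A) :=
  monotone_nat_of_le_succ fun t => occupied_subset_succ h A t

lemma subset_occupied {η : Env N} (h : T.IsAssignment η) (A : Set Site) (t : ℕ) :
    A ⊆ occupied η A t := occupied_monotone h A (Nat.zero_le t)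

/-- The largest assignment allowed by `T`, which drives the deterministic dynamics. -/
noncomputable def CellularAutomaton.maxEnv (T : CellularAutomaton N) : Env N :=
  fun _ _ S => open Classical in decide (T.suff S)

lemma CellularAutomaton.isAssignment_maxEnv (T : CellularAutomaton N) :
    T.IsAssignment T.maxEnv := by
  intro x t
  refine ⟨?_, ?_, ?_⟩
  · intro S S' h
    rw [Bool.le_iff_imp]
    simp only [CellularAutomaton.maxEnv, decide_eq_true_eq]
    exact T.mono _ _ h
  · intro S hS; simpa [CellularAutomaton.maxEnv] using hS
  · intro S hS; simpa [CellularAutomaton.maxEnv] using T.solidifies S hS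

lemma CellularAutomaton.iterate_step_eq (T : CellularAutomaton N) (A : Set Site) (t : ℕ) :
    T.step^[t] A = occupied T.maxEnv A t := by
  induction t with
  | zero => rfl
  | succ t ih =>
    rw [Function.iterate_succ_apply', ih]
    ext x
    rw [mem_occupied_succ]
    simp [CellularAutomaton.maxEnv, CellularAutomaton.step]

lemma occupied_subset_max {η : Env N} (h : T.IsAssignment η) {A A' : Set Site} (hA : A ⊆ A')
    (t : ℕ) : occupied η A t ⊆ occupied T.maxEnv A' t :=
  occupied_mono (T.isAssignment_maxEnv).monotone
    (fun x t S hS => by simpa [CellularAutomaton.maxEnv] using (h x t).2.1 S hS) hA t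

lemma fillsSpace_iff {A : Set Site} :
    T.FillsSpace A ↔ ∀ x, ∃ t, x ∈ occupied T.maxEnv A t := by
  simp only [CellularAutomaton.FillsSpace, CellularAutomaton.iterate_step_eq, Set.eq_univ_iff_forall,
    Set.mem_iUnion]

lemma CellularAutomaton.FillsSpace.mono {A A' : Set Site} (h : T.FillsSpace A) (hA : A ⊆ A') :
    T.FillsSpace A' := by
  rw [fillsSpace_iff] at h ⊢
  intro x
  obtain ⟨t, ht⟩ := h x
  exact ⟨t, occupied_subset T.isAssignment_maxEnv.monotone hA t ht⟩

lemma CellularAutomaton.FillsSpace.translate {A : Set Site} (h : T.FillsSpace A) (v : Site) :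
    T.FillsSpace {y | v + y ∈ A} := by
  rw [fillsSpace_iff] at h ⊢
  intro x
  obtain ⟨t, ht⟩ := h (v + x)
  refine ⟨t, ?_⟩
  have := occupied_shift T.maxEnv A v 0 t
  have e1 : shiftEnv v 0 T.maxEnv = T.maxEnv := rfl
  have e2 : shiftEnv 0 0 T.maxEnv = T.maxEnv := rfl
  rw [e1, e2] at this
  rw [this]
  exact ht

/-- The sup-norm range of the neighborhood, increased to be positive. -/
noncomputable def range (N : Finset Site) : ℕ := 1 + N.sup fun y => (y.1.natAbs + y.2.natAbs)

lemma range_pos : 0 < range N := by unfold range; omega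

lemma one_le_range : (1 : ℝ) ≤ range N := by exact_mod_cast (range_pos (N := N))

lemma norm_le_natAbs (y : Site) : ‖y‖ ≤ y.1.natAbs + y.2.natAbs := by
  rw [Prod.norm_def]
  have h1 : ‖y.1‖ = (y.1.natAbs : ℝ) := by rw [Int.norm_eq_abs, Nat.cast_natAbs]; simp
  have h2 : ‖y.2‖ = (y.2.natAbs : ℝ) := by rw [Int.norm_eq_abs, Nat.cast_natAbs]; simp
  rw [h1, h2]
  apply max_le <;> simp

lemma norm_le_range {y : Site} (hy : y ∈ N) : ‖y‖ ≤ range N := by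
  refine (norm_le_natAbs y).trans ?_
  have := Finset.le_sup (f := fun y : Site => (y.1.natAbs + y.2.natAbs)) hy
  have h2 : y.1.natAbs + y.2.natAbs ≤ range N := by unfold range; omega
  exact_mod_cast h2

/-- Finite propagation: the state in the ball of radius `R` at time `t` is determined by the data
in the ball of radius `R + t * range N`. -/
lemma occupied_local {η η' : Env N} {A A' : Set Site} {x : Site} (t : ℕ) (R : ℝ)
    (hA : ∀ y, ‖y - x‖ ≤ R + range N * t → (y ∈ A ↔ y ∈ A'))
    (hη : ∀ y, ‖y - x‖ ≤ R + range N * t → ∀ s, s < t → η y s = η' y s) :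
    ∀ y, ‖y - x‖ ≤ R → (y ∈ occupied η A t ↔ y ∈ occupied η' A' t) := by
  induction t generalizing R with
  | zero => intro y hy; exact hA y (by simpa using hy)
  | succ t ih =>
    intro y hy
    have hr : (0 : ℝ) ≤ range N := by positivity
    have := ih (R + range N) (fun z hz => hA z (by push_cast; linarith))
      (fun z hz s hs => hη z (by push_cast; linarith) s (by omega))
    rw [mem_occupied_succ, mem_occupied_succ, hη y (by push_cast; nlinarith) t (by omega)]
    rw [localConfig_congr]
    intro z hz
    apply this
    calc ‖y + z - x‖ = ‖(y - x) + z‖ := by congr 1; abel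
      _ ≤ ‖y - x‖ + ‖z‖ := norm_add_le _ _
      _ ≤ _ := add_le_add hy (norm_le_range hz)

/-- An occupied site remains occupied if only the part of the initial state within its reach is
kept. -/
lemma mem_occupied_of_local {η : Env N} (h : T.IsAssignment η) {A A' : Set Site} {x : Site} {t : ℕ}
    (hx : x ∈ occupied η A t) (hA : ∀ y, ‖y - x‖ ≤ range N * t → y ∈ A → y ∈ A') :
    x ∈ occupied η A' t := by
  have := occupied_local (η := η) (η' := η) (A := A) (A' := A ∩ {y | ‖y - x‖ ≤ range N * t})
    (x := x) t 0 (fun y hy => by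
      simp only [zero_add] at hy
      simp [hy]) (fun _ _ _ _ => rfl) x (by simp)
  refine occupied_subset h.monotone ?_ t (this.1 hx)
  rintro y ⟨h1, h2⟩
  exact hA y h2 h1

lemma occupied_empty {η : Env N} (h : T.IsAssignment η) (t : ℕ) : occupied η ∅ t = ∅ := by
  induction t with
  | zero => rfl
  | succ t ih =>
    ext x
    rw [mem_occupied_succ, ih]
    simp only [Set.mem_empty_iff_false, iff_false]
    intro hx
    refine T.contact _ ?_ ((h x t).2.1 _ hx)
    ext y
    rw [mem_localConfig]
    simp

lemma exists_near_of_mem_occupied {η : Env N} (h : T.IsAssignment η) {A : Set Site} {x : Site}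
    {t : ℕ} (hx : x ∈ occupied η A t) : ∃ a ∈ A, ‖x - a‖ ≤ range N * t := by
  by_contra! hc
  have := mem_occupied_of_local (A' := ∅) h hx (fun y hy hyA => by
    have := hc y hyA
    rw [norm_sub_rev] at this
    exact absurd hy (not_le.2 this))
  rw [occupied_empty h] at this
  exact this

/-! ### Lattice and plane -/

lemma toPlane_add (x y : Site) : toPlane (x + y) = toPlane x + toPlane y := by
  ext i; fin_cases i <;> simp [toPlane]

lemma toPlane_sub (x y : Site) : toPlane (x - y) = toPlane x - toPlane y := by
  ext i; fin_cases i <;> simp [toPlane]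

lemma toPlane_zero : toPlane 0 = 0 := by
  ext i; fin_cases i <;> simp [toPlane]

lemma norm_toPlane_le (x : Site) : ‖toPlane x‖ ≤ 2 * ‖x‖ := by
  rw [EuclideanSpace.norm_eq, Real.sqrt_le_left (by positivity)]
  simp only [toPlane, Fin.sum_univ_two, Prod.norm_def, Int.norm_eq_abs]
  simp only [Matrix.cons_val_zero, Matrix.cons_val_one, Real.norm_eq_abs, sq_abs]
  have h1 := le_max_left |(x.1 : ℝ)| |(x.2 : ℝ)|
  have h2 := le_max_right |(x.1 : ℝ)| |(x.2 : ℝ)|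
  have h3 : (x.1 : ℝ) ^ 2 ≤ (max |(x.1 : ℝ)| |(x.2 : ℝ)|) ^ 2 := by
    rw [← sq_abs]; exact pow_le_pow_left₀ (abs_nonneg _) h1 2
  have h4 : (x.2 : ℝ) ^ 2 ≤ (max |(x.1 : ℝ)| |(x.2 : ℝ)|) ^ 2 := by
    rw [← sq_abs (x.2 : ℝ)]; exact pow_le_pow_left₀ (abs_nonneg _) h2 2
  nlinarith

lemma norm_le_norm_toPlane (x : Site) : ‖x‖ ≤ ‖toPlane x‖ := by
  rw [EuclideanSpace.norm_eq]
  simp only [toPlane, Fin.sum_univ_two, Prod.norm_def, Int.norm_eq_abs]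
  simp only [Matrix.cons_val_zero, Matrix.cons_val_one, Real.norm_eq_abs, sq_abs]
  apply max_le <;> apply Real.le_sqrt_of_sq_le <;> rw [sq_abs] <;>
    nlinarith [sq_nonneg (x.1:ℝ), sq_nonneg (x.2:ℝ)]

/-- The lattice box `{x : ‖x‖ ≤ R}` in the sup norm. -/
noncomputable def box (R : ℕ) : Finset Site := Finset.Icc (-R : ℤ) R ×ˢ Finset.Icc (-R : ℤ) R

lemma mem_box {R : ℕ} {x : Site} : x ∈ box R ↔ ‖x‖ ≤ R := by
  simp only [box, Finset.mem_product, Finset.mem_Icc, Prod.norm_def, Int.norm_eq_abs, max_le_iff,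
    abs_le]
  norm_cast

lemma card_box (R : ℕ) : (box R).card = (2 * R + 1) ^ 2 := by
  simp only [box, Finset.card_product, Int.card_Icc]
  rw [sq]
  congr 1 <;> omega

lemma finite_norm_le (R : ℝ) : {x : Site | ‖x‖ ≤ R}.Finite := by
  refine (box ⌈R⌉₊).finite_toSet.subset fun x hx => ?_
  simp only [Finset.mem_coe, mem_box]
  exact le_trans hx (Nat.le_ceil R)

/-! ### Uniform local regularity -/

lemma dist_toPlane (x y : Site) : dist (toPlane x) (toPlane y) = ‖toPlane (x - y)‖ := by
  rw [dist_eq_norm, toPlane_sub]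

/-- Local regularity holds with one constant for all initial states, filling or not.
Counterexamples for larger and larger constants, cut off by finite propagation and placed far apart
together with a finite set that fills space, would form a single filling initial state that
violates local regularity. -/
theorem CellularAutomaton.LocallyRegular.uniform (hT : T.LocallyRegular)
    (hfill : ∃ A : Set Site, A.Finite ∧ T.FillsSpace A) :
    ∃ C : ℕ, ∀ (A : Set Site) (η : Env N), T.IsAssignment η → ∀ (t : ℕ), ∀ x ∈ occupied η A t,
      (∀ a ∈ A, (C : ℝ) ≤ ‖x - a‖) →
        ∃ G ⊆ occupied η A t, (∀ y ∈ G, ‖y - x‖ ≤ C) ∧ T.FillsSpace G := by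
  by_contra! hcon
  choose A η hη t x hx hdist hno using hcon
  obtain ⟨F, hFfin, hF⟩ := hfill
  obtain ⟨f, hf⟩ : ∃ f : ℤ, ∀ y ∈ F, y.1 ≤ f := by
    obtain ⟨f, hf⟩ := (hFfin.image Prod.fst).bddAbove
    exact ⟨f, fun y hy => hf ⟨y, hy, rfl⟩⟩
  -- the `n`-th counterexample is moved to the ball of radius `R n` around `Z n`; these balls lie in
  -- the disjoint vertical strips `S n ≤ y.1 < S (n + 1)`, all to the right of `F`
  let R : ℕ → ℕ := fun n => n + range N * t n
  let S : ℕ → ℤ := fun n => f + 1 + ∑ k ∈ Finset.range n, (2 * (R k : ℤ) + 1)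
  let Z : ℕ → Site := fun n => (S n + R n, 0)
  have hSsucc : ∀ n, S (n + 1) = S n + (2 * (R n : ℤ) + 1) := fun n => by
    simp only [S, Finset.sum_range_succ]; ring
  have hSmono : Monotone S := monotone_nat_of_le_succ fun n => by
    rw [hSsucc]; have : (0 : ℤ) ≤ R n := by positivity
    linarith
  have hloc : ∀ n y, ‖y - Z n‖ ≤ R n → S n ≤ y.1 ∧ y.1 < S (n + 1) := by
    intro n y hy
    have h1 : ‖(y - Z n).1‖ ≤ R n := (norm_fst_le _).trans hy
    rw [Int.norm_eq_abs] at h1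
    have h2 : |(y - Z n).1| ≤ (R n : ℤ) := by exact_mod_cast h1
    simp only [Z, Prod.fst_sub, abs_le] at h2
    rw [hSsucc]
    constructor <;> linarith [h2.1, h2.2]
  have huniq : ∀ n m y, ‖y - Z n‖ ≤ R n → ‖y - Z m‖ ≤ R m → n = m := by
    intro n m y hn hm
    have h1 := hloc n y hn
    have h2 := hloc m y hm
    rcases lt_trichotomy n m with h | h | h
    · have := hSmono (show n + 1 ≤ m from h); linarith
    · exact h
    · have := hSmono (show m + 1 ≤ n from h); linarith
  let B : Set Site := F ∪ {y | ∃ n, ‖y - Z n‖ ≤ R n ∧ (x n - Z n) + y ∈ A n}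
  classical
  let ζ : Env N := fun y s => if h : ∃ n, ‖y - Z n‖ ≤ R n then
    η h.choose ((x h.choose - Z h.choose) + y) s else T.maxEnv y s
  have hζ : T.IsAssignment ζ := by
    intro y s
    by_cases h : ∃ n, ‖y - Z n‖ ≤ R n
    · simp only [ζ, dif_pos h]; exact hη _ _ _
    · simp only [ζ, dif_neg h]; exact T.isAssignment_maxEnv _ _
  -- near `Z n` and up to time `t n` the combined process is a copy of the `n`-th one
  have hagree : ∀ n y, ‖y - Z n‖ ≤ n →
      (y ∈ occupied ζ B (t n) ↔ (x n - Z n) + y ∈ occupied (η n) (A n) (t n)) := by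
    intro n y hy
    have h1 := occupied_shift (η n) (A n) (x n - Z n) 0 (t n)
    rw [shiftEnv_zero] at h1
    have h2 := occupied_local (η := ζ) (η' := shiftEnv (x n - Z n) 0 (η n)) (A := B)
      (A' := {y | (x n - Z n) + y ∈ A n}) (x := Z n) (t n) n ?_ ?_ y hy
    · rw [h2, h1]; rfl
    · intro z hz
      have hz' : ‖z - Z n‖ ≤ R n := by simpa [R] using hz
      constructor
      · rintro (h | ⟨m, hm, hm'⟩)
        · have := hf z h
          have h3 := (hloc n z hz').1
          have h4 : S 0 ≤ S n := hSmono (Nat.zero_le n)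
          have h5 : S 0 = f + 1 := by simp [S]
          linarith
        · rw [huniq n m z hz' hm]; exact hm'
      · intro h; exact Or.inr ⟨n, hz', h⟩
    · intro z hz s _
      have hz' : ‖z - Z n‖ ≤ R n := by simpa [R] using hz
      have hex : ∃ n, ‖z - Z n‖ ≤ R n := ⟨n, hz'⟩
      have hch : hex.choose = n := huniq _ _ z hex.choose_spec hz'
      simp only [ζ, dif_pos hex, hch, shiftEnv]
      simp
  obtain ⟨C, hC⟩ := hT B (hF.mono Set.subset_union_left)
  obtain ⟨n, hn⟩ := exists_nat_ge C
  have hmem : Z n ∈ occupied ζ B (t n) := by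
    rw [hagree n (Z n) (by simp)]; simpa using hx n
  obtain ⟨G, hG, hGC, hGfill⟩ := hC ζ hζ (t n) (Z n) hmem (by
    intro a ha
    refine hn.trans (le_trans ?_ ((norm_le_norm_toPlane _).trans (dist_toPlane _ _).ge))
    by_contra! hlt
    have ha' : ‖a - Z n‖ ≤ R n := by
      rw [norm_sub_rev]
      refine hlt.le.trans ?_
      simp only [R]; push_cast
      have : (0 : ℝ) ≤ range N * t n := by positivity
      linarith
    rcases ha with h | ⟨m, hm, hm'⟩
    · have := hf a h
      have h3 := (hloc n a ha').1
      have h4 : S 0 ≤ S n := hSmono (Nat.zero_le n)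
      have h5 : S 0 = f + 1 := by simp [S]
      linarith
    · rw [← huniq n m a ha' hm] at hm'
      have := hdist n _ hm'
      rw [show x n - (x n - Z n + a) = Z n - a by abel] at this
      linarith)
  have hGn : ∀ y ∈ G, ‖y - Z n‖ ≤ n := by
    intro y hy
    have h1 := hGC y hy
    rw [dist_toPlane] at h1
    rw [norm_sub_rev]
    exact (norm_le_norm_toPlane _).trans (h1.trans hn)
  refine hno n {y | (Z n - x n) + y ∈ G} ?_ ?_ (hGfill.translate _)
  · intro y hy
    have h1 := (hagree n _ (hGn _ hy)).1 (hG hy)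
    rwa [show x n - Z n + (Z n - x n + y) = y by abel] at h1
  · intro y hy
    have := hGn _ hy
    rwa [show Z n - x n + y - Z n = y - x n by abel] at this

/-- The half-plane sites `{x : ⟨x, u⟩ ≤ b}`. -/
def halfSites (u : Plane) (b : ℝ) : Set Site := toPlane ⁻¹' halfPlane u b

lemma mem_halfSites {u : Plane} {b : ℝ} {x : Site} :
    x ∈ halfSites u b ↔ inner ℝ (toPlane x) u ≤ b := Iff.rfl

lemma abs_inner_toPlane_le {u : Plane} (hu : ‖u‖ = 1) (x : Site) :
    |inner ℝ (toPlane x) u| ≤ 2 * ‖x‖ := by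
  have := abs_real_inner_le_norm (toPlane x) u
  rw [hu, mul_one] at this
  exact this.trans (norm_toPlane_le x)

lemma inner_toPlane_add (u : Plane) (x y : Site) :
    inner ℝ (toPlane (x + y)) u = inner ℝ (toPlane x) u + inner ℝ (toPlane y) u := by
  rw [toPlane_add, inner_add_left]

lemma inner_toPlane_sub (u : Plane) (x y : Site) :
    inner ℝ (toPlane (x - y)) u = inner ℝ (toPlane x) u - inner ℝ (toPlane y) u := by
  rw [toPlane_sub, inner_sub_left]

lemma halfSites_mono {u : Plane} {b b' : ℝ} (h : b ≤ b') : halfSites u b ⊆ halfSites u b' :=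
  fun _ hx => le_trans (mem_halfSites.1 hx) h

/-- The lattice site obtained by rounding the coordinates of a point of the plane. -/
noncomputable def roundSite (z : Plane) : Site := (round (z 0), round (z 1))

lemma norm_toPlane_roundSite_sub (z : Plane) : ‖toPlane (roundSite z) - z‖ ≤ 1 := by
  rw [EuclideanSpace.norm_eq]
  refine Real.sqrt_le_iff.2 ⟨zero_le_one, ?_⟩
  simp only [Fin.sum_univ_two, Real.norm_eq_abs, sq_abs]
  have h0 := abs_sub_round (z 0)
  have h1 := abs_sub_round (z 1)
  have e0 : (toPlane (roundSite z) - z) 0 = round (z 0) - z 0 := by simp [toPlane, roundSite]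
  have e1 : (toPlane (roundSite z) - z) 1 = round (z 1) - z 1 := by simp [toPlane, roundSite]
  rw [e0, e1]
  rw [abs_sub_comm, abs_le] at h0 h1
  nlinarith

/-- A site at a prescribed position relative to a half-plane: rounding `s • u`. -/
lemma exists_site_direction {u : Plane} (hu : ‖u‖ = 1) (s : ℝ) :
    ∃ v : Site, |inner ℝ (toPlane v) u - s| ≤ 1 ∧ ‖v‖ ≤ |s| + 1 := by
  have h := norm_toPlane_roundSite_sub (s • u)
  refine ⟨roundSite (s • u), ?_, ?_⟩
  · have h1 := abs_real_inner_le_norm (toPlane (roundSite (s • u)) - s • u) u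
    rw [hu, mul_one, inner_sub_left, inner_smul_left, real_inner_self_eq_norm_sq, hu] at h1
    simp at h1
    exact h1.trans h
  · refine (norm_le_norm_toPlane _).trans ?_
    have h2 : ‖toPlane (roundSite (s • u))‖ ≤ ‖toPlane (roundSite (s • u)) - s • u‖ + ‖s • u‖ := by
      simpa using norm_add_le (toPlane (roundSite (s • u)) - s • u) (s • u)
    rw [norm_smul, hu, mul_one, Real.norm_eq_abs] at h2
    linarith

/-- Every point occupied by a process started from a half-plane is close to an occupied set that
fills space, uniformly in the direction and in the environment. -/
theorem exists_filling_near (hT : T.LocallyRegular)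
    (hfill : ∃ A : Set Site, A.Finite ∧ T.FillsSpace A) :
    ∃ C : ℕ, ∀ (u : Plane), ‖u‖ = 1 → ∀ (b : ℝ) (η : Env N), T.IsAssignment η → ∀ (t : ℕ),
      ∀ x ∈ occupied η (halfSites u b) t,
        ∃ G ⊆ occupied η (halfSites u b) t, (∀ y ∈ G, ‖y - x‖ ≤ C) ∧ T.FillsSpace G := by
  obtain ⟨C, hC⟩ := hT.uniform hfill
  obtain ⟨F, hFfin, hF⟩ := hfill
  obtain ⟨f, hf⟩ : ∃ f : ℝ, ∀ y ∈ F, ‖y‖ ≤ f := by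
    obtain ⟨f, hf⟩ := (hFfin.image norm).bddAbove
    exact ⟨f, fun y hy => hf ⟨y, hy, rfl⟩⟩
  obtain ⟨K, hK⟩ := exists_nat_ge (C + |2 * f + 1| + 1 + f)
  refine ⟨max C K, fun u hu b η hη t x hx => ?_⟩
  by_cases hfar : ∀ a ∈ halfSites u b, (C : ℝ) ≤ ‖x - a‖
  · obtain ⟨G, h1, h2, h3⟩ := hC _ η hη t x hx hfar
    exact ⟨G, h1, fun y hy => (h2 y hy).trans (by exact_mod_cast le_max_left _ _), h3⟩
  -- close to the half-plane, a translate of `F` inside the half-plane is near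
  · push Not at hfar
    obtain ⟨a, ha, hxa⟩ := hfar
    obtain ⟨v, hv1, hv2⟩ := exists_site_direction hu (-(2 * f + 1))
    rw [abs_neg] at hv2
    refine ⟨{y | -(a + v) + y ∈ F}, ?_, ?_, hF.translate _⟩
    · refine subset_trans ?_ (subset_occupied hη _ t)
      intro y hy
      have hy2 := hf _ hy
      have hy3 := (abs_le.1 (abs_inner_toPlane_le hu (-(a + v) + y))).2
      have e : y = a + (v + (-(a + v) + y)) := by abel
      rw [mem_halfSites, e, inner_toPlane_add, inner_toPlane_add]
      have := (abs_le.1 hv1).2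
      have := mem_halfSites.1 ha
      linarith
    · intro y hy
      have hy2 := hf _ hy
      refine le_trans ?_ (show (K : ℝ) ≤ _ by exact_mod_cast le_max_right C K)
      refine le_trans ?_ hK
      have e : y - x = (-(a + v) + y) + v + -(x - a) := by abel
      rw [e]
      refine (norm_add₃_le).trans ?_
      rw [norm_neg]
      linarith

/-- A uniform time within which every filling set in a given box covers another given box. -/
lemma exists_fill_time (T : CellularAutomaton N) (C R : ℕ) :
    ∃ t : ℕ, ∀ G : Set Site, (∀ y ∈ G, ‖y‖ ≤ C) → T.FillsSpace G →
      ∀ x : Site, ‖x‖ ≤ R → x ∈ occupied T.maxEnv G t := by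
  have hfin : {G : Set Site | G ⊆ {y | ‖y‖ ≤ (C : ℝ)}}.Finite := (finite_norm_le C).finite_subsets
  have hev : ∀ G ∈ {G : Set Site | G ⊆ {y | ‖y‖ ≤ (C : ℝ)}}, ∀ᶠ t in atTop,
      T.FillsSpace G → ∀ x ∈ {x : Site | ‖x‖ ≤ (R : ℝ)}, x ∈ occupied T.maxEnv G t := by
    intro G _
    by_cases hG : T.FillsSpace G
    · simp only [hG, forall_const]
      rw [Filter.eventually_all_finite (finite_norm_le R)]
      intro x _
      obtain ⟨t, ht⟩ := fillsSpace_iff.1 hG x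
      exact eventually_atTop.2 ⟨t, fun s hs => occupied_monotone T.isAssignment_maxEnv G hs ht⟩
    · exact Eventually.of_forall fun _ h => absurd h hG
  rw [← Filter.eventually_all_finite hfin] at hev
  obtain ⟨t, ht⟩ := hev.exists
  exact ⟨t, fun G hG hGf x hx => ht G hG hGf x hx⟩

variable {π : RandomRule N}

/-! ### Noise: shifts, measurability, independence -/

section Measurability

variable {Ω : Type*} [MeasurableSpace Ω]

lemma measurableSet_localConfig_eq {A : Ω → Set Site} (hA : Measurable A) (x : Site)
    (S : Config N) : MeasurableSet {ω | localConfig N (A ω) x = S} := by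
  have : {ω | localConfig N (A ω) x = S} =
      ⋂ y ∈ N, {ω | (x + y ∈ A ω ↔ y ∈ S.1)} := by
    ext ω
    simp only [Set.mem_ofPred_eq, Set.mem_iInter]
    constructor
    · rintro rfl y hy
      rw [mem_localConfig]; simp [hy]
    · intro h
      apply Subtype.ext
      ext y
      rw [mem_localConfig]
      constructor
      · rintro ⟨h1, h2⟩; exact (h y h1).1 h2
      · intro h1
        have hy : y ∈ N := Finset.mem_powerset.1 S.2 h1
        exact ⟨hy, (h y hy).2 h1⟩
  rw [this]
  refine Finset.measurableSet_biInter _ fun y _ => ?_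
  have h1 := measurableSet_setOfPred.2 (measurable_set_iff.1 hA (x + y))
  by_cases hS : y ∈ S.1
  · simpa [hS] using h1
  · have h2 : {ω | (x + y ∈ A ω ↔ y ∈ S.1)} = {ω | x + y ∈ A ω}ᶜ := by ext ω; simp [hS]
    rw [h2]
    exact h1.compl

/-- The occupied set is measurable in the initial state and the environment up to time `t`. -/
lemma measurable_occupied {η : Ω → Env N} {t : ℕ}
    (h : ∀ x, ∀ s < t, Measurable fun ω => η ω x s) {A : Ω → Set Site} (hA : Measurable A) :
    Measurable fun ω => occupied (η ω) (A ω) t := by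
  induction t with
  | zero => exact hA
  | succ t ih =>
    have ih := ih fun x s hs => h x s (by omega)
    rw [measurable_set_iff]
    intro x
    rw [← measurableSet_setOfPred]
    have : {ω | x ∈ occupied (η ω) (A ω) (t + 1)} = ⋃ S : Config N,
        {ω | localConfig N (occupied (η ω) (A ω) t) x = S} ∩ {ω | η ω x t S = true} := by
      ext ω
      simp [mem_occupied_succ]
    rw [this]
    refine MeasurableSet.iUnion fun S => (measurableSet_localConfig_eq ih x S).inter ?_
    exact (measurable_pi_iff.1 (h x t (by omega)) S) (measurableSet_singleton true)

end Measurability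

variable {Ω : Type*} [mΩ : MeasurableSpace Ω] {μ : Measure Ω}

/-- The environment realized by the noise `ξ` at `ω`. -/
abbrev envOf (ξ : Site → ℕ → Ω → Config N → Bool) (ω : Ω) : Env N := fun x t => ξ x t ω

/-- The noise seen from the space-time point `(v, s)`. -/
def shiftNoise (v : Site) (s : ℕ) (ξ : Site → ℕ → Ω → Config N → Bool) :
    Site → ℕ → Ω → Config N → Bool := fun x t => ξ (v + x) (s + t)

lemma envOf_shiftNoise (v : Site) (s : ℕ) (ξ : Site → ℕ → Ω → Config N → Bool) (ω : Ω) :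
    envOf (shiftNoise v s ξ) ω = shiftEnv v s (envOf ξ ω) := rfl

lemma IsNoise.shift {ξ : Site → ℕ → Ω → Config N → Bool} (h : IsNoise π μ ξ) (v : Site) (s : ℕ) :
    IsNoise π μ (shiftNoise v s ξ) where
  measurable x t := h.measurable _ _
  indep := by
    have := h.indep.precomp (g := fun i : Site × ℕ => (v + i.1, s + i.2))
      (by rintro ⟨a, b⟩ ⟨c, d⟩ hi; simp only [Prod.mk.injEq] at hi ⊢; exact
          ⟨add_left_cancel hi.1, by omega⟩)
    exact this
  ident x t := (h.ident _ _).trans (h.ident _ _).symm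
  bernoulli x t S := h.bernoulli _ _ S
  coupled x t := h.coupled _ _

/-- A noise all of whose realizations (not only almost all) are assignments allowed by `T`. -/
structure IsSureNoise (T : CellularAutomaton N) (π : RandomRule N) (μ : Measure Ω)
    (ξ : Site → ℕ → Ω → Config N → Bool) : Prop where
  noise : IsNoise π μ ξ
  sure : ∀ ω, T.IsAssignment (envOf ξ ω)

lemma IsSureNoise.shift {ξ : Site → ℕ → Ω → Config N → Bool} (h : IsSureNoise T π μ ξ) (v : Site)
    (s : ℕ) : IsSureNoise T π μ (shiftNoise v s ξ) :=
  ⟨h.noise.shift v s, fun ω => (h.sure ω).shift v s⟩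

lemma IsNoise.measurableSet_eq {ξ : Site → ℕ → Ω → Config N → Bool} (h : IsNoise π μ ξ)
    (x : Site) (t : ℕ) (S : Config N) (b : Bool) : MeasurableSet {ω | ξ x t ω S = b} :=
  (measurable_pi_iff.1 (h.measurable x t) S) (measurableSet_singleton b)

/-- A noise for a perturbation of `T` agrees almost surely with one whose realizations are all
assignments: replace the vectors that are not admissible by the largest admissible one. -/
theorem IsNoise.exists_sure [IsProbabilityMeasure μ] {p : ℝ} (hπ : IsPerturbation p π T)
    {ξ : Site → ℕ → Ω → Config N → Bool} (h : IsNoise π μ ξ) :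
    ∃ ξ' : Site → ℕ → Ω → Config N → Bool, IsSureNoise T π μ ξ' ∧
      ∀ᵐ ω ∂μ, envOf ξ' ω = envOf ξ ω := by
  classical
  let valid : (Config N → Bool) → Prop := fun v =>
    Monotone v ∧ (∀ S, v S = true → T.suff S) ∧ ∀ S : Config N, (0 : Site) ∈ S.1 → v S = true
  let clean : (Config N → Bool) → (Config N → Bool) := fun v =>
    if valid v then v else T.maxEnv 0 0
  have hclean : Measurable clean := measurable_of_finite _
  have hvalid : ∀ x t, ∀ᵐ ω ∂μ, valid (ξ x t ω) := by
    intro x t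
    have h2 : ∀ S, ∀ᵐ ω ∂μ, ξ x t ω S = true → T.suff S := by
      intro S
      by_cases hS : T.suff S
      · simp [hS]
      · have h0 : π.prob S = 0 :=
          le_antisymm (not_lt.1 fun hlt => hS ((hπ.1 S).2 hlt)) (π.nonneg S)
        have h1 := h.bernoulli x t S
        rw [h0, measureReal_eq_zero_iff] at h1
        have : ∀ᵐ ω ∂μ, ¬ (ξ x t ω S = true) := by
          rw [ae_iff]; simpa using h1
        filter_upwards [this] with ω hω h3
        exact absurd h3 hω
    have h3 : ∀ S : Config N, ∀ᵐ ω ∂μ, (0 : Site) ∈ S.1 → ξ x t ω S = true := by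
      intro S
      by_cases hS : (0 : Site) ∈ S.1
      · have h1 := h.bernoulli x t S
        rw [π.solidifies S hS] at h1
        have h4 : μ {ω | ξ x t ω S = true} = 1 := by
          rw [← ofReal_measureReal, h1]; simp
        have := (prob_compl_eq_zero_iff (h.measurableSet_eq x t S true)).2 h4
        filter_upwards [compl_mem_ae_iff.2 this] with ω hω _
        simpa using hω
      · simp [hS]
    filter_upwards [h.coupled x t, ae_all_iff.2 h2, ae_all_iff.2 h3] with ω a b c
    exact ⟨a, b, c⟩
  have hae : ∀ x t, (fun ω => clean (ξ x t ω)) =ᵐ[μ] ξ x t := by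
    intro x t
    filter_upwards [hvalid x t] with ω hω
    simp [clean, hω]
  have hsure : ∀ v, valid (clean v) := by
    intro v
    by_cases hv : valid v
    · simpa only [clean, if_pos hv] using hv
    · simp only [clean, if_neg hv]; exact T.isAssignment_maxEnv 0 0
  refine ⟨fun x t ω => clean (ξ x t ω), ⟨⟨?_, ?_, ?_, ?_, ?_⟩, ?_⟩, ?_⟩
  · exact fun x t => hclean.comp (h.measurable x t)
  · exact h.indep.comp (fun _ => clean) (fun _ => hclean)
  · exact fun x t => (h.ident x t).comp hclean
  · intro x t S
    rw [← h.bernoulli x t S]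
    apply measureReal_congr
    filter_upwards [hae x t] with ω hω
    change (clean (ξ x t ω) S = true) = (ξ x t ω S = true)
    rw [hω]
  · exact fun x t => Eventually.of_forall fun ω => (hsure _).1
  · exact fun ω x t => hsure _
  · have : ∀ᵐ ω ∂μ, ∀ x t, clean (ξ x t ω) = ξ x t ω :=
      ae_all_iff.2 fun x => ae_all_iff.2 fun t => hae x t
    filter_upwards [this] with ω hω
    funext x t
    exact hω x t

/-- The σ-algebra generated by the noise at the space-time points of `I`. -/
@[reducible] def noiseσ (ξ : Site → ℕ → Ω → Config N → Bool) (I : Set (Site × ℕ)) :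
    MeasurableSpace Ω :=
  ⨆ i ∈ I, MeasurableSpace.comap (ξ i.1 i.2) inferInstance

lemma noiseσ_mono (ξ : Site → ℕ → Ω → Config N → Bool) {I J : Set (Site × ℕ)} (h : I ⊆ J) :
    noiseσ ξ I ≤ noiseσ ξ J := biSup_mono h

lemma measurable_noiseσ {ξ : Site → ℕ → Ω → Config N → Bool} {I : Set (Site × ℕ)} {x : Site}
    {t : ℕ} (h : (x, t) ∈ I) : Measurable[noiseσ ξ I] (ξ x t) :=
  Measurable.of_comap_le (le_iSup₂_of_le (x, t) h le_rfl)

lemma IsNoise.indep_noiseσ {ξ : Site → ℕ → Ω → Config N → Bool} (h : IsNoise π μ ξ)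
    {I J : Set (Site × ℕ)} (hIJ : Disjoint I J) : Indep (noiseσ ξ I) (noiseσ ξ J) μ :=
  indep_iSup_of_disjoint (m := fun i : Site × ℕ => MeasurableSpace.comap (ξ i.1 i.2) inferInstance)
    (fun i => (h.measurable i.1 i.2).comap_le) ((iIndepFun_iff_iIndep _ _ _).1 h.indep) hIJ

/-- The space-time points before time `s`. -/
def before (s : ℕ) : Set (Site × ℕ) := {i | i.2 < s}

/-- The space-time points at time `s` or later. -/
def after (s : ℕ) : Set (Site × ℕ) := {i | s ≤ i.2}

lemma disjoint_before_after (s : ℕ) : Disjoint (before s) (after s) := by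
  rw [Set.disjoint_left]
  intro i hi hi'
  simp only [before, after, Set.mem_ofPred_eq] at hi hi'
  omega

lemma before_mono {s t : ℕ} (h : s ≤ t) : before s ⊆ before t := fun i hi => by
  simp only [before, Set.mem_ofPred_eq] at hi ⊢; omega

lemma measurable_occupied_before (ξ : Site → ℕ → Ω → Config N → Bool) (v : Site) (s t : ℕ)
    (A : Set Site) : Measurable[noiseσ ξ (before (s + t))]
      (fun ω => occupied (envOf (shiftNoise v s ξ) ω) A t) := by
  refine @measurable_occupied N Ω (noiseσ ξ (before (s + t))) _ t ?_ _ (@measurable_const _ _ _ _ _)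
  intro x r hr
  exact measurable_noiseσ (ξ := ξ) (I := before (s + t)) (x := v + x) (t := s + r)
    (by simp only [before, Set.mem_ofPred_eq]; omega)

lemma measurable_occupied_before' (ξ : Site → ℕ → Ω → Config N → Bool) (t : ℕ)
    (A : Set Site) : Measurable[noiseσ ξ (before t)] (fun ω => occupied (envOf ξ ω) A t) := by
  have := measurable_occupied_before ξ 0 0 t A
  rw [zero_add] at this
  simpa only [envOf_shiftNoise, shiftEnv_zero] using this

lemma measurable_occupied_after (ξ : Site → ℕ → Ω → Config N → Bool) (v : Site) (s t : ℕ)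
    (A : Set Site) : Measurable[noiseσ ξ (after s)]
      (fun ω => occupied (envOf (shiftNoise v s ξ) ω) A t) := by
  refine @measurable_occupied N Ω (noiseσ ξ (after s)) _ t ?_ _ (@measurable_const _ _ _ _ _)
  intro x r hr
  exact measurable_noiseσ (ξ := ξ) (I := after s) (x := v + x) (t := s + r)
    (by simp only [after, Set.mem_ofPred_eq]; omega)

lemma IsNoise.measurable_envOf {ξ : Site → ℕ → Ω → Config N → Bool} (h : IsNoise π μ ξ) :
    Measurable (envOf ξ) :=
  measurable_pi_iff.2 fun x => measurable_pi_iff.2 fun t => h.measurable x t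

lemma IsNoise.measurable_occupied {ξ : Site → ℕ → Ω → Config N → Bool} (h : IsNoise π μ ξ)
    (A : Set Site) (t : ℕ) : Measurable fun ω => occupied (envOf ξ ω) A t :=
  RandomGrowth.measurable_occupied (fun x s _ => h.measurable x s) measurable_const

lemma IsNoise.measurableSet_mem {ξ : Site → ℕ → Ω → Config N → Bool} (h : IsNoise π μ ξ)
    (A : Set Site) (t : ℕ) (x : Site) : MeasurableSet {ω | x ∈ occupied (envOf ξ ω) A t} :=
  measurableSet_setOfPred.2 (measurable_set_iff.1 (h.measurable_occupied A t) x)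

/-- Events of the past and of the future are independent. -/
lemma IsNoise.real_inter_eq_mul {ξ : Site → ℕ → Ω → Config N → Bool} (h : IsNoise π μ ξ) {s : ℕ}
    {E F : Set Ω} (hE : MeasurableSet[noiseσ ξ (before s)] E)
    (hF : MeasurableSet[noiseσ ξ (after s)] F) : μ.real (E ∩ F) = μ.real E * μ.real F := by
  have := (Indep_iff _ _ μ).1 (h.indep_noiseσ (disjoint_before_after s)) E F hE hF
  simp only [measureReal_def, this, ENNReal.toReal_mul]

variable [IsProbabilityMeasure μ]

/-- The law of the whole environment is invariant under space-time shifts. -/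
lemma IsNoise.map_shift {ξ : Site → ℕ → Ω → Config N → Bool} (h : IsNoise π μ ξ) (v : Site)
    (s : ℕ) : Measure.map (envOf (shiftNoise v s ξ)) μ = Measure.map (envOf ξ) μ := by
  have key : ∀ ζ : Site → ℕ → Ω → Config N → Bool, IsNoise π μ ζ →
      (∀ x t, IdentDistrib (ζ x t) (ξ 0 0) μ μ) →
      Measure.map (fun ω (i : Site × ℕ) => ζ i.1 i.2 ω) μ =
        Measure.infinitePi fun _ => Measure.map (ξ 0 0) μ := by
    intro ζ hζ hid
    rw [(iIndepFun_iff_map_fun_eq_infinitePi_map fun i : Site × ℕ => hζ.measurable i.1 i.2).1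
      hζ.indep]
    congr 1
    funext i
    exact (hid i.1 i.2).map_eq
  have hcurry : ∀ ζ : Site → ℕ → Ω → Config N → Bool, IsNoise π μ ζ → Measure.map (envOf ζ) μ =
      Measure.map (fun (f : Site × ℕ → Config N → Bool) (x : Site) (t : ℕ) => f (x, t))
        (Measure.map (fun ω (i : Site × ℕ) => ζ i.1 i.2 ω) μ) := by
    intro ζ hζ
    rw [Measure.map_map]
    · rfl
    · exact measurable_pi_iff.2 fun x => measurable_pi_iff.2 fun t => measurable_pi_apply _
    · exact measurable_pi_iff.2 fun i => hζ.measurable i.1 i.2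
  rw [hcurry _ (h.shift v s), hcurry _ h, key _ (h.shift v s), key _ h h.ident]
  exact fun x t => h.ident _ _

/-- The Markov property at time `1`. -/
theorem IsNoise.integral_markov {ξ : Site → ℕ → Ω → Config N → Bool} (h : IsNoise π μ ξ)
    (A : Set Site) {f : Set Site × Env N → ℝ} (hf : Measurable f) (C : ℝ) (hC : ∀ z, |f z| ≤ C) :
    ∫ ω, f (occupied (envOf ξ ω) A 1, shiftEnv 0 1 (envOf ξ ω)) ∂μ =
      ∫ ω, ∫ ω', f (occupied (envOf ξ ω) A 1, envOf ξ ω') ∂μ ∂μ := by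
  have hB := h.measurable_occupied A 1
  have hS : Measurable (envOf (shiftNoise 0 1 ξ)) := (h.shift 0 1).measurable_envOf
  have hind : IndepFun (fun ω => occupied (envOf ξ ω) A 1) (envOf (shiftNoise 0 1 ξ)) μ := by
    refine indep_of_indep_of_le_left (indep_of_indep_of_le_right
      (h.indep_noiseσ (disjoint_before_after 1)) ?_) ?_
    · apply Measurable.comap_le
      refine @measurable_pi_iff _ _ _ (_) _ _ |>.2 fun x =>
        @measurable_pi_iff _ _ _ (_) _ _ |>.2 fun t => ?_
      exact measurable_noiseσ (ξ := ξ) (I := after 1) (x := 0 + x) (t := 1 + t)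
        (by simp only [after, Set.mem_ofPred_eq]; omega)
    · apply Measurable.comap_le
      have := measurable_occupied_before ξ 0 0 1 A
      simp only [envOf_shiftNoise, shiftEnv_zero] at this
      exact this
  have hmap := (indepFun_iff_map_prod_eq_prod_map_map hB.aemeasurable hS.aemeasurable).1 hind
  rw [h.map_shift 0 1] at hmap
  have : IsProbabilityMeasure (Measure.map (fun ω => occupied (envOf ξ ω) A 1) μ) :=
    Measure.isProbabilityMeasure_map hB.aemeasurable
  have : IsProbabilityMeasure (Measure.map (envOf ξ) μ) :=
    Measure.isProbabilityMeasure_map h.measurable_envOf.aemeasurable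
  calc ∫ ω, f (occupied (envOf ξ ω) A 1, shiftEnv 0 1 (envOf ξ ω)) ∂μ
      = ∫ z, f z ∂(Measure.map (fun ω => (occupied (envOf ξ ω) A 1,
          envOf (shiftNoise 0 1 ξ) ω)) μ) := by
        rw [integral_map (hB.prodMk hS).aemeasurable hf.aestronglyMeasurable]; rfl
    _ = ∫ B, ∫ e, f (B, e) ∂(Measure.map (envOf ξ) μ)
          ∂(Measure.map (fun ω => occupied (envOf ξ ω) A 1) μ) := by
        rw [hmap, integral_prod]
        exact Integrable.of_bound hf.aestronglyMeasurable C
          (Eventually.of_forall fun z => by simpa using hC z)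
    _ = ∫ ω, ∫ e, f (occupied (envOf ξ ω) A 1, e) ∂(Measure.map (envOf ξ) μ) ∂μ := by
        rw [integral_map hB.aemeasurable]
        exact (hf.stronglyMeasurable.integral_prod_right').aestronglyMeasurable
    _ = _ := by
        congr 1; funext ω
        rw [integral_map h.measurable_envOf.aemeasurable]
        exact (hf.comp measurable_prodMk_left).aestronglyMeasurable

/-- Each site consults only one of its variables in the first step, so the states of different
sites at time `1` are independent. -/
lemma IsNoise.map_occupied_one_eq_infinitePi {ξ : Site → ℕ → Ω → Config N → Bool}
    (h : IsNoise π μ ξ) (A : Set Site) :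
    Measure.map (fun ω => occupied (envOf ξ ω) A 1) μ =
      Measure.map (fun b : Site → Bool => {x | b x = true}) (Measure.infinitePi fun x =>
        Measure.map (fun ω => ξ x 0 ω (localConfig N A x)) μ) := by
  have h1 := h.indep.precomp (g := fun x : Site => (x, 0)) (fun x y hxy => by simpa using hxy)
  have h2 := h1.comp (fun x (f : Config N → Bool) => f (localConfig N A x))
    (fun x => measurable_pi_apply _)
  have hm : ∀ x, Measurable (fun ω => ξ x 0 ω (localConfig N A x)) := fun x =>
    measurable_pi_iff.1 (h.measurable x 0) _
  have h3 := (iIndepFun_iff_map_fun_eq_infinitePi_map hm).1 h2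
  rw [← h3, Measure.map_map]
  · rfl
  · rw [measurable_set_iff]
    intro x
    rw [← measurableSet_setOfPred]
    exact measurableSet_eq_fun (measurable_pi_apply x) measurable_const
  · exact measurable_pi_iff.2 hm

/-- The one-step law from a given state depends only on the rule, not on the way in which the
variables of different configurations are coupled. -/
lemma map_occupied_one {Ω' : Type*} [MeasurableSpace Ω'] {μ' : Measure Ω'} [IsProbabilityMeasure μ']
    {ξ : Site → ℕ → Ω → Config N → Bool} {ξ' : Site → ℕ → Ω' → Config N → Bool}
    (h : IsNoise π μ ξ) (h' : IsNoise π μ' ξ') (A : Set Site) :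
    Measure.map (fun ω => occupied (envOf ξ ω) A 1) μ =
      Measure.map (fun ω => occupied (envOf ξ' ω) A 1) μ' := by
  rw [h.map_occupied_one_eq_infinitePi, h'.map_occupied_one_eq_infinitePi]
  congr 2
  funext x
  have hm : Measurable (fun ω => ξ x 0 ω (localConfig N A x)) :=
    measurable_pi_iff.1 (h.measurable x 0) _
  have hm' : Measurable (fun ω => ξ' x 0 ω (localConfig N A x)) :=
    measurable_pi_iff.1 (h'.measurable x 0) _
  have hp : Measure.map (fun ω => ξ x 0 ω (localConfig N A x)) μ {true} =
      Measure.map (fun ω => ξ' x 0 ω (localConfig N A x)) μ' {true} := by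
    rw [Measure.map_apply hm (measurableSet_singleton _),
      Measure.map_apply hm' (measurableSet_singleton _)]
    have e1 := h.bernoulli x 0 (localConfig N A x)
    have e2 := h'.bernoulli x 0 (localConfig N A x)
    rw [← e2, measureReal_def, measureReal_def, ENNReal.toReal_eq_toReal_iff' (by simp) (by simp)]
      at e1
    exact e1
  have hprob := Measure.isProbabilityMeasure_map (μ := μ) hm.aemeasurable
  have hprob' := Measure.isProbabilityMeasure_map (μ := μ') hm'.aemeasurable
  refine Measure.ext_of_singleton fun b => ?_
  cases b
  · have hc : ({false} : Set Bool) = {true}ᶜ := by ext b; cases b <;> simp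
    rw [hc, prob_compl_eq_one_sub (measurableSet_singleton _),
      prob_compl_eq_one_sub (measurableSet_singleton _), hp]
  · exact hp

/-- Conditioning on the first step. -/
lemma IsNoise.real_occupied_succ {ξ : Site → ℕ → Ω → Config N → Bool}
    (h : IsNoise π μ ξ) {E : Set (Set Site)} (hE : MeasurableSet E) (t : ℕ) (A : Set Site) :
    μ.real {ω | occupied (envOf ξ ω) A (t + 1) ∈ E} =
      ∫ B, μ.real {ω | occupied (envOf ξ ω) B t ∈ E}
        ∂(Measure.map (fun ω => occupied (envOf ξ ω) A 1) μ) := by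
  classical
  let f : Set Site × Env N → ℝ := fun z => if occupied z.2 z.1 t ∈ E then 1 else 0
  have hset : MeasurableSet {z : Set Site × Env N | occupied z.2 z.1 t ∈ E} := by
    have : Measurable fun z : Set Site × Env N => occupied z.2 z.1 t :=
      RandomGrowth.measurable_occupied (fun x s _ => by fun_prop) measurable_fst
    exact this hE
  have hf : Measurable f := Measurable.ite hset measurable_const measurable_const
  have hC : ∀ z, |f z| ≤ 1 := fun z => by
    simp only [f]; split_ifs <;> simp
  have h1 := h.integral_markov A hf 1 hC
  have hind : ∀ (B : Set Site) (s : ℕ), μ.real {ω | occupied (envOf ξ ω) B s ∈ E} =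
      ∫ ω, (if occupied (envOf ξ ω) B s ∈ E then (1 : ℝ) else 0) ∂μ := by
    intro B s
    have := integral_indicator_one (μ := μ) ((h.measurable_occupied B s) hE)
    refine Eq.trans ?_ (this.symm.trans ?_)
    · rfl
    · congr 1
  simp only [f, ← occupied_add] at h1
  rw [add_comm 1 t, ← hind] at h1
  simp only [← hind] at h1
  rw [integral_map (h.measurable_occupied A 1).aemeasurable, ← h1]
  have : StronglyMeasurable fun B => ∫ ω', f (B, envOf ξ ω') ∂μ := by
    have hg : Measurable fun z : Set Site × Ω => f (z.1, envOf ξ z.2) :=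
      hf.comp (measurable_fst.prodMk (h.measurable_envOf.comp measurable_snd))
    exact hg.stronglyMeasurable.integral_prod_right'
  simp only [f, ← hind] at this
  exact this.aestronglyMeasurable

/-- The law of `A_t` depends only on the rule and the initial state. -/
theorem real_occupied_eq {Ω' : Type*} [MeasurableSpace Ω'] {μ' : Measure Ω'}
    [IsProbabilityMeasure μ']
    {ξ : Site → ℕ → Ω → Config N → Bool} {ξ' : Site → ℕ → Ω' → Config N → Bool}
    (h : IsNoise π μ ξ) (h' : IsNoise π μ' ξ') {E : Set (Set Site)} (hE : MeasurableSet E) (t : ℕ)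
    (A : Set Site) : μ.real {ω | occupied (envOf ξ ω) A t ∈ E} =
      μ'.real {ω | occupied (envOf ξ' ω) A t ∈ E} := by
  induction t generalizing A with
  | zero => by_cases hA : A ∈ E <;> simp [occupied, hA]
  | succ t ih =>
    rw [h.real_occupied_succ hE, h'.real_occupied_succ hE, map_occupied_one h h']
    simp only [ih]

/-! ### Filling sets cover their surroundings quickly -/

lemma measurableSet_forall_mem (P : Site → Prop) :
    MeasurableSet {B : Set Site | ∀ y, P y → y ∈ B} := by
  have : {B : Set Site | ∀ y, P y → y ∈ B} = ⋂ y : {y // P y}, {B | (y : Site) ∈ B} := by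
    ext B; simp
  rw [this]
  exact MeasurableSet.iInter fun y => measurableSet_setOfPred.2
    (measurable_set_iff.1 measurable_id (y : Site))

/-- A finite pattern of values of the noise, with one configuration per space-time point, has at
least the product of the single probabilities. -/
lemma IsNoise.pow_card_le_pattern {ξ : Site → ℕ → Ω → Config N → Bool} (h : IsNoise π μ ξ)
    (W : Finset (Site × ℕ)) (S : Site × ℕ → Config N) (b : Site × ℕ → Bool) {q : ℝ} (hq : 0 ≤ q)
    (hW : ∀ i ∈ W, q ≤ μ.real {ω | ξ i.1 i.2 ω (S i) = b i}) :
    q ^ W.card ≤ μ.real {ω | ∀ i ∈ W, ξ i.1 i.2 ω (S i) = b i} := by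
  have h1 := h.indep.measure_inter_preimage_eq_mul W
    (sets := fun i => {f : Config N → Bool | f (S i) = b i})
    (fun i _ => measurableSet_eq_fun (measurable_pi_apply _) measurable_const)
  have h2 : {ω | ∀ i ∈ W, ξ i.1 i.2 ω (S i) = b i} =
      ⋂ i ∈ W, (fun ω => ξ i.1 i.2 ω) ⁻¹' {f : Config N → Bool | f (S i) = b i} := by
    ext ω; simp
  rw [h2, measureReal_def, h1, ENNReal.toReal_prod, ← Finset.prod_const]
  exact Finset.prod_le_prod (fun _ _ => hq) fun i hi => hW i hi

/-- A filling set covers a given box within a fixed time with a probability that is bounded below: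
the process dominates the deterministic one if, at each site and time, the variable of the
configuration that the deterministic process sees equals `1` whenever that is possible. -/
lemma exists_try (hπ : ∃ p, IsPerturbation p π T) (C R : ℕ) :
    ∃ (t₁ : ℕ) (q : ℝ), 0 < q ∧ ∀ ξ : Site → ℕ → Ω → Config N → Bool, IsSureNoise T π μ ξ →
      ∀ G : Set Site, (∀ y ∈ G, ‖y‖ ≤ C) → T.FillsSpace G →
        q ≤ μ.real {ω | ∀ x, ‖x‖ ≤ R → x ∈ occupied (envOf ξ ω) G t₁} := by
  obtain ⟨p, hp⟩ := hπ
  obtain ⟨t₁, ht₁⟩ := exists_fill_time T C R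
  have hp0 : 0 < p := hp.2.1.1
  have hp1 : p ≤ 1 := by
    obtain ⟨S, hS⟩ := hp.2.1.2
    exact hS ▸ π.le_one S
  let M : ℕ := C + range N * t₁
  refine ⟨t₁, p ^ (box M ×ˢ Finset.range t₁).card, by positivity, fun ξ hξ G hGC hG => ?_⟩
  classical
  let D : ℕ → Set Site := occupied T.maxEnv G
  let W : Finset (Site × ℕ) := (box M ×ˢ Finset.range t₁).filter fun i => i.1 ∈ D (i.2 + 1)
  have hW : ∀ x, ∀ s < t₁, x ∈ D (s + 1) → (x, s) ∈ W := by
    intro x s hs hx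
    simp only [W, Finset.mem_filter, Finset.mem_product, Finset.mem_range, mem_box]
    refine ⟨⟨?_, hs⟩, hx⟩
    obtain ⟨a, ha, hxa⟩ := exists_near_of_mem_occupied T.isAssignment_maxEnv hx
    have h1 : ‖x‖ ≤ ‖x - a‖ + ‖a‖ := by simpa using norm_add_le (x - a) a
    have h2 := hGC a ha
    have h3 : ((s + 1 : ℕ) : ℝ) ≤ t₁ := by exact_mod_cast hs
    have h4 : (range N : ℝ) * ((s + 1 : ℕ) : ℝ) ≤ range N * t₁ := by gcongr
    simp only [M]; push_cast at *; linarith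
  have hpat := hξ.noise.pow_card_le_pattern W (fun i => localConfig N (D i.2) i.1)
    (fun _ => true) hp0.le (by
      intro i hi
      rw [hξ.noise.bernoulli]
      have h1 : i.1 ∈ D (i.2 + 1) := (Finset.mem_filter.1 hi).2
      rw [mem_occupied_succ] at h1
      have h2 : T.suff (localConfig N (D i.2) i.1) :=
        (T.isAssignment_maxEnv _ _).2.1 _ h1
      exact hp.2.2 ⟨(hp.1 _).1 h2, _, rfl⟩)
  refine le_trans (pow_le_pow_of_le_one hp0.le hp1 (Finset.card_filter_le _ _)) (hpat.trans ?_)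
  refine measureReal_mono (fun ω hω x hx => ?_)
  have key : ∀ s ≤ t₁, D s ⊆ occupied (envOf ξ ω) G s := by
    intro s
    induction s with
    | zero => intro _ y hy; exact hy
    | succ s ih =>
      intro hs y hy
      rw [mem_occupied_succ]
      exact eq_true_of_monotone ((hξ.sure ω).monotone y s)
        (localConfig_mono fun z _ hz => ih (by omega) hz) (hω (y, s) (hW y s (by omega) hy))
  exact key t₁ le_rfl (ht₁ G hGC hG x hx)

/-- A filling set covers its surroundings within `J` rounds, up to an error exponentially small
in `J`. -/
theorem exists_tries (hπ : ∃ p, IsPerturbation p π T) (C R : ℕ) :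
    ∃ (t₁ : ℕ) (q : ℝ), 0 < t₁ ∧ 0 ≤ q ∧ q < 1 ∧
      ∀ ξ : Site → ℕ → Ω → Config N → Bool, IsSureNoise T π μ ξ →
      ∀ (A : Set Site) (x : Site), (∃ G ⊆ A, (∀ y ∈ G, ‖y - x‖ ≤ C) ∧ T.FillsSpace G) → ∀ J : ℕ,
        μ.real {ω | ¬ ∀ y, ‖y - x‖ ≤ R → y ∈ occupied (envOf ξ ω) A (J * t₁)} ≤ q ^ J := by
  obtain ⟨t₀, q₀, hq₀, htry⟩ := exists_try (μ := μ) hπ C R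
  have hmeasE := measurableSet_forall_mem (fun y : Site => ‖y‖ ≤ R)
  refine ⟨t₀ + 1, 1 - min q₀ 1, by omega, by simp, by simp [hq₀], ?_⟩
  rintro ξ hξ A x ⟨G, hGA, hGC, hG⟩ J
  set t₁ := t₀ + 1
  induction J with
  | zero => simp
  | succ J ih =>
    let G' : Set Site := {y | x + y ∈ G}
    have hG'C : ∀ y ∈ G', ‖y‖ ≤ C := fun y hy => by
      have := hGC _ hy
      rwa [add_sub_cancel_left] at this
    have hshift := hξ.shift x (J * t₁)
    have h1 := htry _ hshift G' hG'C (hG.translate x)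
    have hsub : {ω | ¬ ∀ y, ‖y - x‖ ≤ R → y ∈ occupied (envOf ξ ω) A ((J + 1) * t₁)} ⊆
        {ω | ¬ ∀ y, ‖y - x‖ ≤ R → y ∈ occupied (envOf ξ ω) A (J * t₁)} ∩
        {ω | ∀ y, ‖y‖ ≤ R → y ∈ occupied (envOf (shiftNoise x (J * t₁) ξ) ω) G' t₁}ᶜ := by
      intro ω hω
      refine ⟨fun hc => hω fun y hy => ?_, fun hc => hω fun y hy => ?_⟩
      · exact occupied_monotone (hξ.sure ω) A (by rw [add_one_mul]; omega) (hc y hy)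
      · have h2 := hc (-x + y) (by rwa [neg_add_eq_sub])
        rw [envOf_shiftNoise, occupied_shift] at h2
        have h3 : y ∈ occupied (shiftEnv 0 (J * t₁) (envOf ξ ω)) G t₁ := by
          simpa using h2
        rw [add_one_mul, occupied_add]
        exact occupied_subset ((hξ.sure ω).shift _ _).monotone
          (hGA.trans (subset_occupied (hξ.sure ω) A _)) _ h3
    have hm1 : MeasurableSet[noiseσ ξ (before (J * t₁))]
        {ω | ¬ ∀ y, ‖y - x‖ ≤ R → y ∈ occupied (envOf ξ ω) A (J * t₁)} := by
      have := (measurable_occupied_before' ξ (J * t₁) A)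
        (measurableSet_forall_mem (fun y : Site => ‖y - x‖ ≤ R)).compl
      exact this
    have hm2 : MeasurableSet[noiseσ ξ (after (J * t₁))]
        {ω | ∀ y, ‖y‖ ≤ R → y ∈ occupied (envOf (shiftNoise x (J * t₁) ξ) ω) G' t₁}ᶜ :=
      (measurable_occupied_after ξ x (J * t₁) t₁ G') hmeasE.compl
    refine (measureReal_mono hsub (measure_ne_top _ _)).trans ?_
    rw [hξ.noise.real_inter_eq_mul hm1 hm2, pow_succ]
    refine mul_le_mul ih ?_ measureReal_nonneg (pow_nonneg (by simp) _)
    have hm3 : MeasurableSet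
        {ω | ∀ y, ‖y‖ ≤ R → y ∈ occupied (envOf (shiftNoise x (J * t₁) ξ) ω) G' t₁} :=
      (hshift.noise.measurable_occupied G' t₁) hmeasE
    rw [probReal_compl_eq_one_sub hm3]
    have h2 : μ.real {ω | ∀ y, ‖y‖ ≤ R → y ∈ occupied (envOf (shiftNoise x (J * t₁) ξ) ω) G' t₀}
        ≤ μ.real {ω | ∀ y, ‖y‖ ≤ R → y ∈ occupied (envOf (shiftNoise x (J * t₁) ξ) ω) G' t₁} :=
      measureReal_mono fun ω hω y hy => occupied_subset_succ (hshift.sure ω) _ _ (hω y hy)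
    have := min_le_left q₀ 1
    exact sub_le_sub_left (this.trans (h1.trans h2)) 1

/-! ### Counting defects -/

section Defects

variable {I : Type*}

open Classical in
/-- The largest number of defects along a backward path from `i` at time `n`: a step from time `n`
to `n + 1` at `i` has a defect if `Bad n i k` occurs, `k` being the largest number of
defects among the neighbors of `i` so far. -/
noncomputable def defectCount (nbr : I → Finset I) (Bad : ℕ → I → ℕ → Set Ω) : ℕ → I → Ω → ℕ
  | 0, _, _ => 0
  | n + 1, i, ω => ((nbr i).sup fun j => defectCount nbr Bad n j ω) +
      if ω ∈ Bad n i ((nbr i).sup fun j => defectCount nbr Bad n j ω) then 1 else 0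

variable {nbr : I → Finset I} {Bad : ℕ → I → ℕ → Set Ω}

lemma defectCount_succ_of_mem {n : ℕ} {i : I} {ω : Ω}
    (h : ω ∈ Bad n i ((nbr i).sup fun j => defectCount nbr Bad n j ω)) :
    defectCount nbr Bad (n + 1) i ω = ((nbr i).sup fun j => defectCount nbr Bad n j ω) + 1 := by
  rw [defectCount, if_pos h]

lemma defectCount_succ_of_notMem {n : ℕ} {i : I} {ω : Ω}
    (h : ω ∉ Bad n i ((nbr i).sup fun j => defectCount nbr Bad n j ω)) :
    defectCount nbr Bad (n + 1) i ω = (nbr i).sup fun j => defectCount nbr Bad n j ω := by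
  rw [defectCount, if_neg h, add_zero]

lemma defectCount_le (n : ℕ) (i : I) (ω : Ω) : defectCount nbr Bad n i ω ≤ n := by
  induction n generalizing i with
  | zero => simp [defectCount]
  | succ n ih =>
    rw [defectCount]
    have : ((nbr i).sup fun j => defectCount nbr Bad n j ω) ≤ n := Finset.sup_le fun j _ => ih j
    split_ifs <;> omega

lemma measurable_finset_sup {Ω I : Type*} [MeasurableSpace Ω] (s : Finset I) (f : I → Ω → ℕ)
    (h : ∀ j, Measurable (f j)) : Measurable fun ω => s.sup fun j => f j ω := by
  classical
  induction s using Finset.induction_on with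
  | empty => simp
  | insert a s ha ih =>
    simp only [Finset.sup_insert]
    exact (h a).max ih

open Classical in
lemma measurable_add_ite {Ω : Type*} [MeasurableSpace Ω] {f : Ω → ℕ} (hf : Measurable f)
    {s : Set Ω} (hs : MeasurableSet s) : Measurable fun ω => f ω + if ω ∈ s then 1 else 0 :=
  hf.add (Measurable.ite hs measurable_const measurable_const)

lemma measurable_defectCount {F : ℕ → MeasurableSpace Ω} (hF : Monotone F)
    (hBad : ∀ n i k, MeasurableSet[F (n + 1)] (Bad n i k)) (n : ℕ) (i : I) :
    Measurable[F n] (defectCount nbr Bad n i) := by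
  classical
  induction n generalizing i with
  | zero =>
    have : defectCount nbr Bad 0 i = fun _ => 0 := by funext ω; rfl
    rw [this]
    exact @measurable_const _ _ _ (F 0) _
  | succ n ih =>
    have hsup : Measurable[F (n + 1)] fun ω => (nbr i).sup fun j => defectCount nbr Bad n j ω :=
      @measurable_finset_sup Ω I (F (n + 1)) (nbr i) (fun j => defectCount nbr Bad n j)
        fun j => (ih j).mono (hF (Nat.le_succ n)) le_rfl
    have hset : MeasurableSet[F (n + 1)]
        {ω | ω ∈ Bad n i ((nbr i).sup fun j => defectCount nbr Bad n j ω)} := by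
      have : {ω | ω ∈ Bad n i ((nbr i).sup fun j => defectCount nbr Bad n j ω)} =
          ⋃ k : ℕ, ((fun ω => (nbr i).sup fun j => defectCount nbr Bad n j ω) ⁻¹' {k} ∩
            Bad n i k) := by
        ext ω; simp
      rw [this]
      exact @MeasurableSet.iUnion _ _ (F (n + 1)) _ _ fun k =>
        @MeasurableSet.inter _ (F (n + 1)) _ _ (hsup (measurableSet_singleton k)) (hBad n i k)
    exact @measurable_add_ite Ω (F (n + 1)) _ hsup _ hset

/-- A union bound over backward paths: having `m` defects by time `n` has probability at most
`K ^ n * (n.choose m) * q ^ m`, if each site has at most `K` neighbors and each defect has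
probability at most `q` given the past. -/
theorem real_defectCount_eq_le {F : ℕ → MeasurableSpace Ω} (hF : Monotone F)
    (hBad : ∀ n i k, MeasurableSet[F (n + 1)] (Bad n i k)) {K : ℕ} (hK : ∀ i, (nbr i).card ≤ K)
    (hne : ∀ i, (nbr i).Nonempty) {q : ℝ} (hq : 0 ≤ q)
    (hind : ∀ n i k E, MeasurableSet[F n] E → μ.real (E ∩ Bad n i k) ≤ q * μ.real E)
    (n : ℕ) (i : I) (m : ℕ) :
    μ.real {ω | defectCount nbr Bad n i ω = m} ≤ (K : ℝ) ^ n * (n.choose m) * q ^ m := by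
  induction n generalizing i m with
  | zero =>
    rcases m with _ | m
    · simp [defectCount]
    · simp [defectCount]
  | succ n ih =>
    have hattain : ∀ ω, ∃ j ∈ nbr i, ((nbr i).sup fun j => defectCount nbr Bad n j ω) =
        defectCount nbr Bad n j ω := fun ω =>
      Finset.exists_mem_eq_sup _ (hne i) _
    have hsum : ∀ (s : I → Set Ω) (c : ℝ), 0 ≤ c → (∀ j ∈ nbr i, μ.real (s j) ≤ c) →
        μ.real (⋃ j ∈ nbr i, s j) ≤ K * c := by
      intro s c hc hs
      refine (measureReal_biUnion_finset_le _ _).trans ((Finset.sum_le_card_nsmul _ _ c hs).trans ?_)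
      rw [nsmul_eq_mul]
      exact mul_le_mul_of_nonneg_right (by exact_mod_cast hK i) hc
    have hmeas : ∀ j k, MeasurableSet[F n] {ω | defectCount nbr Bad n j ω = k} := fun j k =>
      (measurable_defectCount hF hBad n j) (measurableSet_singleton k)
    rcases m with _ | m
    · have hsub : {ω | defectCount nbr Bad (n + 1) i ω = 0} ⊆
          ⋃ j ∈ nbr i, {ω | defectCount nbr Bad n j ω = 0} := by
        intro ω hω
        obtain ⟨j, hj, hj'⟩ := hattain ω
        simp only [Set.mem_iUnion]
        refine ⟨j, hj, ?_⟩
        change _ = 0 at hω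
        rw [defectCount] at hω
        change _ = 0
        omega
      refine (measureReal_mono hsub (measure_ne_top _ _)).trans
        ((hsum _ _ (by positivity) fun j _ => ih j 0).trans ?_)
      simp [pow_succ]; linarith
    · have hsub : {ω | defectCount nbr Bad (n + 1) i ω = m + 1} ⊆
          ⋃ j ∈ nbr i, ({ω | defectCount nbr Bad n j ω = m + 1} ∪
            ({ω | defectCount nbr Bad n j ω = m} ∩ Bad n i m)) := by
        intro ω hω
        obtain ⟨j, hj, hj'⟩ := hattain ω
        simp only [Set.mem_iUnion]
        refine ⟨j, hj, ?_⟩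
        change _ = m + 1 at hω
        by_cases hb : ω ∈ Bad n i ((nbr i).sup fun j => defectCount nbr Bad n j ω)
        · rw [defectCount_succ_of_mem hb] at hω
          right
          refine ⟨?_, ?_⟩
          · change _ = m; omega
          · rwa [show ((nbr i).sup fun j => defectCount nbr Bad n j ω) = m by omega] at hb
        · rw [defectCount_succ_of_notMem hb] at hω
          left
          change _ = m + 1; omega
      refine (measureReal_mono hsub (measure_ne_top _ _)).trans ((hsum _
        ((K : ℝ) ^ n * (n.choose (m + 1)) * q ^ (m + 1) +
          q * ((K : ℝ) ^ n * (n.choose m) * q ^ m)) (by positivity) fun j _ => ?_).trans ?_)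
      · refine (measureReal_union_le _ _).trans (add_le_add (ih j _) ?_)
        exact (hind n i m _ (hmeas j m)).trans (mul_le_mul_of_nonneg_left (ih j m) hq)
      · rw [Nat.choose_succ_succ]
        push_cast
        apply le_of_eq
        ring

/-- If defects are rare enough, a positive fraction `ε` of defects is exponentially unlikely. -/
theorem real_defectCount_ge_le {F : ℕ → MeasurableSpace Ω} (hF : Monotone F)
    (hBad : ∀ n i k, MeasurableSet[F (n + 1)] (Bad n i k)) {K : ℕ} (hK : ∀ i, (nbr i).card ≤ K)
    (hne : ∀ i, (nbr i).Nonempty) {q : ℝ} (hq : 0 < q) (hq1 : q ≤ 1)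
    (hind : ∀ n i k E, MeasurableSet[F n] E → μ.real (E ∩ Bad n i k) ≤ q * μ.real E)
    {ε : ℝ} (hε : 2 * K * q ^ ε ≤ Real.exp (-2)) (n : ℕ) (i : I) :
    μ.real {ω | ε * n ≤ defectCount nbr Bad n i ω} ≤ Real.exp (-n) := by
  have hsub : {ω | ε * n ≤ defectCount nbr Bad n i ω} ⊆
      ⋃ m ∈ (Finset.range (n + 1)).filter (fun m : ℕ => ε * n ≤ m),
        {ω | defectCount nbr Bad n i ω = m} := by
    intro ω hω
    simp only [Set.mem_iUnion]
    refine ⟨defectCount nbr Bad n i ω, ?_, rfl⟩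
    simp only [Finset.mem_filter, Finset.mem_range]
    exact ⟨Nat.lt_succ_of_le (defectCount_le _ _ _), hω⟩
  refine (measureReal_mono hsub (measure_ne_top _ _)).trans
    ((measureReal_biUnion_finset_le _ _).trans ?_)
  have hterm : ∀ m ∈ (Finset.range (n + 1)).filter (fun m : ℕ => ε * n ≤ m),
      μ.real {ω | defectCount nbr Bad n i ω = m} ≤ Real.exp (-2) ^ n := by
    intro m hm
    simp only [Finset.mem_filter, Finset.mem_range] at hm
    refine (real_defectCount_eq_le hF hBad hK hne hq.le hind n i m).trans ?_
    have h1 : (n.choose m : ℝ) ≤ 2 ^ n := by exact_mod_cast Nat.choose_le_two_pow n m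
    have h2 : q ^ m ≤ (q ^ ε) ^ n := by
      rw [← Real.rpow_natCast, ← Real.rpow_natCast, ← Real.rpow_mul hq.le]
      exact Real.rpow_le_rpow_of_exponent_ge hq hq1 hm.2
    calc (K : ℝ) ^ n * (n.choose m) * q ^ m ≤ (K : ℝ) ^ n * 2 ^ n * (q ^ ε) ^ n := by gcongr
      _ = (2 * K * q ^ ε) ^ n := by rw [mul_pow, mul_pow]; ring
      _ ≤ _ := pow_le_pow_left₀ (by positivity) hε n
  refine (Finset.sum_le_card_nsmul _ _ _ hterm).trans ?_
  rw [nsmul_eq_mul]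
  have hcard : (((Finset.range (n + 1)).filter (fun m : ℕ => ε * n ≤ m)).card : ℝ) ≤ n + 1 := by
    have := Finset.card_filter_le (Finset.range (n + 1)) (fun m : ℕ => ε * n ≤ m)
    rw [Finset.card_range] at this
    exact_mod_cast this
  have h3 : (n : ℝ) + 1 ≤ Real.exp n := Real.add_one_le_exp _
  calc _ ≤ Real.exp n * Real.exp (-2) ^ n := by
        gcongr
        exact hcard.trans h3
    _ = Real.exp (-n) := by
        rw [← Real.exp_nat_mul, ← Real.exp_add]; congr 1; ring

end Defects

/-! ### Linear growth -/

/-- The path from `0` to `d` by steps of sup norm at most `1`, which stays at `d` after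
time `‖d‖`. -/
def clampPath (d : Site) (j : ℕ) : Site :=
  (max (-(j : ℤ)) (min j d.1), max (-(j : ℤ)) (min j d.2))

lemma norm_le_iff_natAbs {x : Site} {R : ℕ} : ‖x‖ ≤ R ↔ |x.1| ≤ R ∧ |x.2| ≤ R := by
  rw [Prod.norm_def, max_le_iff, Int.norm_eq_abs, Int.norm_eq_abs]
  norm_cast

lemma clampPath_zero (d : Site) : clampPath d 0 = 0 := by
  ext <;> simp only [clampPath, Prod.fst_zero, Prod.snd_zero] <;> omega

lemma clampPath_of_le {d : Site} {j : ℕ} (h : ‖d‖ ≤ j) : clampPath d j = d := by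
  rw [norm_le_iff_natAbs, abs_le, abs_le] at h
  ext <;> simp only [clampPath] <;> omega

lemma norm_clampPath_succ_sub (d : Site) (j : ℕ) : ‖clampPath d (j + 1) - clampPath d j‖ ≤ 1 := by
  have := (norm_le_iff_natAbs (x := clampPath d (j + 1) - clampPath d j) (R := 1)).2 (by
    simp only [clampPath, Prod.fst_sub, Prod.snd_sub, abs_le]
    push_cast
    omega)
  simpa using this

lemma exists_box_fills (hfill : ∃ A : Set Site, A.Finite ∧ T.FillsSpace A) :
    ∃ R : ℕ, T.FillsSpace {y | ‖y‖ ≤ R} := by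
  obtain ⟨F, hFfin, hF⟩ := hfill
  obtain ⟨f, hf⟩ := (hFfin.image norm).bddAbove
  obtain ⟨R, hR⟩ := exists_nat_ge f
  exact ⟨R, hF.mono fun y hy => (hf ⟨y, hy, rfl⟩).trans hR⟩

/-- Starting from a fixed box, the process reaches distance `n / 2` within `n` rounds, up to an
exponentially small error. -/
theorem exists_linear_growth (hπ : ∃ p, IsPerturbation p π T)
    (hfill : ∃ A : Set Site, A.Finite ∧ T.FillsSpace A) :
    ∃ R τ : ℕ, 0 < τ ∧
      ∀ ξ : Site → ℕ → Ω → Config N → Bool, IsSureNoise T π μ ξ →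
      ∀ (A : Set Site) (z y : Site) (n : ℕ), (∀ x, ‖x - z‖ ≤ R → x ∈ A) → 2 * ‖y - z‖ ≤ n →
        μ.real {ω | y ∉ occupied (envOf ξ ω) A (n * τ)} ≤ Real.exp (-n) := by
  obtain ⟨R, hR⟩ := exists_box_fills hfill
  obtain ⟨t₁, q, ht₁, hq0, hq1, htry⟩ := exists_tries (μ := μ) hπ R (R + 1)
  obtain ⟨J, hJ⟩ := exists_pow_lt_of_lt_one (show 0 < (Real.exp (-2) / 2) ^ 2 by positivity) hq1
  have hJ0 : J ≠ 0 := by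
    rintro rfl
    rw [pow_zero] at hJ
    have : Real.exp (-2) ≤ 1 := Real.exp_le_one_iff.2 (by norm_num)
    have h2 := Real.exp_pos (-2)
    nlinarith
  refine ⟨R, J * t₁, Nat.mul_pos (by omega) ht₁, fun ξ hξ A z y n hA hyz => ?_⟩
  set τ := J * t₁ with hτ
  set δ : ℝ := (Real.exp (-2) / 2) ^ 2 with hδ
  -- one box of radius `R` is moved along the path `γ` from `z` to `y`, and waits at each defect
  let γ : ℕ → Site := fun j => z + clampPath (y - z) j
  let B : Set Site := {x | ‖x‖ ≤ R}
  let Bad : ℕ → Unit → ℕ → Set Ω := fun n _ k =>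
    {ω | ¬ ∀ x, ‖x - 0‖ ≤ (R + 1 : ℕ) →
      x ∈ occupied (envOf (shiftNoise (γ (n - k)) (n * τ) ξ) ω) B τ}
  let nbr : Unit → Finset Unit := fun _ => {()}
  have hbadm : ∀ n i k, Bad n i k = (fun ω =>
      occupied (envOf (shiftNoise (γ (n - k)) (n * τ) ξ) ω) B τ) ⁻¹'
        {C | ∀ x, ‖x - 0‖ ≤ (R + 1 : ℕ) → x ∈ C}ᶜ := fun n i k => rfl
  have hset : MeasurableSet {C : Set Site | ∀ x, ‖x - 0‖ ≤ (R + 1 : ℕ) → x ∈ C}ᶜ :=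
    (measurableSet_forall_mem _).compl
  have hδ1 : δ ≤ 1 := by
    have : Real.exp (-2) ≤ 1 := Real.exp_le_one_iff.2 (by norm_num)
    have h2 := Real.exp_pos (-2)
    nlinarith
  have htail := real_defectCount_ge_le (μ := μ) (nbr := nbr) (Bad := Bad)
    (F := fun n => noiseσ ξ (before (n * τ)))
    (fun a b hab => noiseσ_mono ξ (before_mono (Nat.mul_le_mul_right τ hab)))
    (fun n i k => by
      rw [hbadm n i k, add_one_mul]
      exact measurable_occupied_before ξ _ _ _ _ hset)
    (K := 1) (fun i => by simp [nbr]) (fun i => by simp [nbr]) (q := δ) (by positivity) hδ1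
    (by
      intro n i k E hE
      rw [hξ.noise.real_inter_eq_mul hE (by
        rw [hbadm n i k]; exact measurable_occupied_after ξ _ _ _ _ hset), mul_comm]
      refine mul_le_mul_of_nonneg_right ?_ measureReal_nonneg
      refine (htry _ (hξ.shift _ _) B 0 ⟨B, subset_rfl, fun y hy => ?_, hR⟩ J).trans hJ.le
      have hy' : ‖y‖ ≤ R := hy
      simpa using hy')
    (ε := 1 / 2) (by
      rw [hδ, ← Real.sqrt_eq_rpow, Real.sqrt_sq (by positivity)]
      apply le_of_eq; push_cast; ring) n ()
  refine (measureReal_mono fun ω hω => ?_).trans htail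
  change (1 / 2 : ℝ) * n ≤ _
  by_contra! hlt
  have key : ∀ m, ∀ x, ‖x - γ (m - defectCount nbr Bad m () ω)‖ ≤ R →
      x ∈ occupied (envOf ξ ω) A (m * τ) := by
    intro m
    induction m with
    | zero =>
      intro x hx
      rw [zero_mul]
      refine hA x ?_
      simpa [γ, clampPath_zero, defectCount] using hx
    | succ m ih =>
      intro x hx
      have hle : defectCount nbr Bad m () ω ≤ m := defectCount_le _ _ _
      have hsup : ((nbr ()).sup fun j => defectCount nbr Bad m j ω) =
        defectCount nbr Bad m () ω := by simp [nbr]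
      by_cases hb : ω ∈ Bad m () ((nbr ()).sup fun j => defectCount nbr Bad m j ω)
      · rw [defectCount_succ_of_mem hb, hsup, Nat.add_sub_add_right] at hx
        exact occupied_monotone (hξ.sure ω) A (by rw [add_one_mul]; omega) (ih x hx)
      · rw [defectCount_succ_of_notMem hb, hsup, Nat.sub_add_comm hle] at hx
        rw [hsup] at hb
        simp only [Bad, Set.mem_ofPred_eq, not_not] at hb
        set g := γ (m - defectCount nbr Bad m () ω) with hg
        have h1 : ‖x - g‖ ≤ R + 1 := by
          have h2 := norm_clampPath_succ_sub (y - z) (m - defectCount nbr Bad m () ω)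
          have h3 : x - g = (x - γ (m - defectCount nbr Bad m () ω + 1)) +
              (clampPath (y - z) (m - defectCount nbr Bad m () ω + 1) -
                clampPath (y - z) (m - defectCount nbr Bad m () ω)) := by
            simp only [hg, γ]; abel
          rw [h3]
          exact (norm_add_le _ _).trans (add_le_add hx h2)
        have h4 := hb (x - g) (by simpa using h1)
        have h5 : B ⊆ {x | g + x ∈ occupied (envOf ξ ω) A (m * τ)} := by
          intro w hw
          have hw' : ‖w‖ ≤ R := hw
          exact ih (g + w) (by simpa [hg] using hw')
        rw [envOf_shiftNoise] at h4
        have h6 := occupied_subset ((hξ.sure ω).shift _ _).monotone h5 _ h4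
        rw [occupied_shift, ← occupied_add] at h6
        rw [add_one_mul]
        simpa using h6
  apply hω
  apply key n
  have h7 : ‖y - z‖ ≤ (n - defectCount nbr Bad n () ω : ℕ) := by
    rw [Nat.cast_sub (defectCount_le _ _ _)]
    linarith
  simp [γ, clampPath_of_le h7]

/-! ### Concentration of hitting times -/

open Classical in
/-- The hitting time of the origin truncated at `L`: the number of times `s < L` at which the
origin is vacant. -/
noncomputable def vacantTime (L : ℕ) (A : Set Site) (η : Env N) : ℝ :=
  ∑ s ∈ Finset.range L, if (0 : Site) ∈ occupied η A s then 0 else 1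

lemma vacantTime_nonneg (L : ℕ) (A : Set Site) (η : Env N) : 0 ≤ vacantTime L A η :=
  Finset.sum_nonneg fun s _ => by split_ifs <;> simp

lemma vacantTime_le (L : ℕ) (A : Set Site) (η : Env N) : vacantTime L A η ≤ L := by
  refine (Finset.sum_le_card_nsmul _ _ 1 fun s _ => ?_).trans ?_
  · split_ifs <;> simp
  · simp

open Classical in
lemma vacantTime_succ (L : ℕ) (A : Set Site) (η : Env N) :
    vacantTime (L + 1) A η =
      (if (0 : Site) ∈ A then 0 else 1) + vacantTime L (occupied η A 1) (shiftEnv 0 1 η) := by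
  rw [vacantTime, Finset.sum_range_succ', add_comm]
  congr 1
  refine Finset.sum_congr rfl fun s _ => ?_
  rw [add_comm s 1, occupied_add]

/-- The truncated hitting time decreases if the initial state increases near the origin. -/
lemma vacantTime_anti {η : Env N} (hη : T.IsAssignment η) {L : ℕ} {A A' : Set Site}
    (h : ∀ y, ‖y‖ ≤ (range N * L : ℕ) → y ∈ A → y ∈ A') :
    vacantTime L A' η ≤ vacantTime L A η := by
  refine Finset.sum_le_sum fun s hs => ?_
  by_cases h0 : (0 : Site) ∈ occupied η A s
  · have h1 : (0 : Site) ∈ occupied η A' s := mem_occupied_of_local hη h0 fun y hy hyA => by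
      refine h y ?_ hyA
      rw [sub_zero] at hy
      refine hy.trans ?_
      push_cast
      have : (s : ℝ) ≤ L := by exact_mod_cast (Finset.mem_range.1 hs).le
      gcongr
    simp [h0, h1]
  · simp only [h0, if_false]; split_ifs <;> simp

lemma vacantTime_le_add {η : Env N} (L r : ℕ) (A : Set Site) :
    vacantTime L A η ≤ r + vacantTime L (occupied η A r) (shiftEnv 0 r η) := by
  have h1 : vacantTime L A η ≤ vacantTime (r + L) A η :=
    Finset.sum_le_sum_of_subset_of_nonneg (Finset.range_mono (by omega))
      fun s _ _ => by split_ifs <;> simp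
  refine h1.trans ?_
  rw [vacantTime, Finset.sum_range_add]
  refine add_le_add (vacantTime_le r A η) (le_of_eq ?_)
  refine Finset.sum_congr rfl fun s _ => ?_
  rw [occupied_add]

/-- The truncated hitting time is the horizon if the origin is vacant at the last time. -/
lemma vacantTime_eq_of_notMem {η : Env N} (hη : T.IsAssignment η) {L : ℕ} {A : Set Site}
    (h : (0 : Site) ∉ occupied η A L) : vacantTime (L + 1) A η = L + 1 := by
  have : ∀ s ∈ Finset.range (L + 1),
      (open Classical in if (0 : Site) ∈ occupied η A s then (0 : ℝ) else 1) = 1 := by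
    intro s hs
    rw [if_neg]
    exact fun hc => h (occupied_monotone hη A (Nat.lt_succ_iff.1 (Finset.mem_range.1 hs)) hc)
  rw [vacantTime, Finset.sum_congr rfl this]
  simp

lemma vacantTime_le_of_mem {η : Env N} (hη : T.IsAssignment η) {L s : ℕ} {A : Set Site}
    (h : (0 : Site) ∈ occupied η A s) : vacantTime L A η ≤ s := by
  rw [vacantTime]
  have : ∀ r ∈ Finset.range L, (open Classical in
      if (0 : Site) ∈ occupied η A r then (0 : ℝ) else 1) ≤ if r < s then 1 else 0 := by
    intro r _
    by_cases hr : r < s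
    · simp only [hr, if_true]; split_ifs <;> simp
    · rw [if_pos (occupied_monotone hη A (not_lt.1 hr) h)]; simp [hr]
  refine (Finset.sum_le_sum this).trans ?_
  rw [Finset.sum_boole]
  have : (Finset.range L).filter (fun r => r < s) ⊆ Finset.range s := fun r hr => by
    simp at hr ⊢; exact hr.2
  have := Finset.card_le_card this
  rw [Finset.card_range] at this
  exact_mod_cast this

lemma measurable_vacantTime (L : ℕ) :
    Measurable fun z : Set Site × Env N => vacantTime L z.1 z.2 := by
  unfold vacantTime
  refine Finset.measurable_sum _ fun s _ => ?_
  have : Measurable fun z : Set Site × Env N => occupied z.2 z.1 s :=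
    RandomGrowth.measurable_occupied (fun x s _ => by fun_prop) measurable_fst
  exact Measurable.ite (measurableSet_setOfPred.2 (measurable_set_iff.1 this 0)) measurable_const
    measurable_const

/-- The expected truncated hitting time of the origin from `A`. -/
noncomputable def meanVacant (μ : Measure Ω) (ξ : Site → ℕ → Ω → Config N → Bool) (L : ℕ)
    (A : Set Site) : ℝ := ∫ ω, vacantTime L A (envOf ξ ω) ∂μ

section

variable {ξ : Site → ℕ → Ω → Config N → Bool}

lemma IsNoise.measurable_vacantTime (h : IsNoise π μ ξ) (L : ℕ) (A : Set Site) :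
    Measurable fun ω => vacantTime L A (envOf ξ ω) :=
  (RandomGrowth.measurable_vacantTime L).comp (measurable_const.prodMk h.measurable_envOf)

lemma IsNoise.integrable_vacantTime (h : IsNoise π μ ξ) (L : ℕ) (A : Set Site) :
    Integrable (fun ω => vacantTime L A (envOf ξ ω)) μ :=
  Integrable.of_bound (h.measurable_vacantTime L A).aestronglyMeasurable L
    (Eventually.of_forall fun ω => by
      rw [Real.norm_eq_abs, abs_of_nonneg (vacantTime_nonneg _ _ _)]
      exact vacantTime_le _ _ _)

lemma meanVacant_nonneg (L : ℕ) (A : Set Site) : 0 ≤ meanVacant μ ξ L A :=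
  integral_nonneg fun _ => vacantTime_nonneg _ _ _

lemma IsNoise.meanVacant_le (h : IsNoise π μ ξ) (L : ℕ) (A : Set Site) :
    meanVacant μ ξ L A ≤ L := by
  have := integral_mono (h.integrable_vacantTime L A) (integrable_const (L : ℝ))
    fun ω => vacantTime_le L A (envOf ξ ω)
  rw [meanVacant]
  simpa using this

lemma IsNoise.measurable_meanVacant (h : IsNoise π μ ξ) (L : ℕ) :
    Measurable (meanVacant μ ξ L) := by
  have hg : Measurable fun z : Set Site × Ω => vacantTime L z.1 (envOf ξ z.2) :=
    (RandomGrowth.measurable_vacantTime L).comp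
      (measurable_fst.prodMk (h.measurable_envOf.comp measurable_snd))
  exact hg.stronglyMeasurable.integral_prod_right'.measurable

lemma IsNoise.integral_shift_vacantTime (h : IsNoise π μ ξ) (v : Site) (s L : ℕ) (A : Set Site) :
    ∫ ω, vacantTime L A (shiftEnv v s (envOf ξ ω)) ∂μ = meanVacant μ ξ L A := by
  have hX : Measurable fun e : Env N => vacantTime L A e :=
    (RandomGrowth.measurable_vacantTime L).comp (measurable_const.prodMk measurable_id)
  have h1 := integral_map (h.shift v s).measurable_envOf.aemeasurable (μ := μ)
    hX.aestronglyMeasurable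
  have h2 := integral_map h.measurable_envOf.aemeasurable (μ := μ) hX.aestronglyMeasurable
  rw [h.map_shift v s] at h1
  exact h1.symm.trans h2

lemma IsSureNoise.meanVacant_anti (h : IsSureNoise T π μ ξ) (L : ℕ) {A A' : Set Site}
    (hA : A ⊆ A') : meanVacant μ ξ L A' ≤ meanVacant μ ξ L A :=
  integral_mono (h.noise.integrable_vacantTime L A') (h.noise.integrable_vacantTime L A)
    fun ω => vacantTime_anti (h.sure ω) fun _ _ hy => hA hy

/-- The states that the automaton and its perturbations can reach from half-planes. -/
def Reachable (T : CellularAutomaton N) (A : Set Site) : Prop :=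
  ∃ (u : Plane) (b : ℝ) (η : Env N) (t : ℕ), ‖u‖ = 1 ∧ T.IsAssignment η ∧
    A = occupied η (halfSites u b) t

lemma reachable_halfSites (T : CellularAutomaton N) {u : Plane} (hu : ‖u‖ = 1) (b : ℝ) :
    Reachable T (halfSites u b) := ⟨u, b, T.maxEnv, 0, hu, T.isAssignment_maxEnv, rfl⟩

lemma Reachable.step {A : Set Site} (h : Reachable T A) {η : Env N} (hη : T.IsAssignment η) :
    Reachable T (occupied η A 1) := by
  obtain ⟨u, b, ζ, t, hu, hζ, rfl⟩ := h
  refine ⟨u, b, fun x s => if s < t then ζ x s else η x (s - t), t + 1, hu, ?_, ?_⟩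
  · intro x s
    by_cases hs : s < t
    · simp only [hs, if_true]; exact hζ x s
    · simp only [hs, if_false]; exact hη x _
  · rw [occupied_add]
    have h1 : occupied (fun x s => if s < t then ζ x s else η x (s - t)) (halfSites u b) t =
        occupied ζ (halfSites u b) t :=
      occupied_congr_env fun s hs x => by simp [hs]
    rw [h1]
    exact (occupied_congr_env fun s hs x => by simp [shiftEnv]).symm

/-- One full step of the automaton changes expected hitting times little. From a reachable state
`A`, within a few rounds the process covers all points of `T.step A` that matter for the
origin, because each of them is close to a subset of `A` that fills space. -/
theorem exists_meanVacant_le (hT : T.LocallyRegular)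
    (hfill : ∃ A : Set Site, A.Finite ∧ T.FillsSpace A) (hπ : ∃ p, IsPerturbation p π T) :
    ∃ (t₁ : ℕ) (q : ℝ), 0 ≤ q ∧ q < 1 ∧ ∀ ξ : Site → ℕ → Ω → Config N → Bool,
      IsSureNoise T π μ ξ → ∀ A, Reachable T A → ∀ L J : ℕ,
        meanVacant μ ξ L A ≤ meanVacant μ ξ L (occupied T.maxEnv A 1) +
          (J * t₁ + L * ((2 * (range N * L) + 1) ^ 2 * q ^ J)) := by
  classical
  obtain ⟨C, hC⟩ := exists_filling_near hT hfill
  obtain ⟨t₁, q, -, hq0, hq1, htry⟩ := exists_tries (μ := μ) hπ (C + range N) 0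
  refine ⟨t₁, q, hq0, hq1, fun ξ hξ A hA L J => ?_⟩
  obtain ⟨u, b, ζ, t, hu, hζ, rfl⟩ := hA
  set A := occupied ζ (halfSites u b) t with hA
  set B := occupied T.maxEnv A 1
  let bad : Set Ω := ⋃ y ∈ (box (range N * L)).filter (· ∈ B),
    {ω | ¬ ∀ w, ‖w - y‖ ≤ (0 : ℕ) → w ∈ occupied (envOf ξ ω) A (J * t₁)}
  have hbadm : MeasurableSet bad := by
    refine Finset.measurableSet_biUnion _ fun y _ => ?_
    have := (hξ.noise.measurable_occupied A (J * t₁))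
      (measurableSet_forall_mem fun w => ‖w - y‖ ≤ (0 : ℕ)).compl
    exact this
  have hbad : μ.real bad ≤ (2 * (range N * L) + 1) ^ 2 * q ^ J := by
    refine (measureReal_biUnion_finset_le _ _).trans
      ((Finset.sum_le_card_nsmul _ _ (q ^ J) fun y hy => ?_).trans ?_)
    · refine htry ξ hξ A y ?_ J
      have hyB := (Finset.mem_filter.1 hy).2
      obtain ⟨a, ha, hya⟩ := exists_near_of_mem_occupied T.isAssignment_maxEnv hyB
      obtain ⟨G, hG, hGC, hGf⟩ := hC u hu b ζ hζ t a ha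
      refine ⟨G, hG, fun z hz => ?_, hGf⟩
      have h1 := hGC z hz
      rw [show z - y = (z - a) - (y - a) by abel]
      refine (norm_sub_le _ _).trans ?_
      push_cast at hya ⊢
      linarith
    · rw [nsmul_eq_mul]
      refine mul_le_mul_of_nonneg_right ?_ (by positivity)
      have := (Finset.card_filter_le (box (range N * L)) (· ∈ B)).trans (card_box _).le
      exact_mod_cast this
  -- unless `bad` occurs, the process from `A` dominates after time `J * t₁` the process from `B`
  have hpt : ∀ ω, vacantTime L A (envOf ξ ω) ≤
      (J * t₁ : ℕ) + vacantTime L B (shiftEnv 0 (J * t₁) (envOf ξ ω)) +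
        L * bad.indicator (fun _ => (1 : ℝ)) ω := by
    intro ω
    by_cases hω : ω ∈ bad
    · rw [Set.indicator_of_mem hω]
      have h1 := vacantTime_le L A (envOf ξ ω)
      have h2 := vacantTime_nonneg L B (shiftEnv 0 (J * t₁) (envOf ξ ω))
      have h3 : (0 : ℝ) ≤ (J * t₁ : ℕ) := by positivity
      linarith
    · rw [Set.indicator_of_notMem hω, mul_zero, add_zero]
      refine (vacantTime_le_add L (J * t₁) A).trans ?_
      gcongr
      refine vacantTime_anti ((hξ.sure ω).shift _ _) fun y hy hyB => ?_
      by_contra hc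
      apply hω
      simp only [bad, Set.mem_iUnion]
      exact ⟨y, Finset.mem_filter.2 ⟨mem_box.2 hy, hyB⟩, fun h => hc (h y (by simp))⟩
  have hint1 : Integrable (fun ω => vacantTime L B (shiftEnv 0 (J * t₁) (envOf ξ ω))) μ :=
    (hξ.shift 0 (J * t₁)).noise.integrable_vacantTime L B
  have hint2 : Integrable (bad.indicator (fun _ => (1 : ℝ))) μ :=
    (integrable_const 1).indicator hbadm
  have h1 := integral_mono (hξ.noise.integrable_vacantTime L A)
    (((integrable_const ((J * t₁ : ℕ) : ℝ)).add hint1).add (hint2.const_mul (L : ℝ))) hpt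
  have hint3 : Integrable (fun ω => ((J * t₁ : ℕ) : ℝ) +
      vacantTime L B (shiftEnv 0 (J * t₁) (envOf ξ ω))) μ := (integrable_const _).add hint1
  simp only [Pi.add_apply] at h1
  rw [integral_add hint3 (hint2.const_mul (L : ℝ)),
    integral_add (integrable_const _) hint1, integral_const_mul,
    hξ.noise.integral_shift_vacantTime] at h1
  have h2 : ∫ ω, bad.indicator (fun _ => (1 : ℝ)) ω ∂μ = μ.real bad :=
    integral_indicator_one hbadm
  rw [h2] at h1
  simp only [integral_const, probReal_univ, one_smul] at h1
  change meanVacant μ ξ L A ≤ _ at h1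
  refine h1.trans ?_
  have h3 : (L : ℝ) * μ.real bad ≤ L * ((2 * (range N * L) + 1) ^ 2 * q ^ J) := by gcongr
  push_cast
  linarith

/-- Azuma's inequality for the truncated hitting time, through a recursion over the first step. -/
theorem IsSureNoise.hasSubgaussianMGF_vacantTime (h : IsSureNoise T π μ ξ) {D : NNReal} {L : ℕ}
    (hD : ∀ A, Reachable T A → ∀ l < L,
      meanVacant μ ξ l A ≤ meanVacant μ ξ l (occupied T.maxEnv A 1) + D) :
    ∀ l ≤ L, ∀ A, Reachable T A →
      HasSubgaussianMGF (fun ω => vacantTime l A (envOf ξ ω) - meanVacant μ ξ l A)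
        (l * (D / 2) ^ 2) μ := by
  have hint : ∀ (l : ℕ) (A : Set Site) (θ : ℝ),
      Integrable (fun ω => Real.exp (θ * (vacantTime l A (envOf ξ ω) - meanVacant μ ξ l A))) μ := by
    intro l A θ
    refine Integrable.of_bound (Real.measurable_exp.comp
      (((h.noise.measurable_vacantTime l A).sub_const _).const_mul θ)).aestronglyMeasurable
      (Real.exp (|θ| * l)) (Eventually.of_forall fun ω => ?_)
    rw [Real.norm_eq_abs, abs_of_pos (Real.exp_pos _), Real.exp_le_exp]
    refine (le_abs_self _).trans ?_
    rw [abs_mul]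
    refine mul_le_mul_of_nonneg_left ?_ (abs_nonneg _)
    have h1 := vacantTime_nonneg l A (envOf ξ ω)
    have h2 := vacantTime_le l A (envOf ξ ω)
    have h3 := meanVacant_nonneg (μ := μ) (ξ := ξ) l A
    have h4 := h.noise.meanVacant_le l A
    rw [abs_le]; constructor <;> linarith
  intro l
  induction l with
  | zero =>
    intro _ A _
    refine ⟨hint 0 A, fun t => ?_⟩
    simp [mgf, vacantTime, meanVacant]
  | succ l ih =>
    intro hl A hA
    have ih := ih (by omega)
    refine ⟨hint (l + 1) A, fun t => ?_⟩
    classical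
    set m : ℝ := ∫ ω, meanVacant μ ξ l (occupied (envOf ξ ω) A 1) ∂μ with hm
    have hmv : meanVacant μ ξ (l + 1) A = (if (0 : Site) ∈ A then 0 else 1) + m := by
      have h1 := h.noise.integral_markov A (measurable_vacantTime l) l (fun z => by
        rw [abs_of_nonneg (vacantTime_nonneg _ _ _)]; exact vacantTime_le _ _ _)
      rw [meanVacant]
      simp only [vacantTime_succ]
      have hint1 : Integrable (fun ω =>
          vacantTime l (occupied (envOf ξ ω) A 1) (shiftEnv 0 1 (envOf ξ ω))) μ := by
        refine Integrable.of_bound ((measurable_vacantTime l).comp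
          ((h.noise.measurable_occupied A 1).prodMk
            (h.noise.shift 0 1).measurable_envOf)).aestronglyMeasurable l
          (Eventually.of_forall fun ω => ?_)
        rw [Real.norm_eq_abs]
        rw [abs_of_nonneg (vacantTime_nonneg _ _ _)]
        exact vacantTime_le _ _ _
      rw [integral_add (integrable_const _) hint1, h1]
      simp [hm, meanVacant]
    have hm0 : 0 ≤ m := integral_nonneg fun ω => meanVacant_nonneg _ _
    have hVm : Measurable fun ω => meanVacant μ ξ l (occupied (envOf ξ ω) A 1) :=
      (h.noise.measurable_meanVacant l).comp (h.noise.measurable_occupied A 1)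
    have hVint : Integrable (fun ω => meanVacant μ ξ l (occupied (envOf ξ ω) A 1)) μ := by
      refine Integrable.of_bound hVm.aestronglyMeasurable l (Eventually.of_forall fun ω => ?_)
      rw [Real.norm_eq_abs, abs_of_nonneg (meanVacant_nonneg _ _)]
      exact h.noise.meanVacant_le _ _
    have hml : m ≤ l := by
      have := integral_mono hVint (integrable_const (l : ℝ)) fun ω =>
        h.noise.meanVacant_le l (occupied (envOf ξ ω) A 1)
      simpa using this
    -- the Markov property at time `1` for the exponential
    have hmarkov := h.noise.integral_markov A
      (f := fun z => Real.exp (t * (vacantTime l z.1 z.2 - m)))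
      (Real.measurable_exp.comp (((measurable_vacantTime l).sub_const m).const_mul t))
      (Real.exp (|t| * l)) (fun z => by
        rw [abs_of_pos (Real.exp_pos _), Real.exp_le_exp]
        refine (le_abs_self _).trans ?_
        rw [abs_mul]
        refine mul_le_mul_of_nonneg_left ?_ (abs_nonneg _)
        have h1 := vacantTime_nonneg l z.1 z.2
        have h2 := vacantTime_le l z.1 z.2
        rw [abs_le]; constructor <;> linarith)
    have hlhs : mgf (fun ω => vacantTime (l + 1) A (envOf ξ ω) - meanVacant μ ξ (l + 1) A) μ t =
        ∫ ω, Real.exp (t * (vacantTime l (occupied (envOf ξ ω) A 1)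
          (shiftEnv 0 1 (envOf ξ ω)) - m)) ∂μ := by
      simp only [mgf, hmv, vacantTime_succ]
      congr 1; funext ω; congr 2; ring
    rw [hlhs, hmarkov]
    -- Hoeffding's lemma for the first step
    set V := fun ω => meanVacant μ ξ l (occupied (envOf ξ ω) A 1) with hV
    have hhoef := hasSubgaussianMGF_of_mem_Icc (μ := μ) (X := V)
      (a := meanVacant μ ξ l (occupied T.maxEnv A 1)) (b := meanVacant μ ξ l A) hVm.aemeasurable
      (Eventually.of_forall fun ω =>
        ⟨h.meanVacant_anti l (occupied_subset_max (h.sure ω) subset_rfl 1),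
          h.meanVacant_anti l (subset_occupied (h.sure ω) A 1)⟩)
    set K : ℝ := Real.exp ((l * (D / 2) ^ 2 : NNReal) * t ^ 2 / 2) with hK
    have hinner : ∀ ω,
        ∫ ω', Real.exp (t * (vacantTime l (occupied (envOf ξ ω) A 1) (envOf ξ ω') - m)) ∂μ ≤
          Real.exp (t * (V ω - m)) * K := by
      intro ω
      have h1 := (ih _ (hA.step (h.sure ω))).mgf_le t
      have h2 : ∀ ω', Real.exp (t * (vacantTime l (occupied (envOf ξ ω) A 1) (envOf ξ ω') - m)) =
          Real.exp (t * (V ω - m)) * Real.exp (t * (vacantTime l (occupied (envOf ξ ω) A 1)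
            (envOf ξ ω') - meanVacant μ ξ l (occupied (envOf ξ ω) A 1))) := by
        intro ω'; rw [← Real.exp_add]; congr 1; simp only [hV]; ring
      simp only [h2]
      rw [integral_const_mul]
      exact mul_le_mul_of_nonneg_left h1 (Real.exp_pos _).le
    have hle : ∫ ω, ∫ ω',
        Real.exp (t * (vacantTime l (occupied (envOf ξ ω) A 1) (envOf ξ ω') - m)) ∂μ ∂μ ≤
          ∫ ω, Real.exp (t * (V ω - m)) * K ∂μ :=
      integral_mono_of_nonneg
        (Eventually.of_forall fun ω => integral_nonneg fun _ => (Real.exp_pos _).le)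
        ((hhoef.integrable_exp_mul t).mul_const K) (Eventually.of_forall hinner)
    refine hle.trans ?_
    rw [integral_mul_const]
    have h3 := hhoef.mgf_le t
    have h4 : ‖meanVacant μ ξ l A - meanVacant μ ξ l (occupied T.maxEnv A 1)‖₊ ≤ D := by
      rw [← NNReal.coe_le_coe, coe_nnnorm, Real.norm_eq_abs, abs_le]
      have h5 := hD A hA l (by omega)
      have h6 := h.meanVacant_anti l (subset_occupied T.isAssignment_maxEnv A 1)
      have h7 : (0 : ℝ) ≤ D := D.2
      constructor <;> linarith
    refine (mul_le_mul_of_nonneg_right h3 (Real.exp_pos _).le).trans ?_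
    rw [← Real.exp_add, Real.exp_le_exp]
    have h5 : (((‖meanVacant μ ξ l A - meanVacant μ ξ l (occupied T.maxEnv A 1)‖₊ / 2) ^ 2 : NNReal)
        : ℝ) ≤ ((D / 2) ^ 2 : NNReal) := by
      rw [NNReal.coe_le_coe]; gcongr
    push_cast at h5 ⊢
    nlinarith [sq_nonneg t, mul_le_mul_of_nonneg_right h5 (sq_nonneg t)]

end

/-! ### The sharp transition -/

lemma exists_pow_mul_pow_le {q : ℝ} (hq0 : 0 ≤ q) (hq1 : q < 1) (k : ℕ) :
    ∃ C : ℝ, 0 ≤ C ∧ ∀ n : ℕ, ((n : ℝ) + 1) ^ k * q ^ n ≤ C := by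
  set p := max q (1 / 2) with hp
  have hp0 : 0 < p := lt_of_lt_of_le (by norm_num) (le_max_right _ _)
  have hp1 : p < 1 := max_lt hq1 (by norm_num)
  have h := (tendsto_pow_const_mul_const_pow_of_lt_one k hp0.le hp1).bddAbove_range
  obtain ⟨C, hC⟩ := h
  have hC' : ∀ n : ℕ, (n : ℝ) ^ k * p ^ n ≤ C := fun n => hC ⟨n, rfl⟩
  refine ⟨C / p, ?_, fun n => ?_⟩
  · have := hC' 1
    have h2 : (0 : ℝ) ≤ ((1 : ℕ) : ℝ) ^ k * p ^ 1 := by positivity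
    exact div_nonneg (h2.trans this) hp0.le
  · rw [le_div_iff₀ hp0]
    have h1 := hC' (n + 1)
    rw [pow_succ] at h1
    push_cast at h1
    have h2 : q ^ n ≤ p ^ n := pow_le_pow_left₀ hq0 (le_max_left _ _) n
    calc ((n : ℝ) + 1) ^ k * q ^ n * p ≤ ((n : ℝ) + 1) ^ k * p ^ n * p := by gcongr
      _ = ((n : ℝ) + 1) ^ k * (p ^ n * p) := by ring
      _ ≤ C := h1

/-- The choice of the number of rounds `J ≈ ℓ ^ (1/4)` for which the martingale differences are
`O(J)` and the resulting tail bound decays faster than any power of `ℓ`. -/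
lemma exists_rounds {q ε M : ℝ} (hq0 : 0 ≤ q) (hq1 : q < 1) (hε : 0 < ε) (hM : 0 ≤ M) (t₁ r : ℕ)
    (hr : 0 < r) : ∃ ℓ₀ : ℕ, 0 < ℓ₀ ∧ ∀ ℓ ≥ ℓ₀, ∃ (J k : ℕ) (D : ℝ), 0 < D ∧ 2 * r * k ≤ ε * ℓ ∧
      k ≤ ℓ ∧ J * t₁ + ℓ * ((2 * (r * ℓ) + 1) ^ 2 * q ^ J) ≤ D ∧
      Real.exp (-(k / 2 : ℝ) ^ 2 / (2 * ((ℓ + 1) * (D / 2) ^ 2))) ≤ (ℓ : ℝ) ^ (-M) := by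
  obtain ⟨C, hC0, hC⟩ := exists_pow_mul_pow_le hq0 hq1 12
  have hr' : (1 : ℝ) ≤ r := by exact_mod_cast hr
  set C₂ : ℝ := (2 * r + 1) ^ 2 * C with hC₂
  have hC₂0 : 0 ≤ C₂ := by positivity
  set C₃ : ℝ := t₁ + C₂ + 1 with hC₃
  have hC₃0 : 0 < C₃ := by positivity
  set ε' : ℝ := min ε 1 with hε'
  have hε'0 : 0 < ε' := lt_min hε one_pos
  set c : ℝ := ε' ^ 2 / (64 * r ^ 2 * C₃ ^ 2) with hc
  have hc0 : 0 < c := by positivity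
  obtain ⟨J₀, hJ₀⟩ := exists_nat_ge (16 * M / c)
  obtain ⟨ℓ₁, hℓ₁⟩ := exists_nat_ge (4 * r / ε')
  refine ⟨max ((J₀ + 1) ^ 4) ℓ₁, lt_of_lt_of_le (by positivity) (le_max_left _ _), fun ℓ hℓ => ?_⟩
  have hℓa : (J₀ + 1) ^ 4 ≤ ℓ := (le_max_left _ _).trans hℓ
  have hℓb : 4 * r / ε' ≤ ℓ := hℓ₁.trans (by exact_mod_cast (le_max_right _ _).trans hℓ)
  set J := Nat.sqrt (Nat.sqrt ℓ) with hJ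
  have hJlow : J ^ 4 ≤ ℓ := by
    have h1 := Nat.sqrt_le' ℓ
    have h2 := Nat.sqrt_le' (Nat.sqrt ℓ)
    calc J ^ 4 = (J ^ 2) ^ 2 := by ring
      _ ≤ (Nat.sqrt ℓ) ^ 2 := Nat.pow_le_pow_left h2 2
      _ ≤ ℓ := h1
  have hJup : ℓ ≤ (J + 1) ^ 4 := by
    have h1 := Nat.lt_succ_sqrt' ℓ
    have h2 := Nat.lt_succ_sqrt' (Nat.sqrt ℓ)
    have h3 : Nat.sqrt ℓ + 1 ≤ (J + 1) ^ 2 := h2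
    calc ℓ ≤ (Nat.sqrt ℓ + 1) ^ 2 := h1.le
      _ ≤ ((J + 1) ^ 2) ^ 2 := Nat.pow_le_pow_left h3 2
      _ = (J + 1) ^ 4 := by ring
  have hJJ₀ : J₀ + 1 ≤ J := by
    rw [hJ, Nat.le_sqrt', Nat.le_sqrt', ← pow_mul]
    exact hℓa
  have hJ1 : (1 : ℝ) ≤ J := by exact_mod_cast (by omega : 1 ≤ J)
  have hℓ1 : (1 : ℝ) ≤ ℓ := by
    have : 1 ≤ ℓ := le_trans (Nat.one_le_pow _ _ (by omega)) hℓa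
    exact_mod_cast this
  have hJupR : (ℓ : ℝ) ≤ (J + 1) ^ 4 := by exact_mod_cast hJup
  have hJlowR : (J : ℝ) ^ 4 ≤ ℓ := by exact_mod_cast hJlow
  set k := ⌊ε' * ℓ / (2 * r)⌋₊ with hk
  have hkup : (k : ℝ) ≤ ε' * ℓ / (2 * r) := Nat.floor_le (by positivity)
  have hx2 : 2 ≤ ε' * ℓ / (2 * r) := by
    rw [div_le_iff₀ hε'0] at hℓb
    rw [le_div_iff₀ (by positivity)]; linarith
  have hklow : ε' * ℓ / (4 * r) ≤ k := by
    have h1 := Nat.lt_floor_add_one (ε' * ℓ / (2 * r))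
    have h2 : ε' * ℓ / (4 * r) = (ε' * ℓ / (2 * r)) / 2 := by field_simp; norm_num
    rw [h2]
    have : ε' * ℓ / (2 * r) < k + 1 := h1
    linarith
  refine ⟨J, k, C₃ * (J + 1), by positivity, ?_, ?_, ?_, ?_⟩
  · rw [le_div_iff₀ (by positivity)] at hkup
    have : ε' * ℓ ≤ ε * ℓ := by gcongr; exact min_le_left _ _
    linarith
  · have h1 : ε' * ℓ / (2 * r) ≤ ℓ := by
      rw [div_le_iff₀ (by positivity)]
      have : ε' ≤ 1 := min_le_right _ _
      calc ε' * ℓ ≤ 1 * ℓ := by gcongr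
        _ ≤ ℓ * (2 * r) := by nlinarith
    exact_mod_cast hkup.trans h1
  · have h1 : (ℓ : ℝ) * ((2 * (r * ℓ) + 1) ^ 2 * q ^ J) ≤ C₂ := by
      have h2 : (2 * (r * (ℓ : ℝ)) + 1) ≤ (2 * r + 1) * ℓ := by nlinarith
      calc (ℓ : ℝ) * ((2 * (r * ℓ) + 1) ^ 2 * q ^ J)
          ≤ ℓ * (((2 * r + 1) * ℓ) ^ 2 * q ^ J) := by gcongr
        _ = (2 * r + 1) ^ 2 * (ℓ ^ 3 * q ^ J) := by ring
        _ ≤ (2 * r + 1) ^ 2 * (((J + 1) ^ 4) ^ 3 * q ^ J) := by gcongr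
        _ = (2 * r + 1) ^ 2 * ((J + 1) ^ 12 * q ^ J) := by ring
        _ ≤ C₂ := by rw [hC₂]; gcongr; exact hC J
    have h3 : (J : ℝ) * t₁ ≤ (J + 1) * t₁ := by gcongr; linarith
    have h4 : C₂ ≤ C₂ * (J + 1) := le_mul_of_one_le_right hC₂0 (by linarith)
    have h5 : C₃ * (J + 1) = (J + 1) * t₁ + C₂ * (J + 1) + (J + 1) := by rw [hC₃]; ring
    linarith
  · have hlog : M * Real.log ℓ ≤ 4 * M * J := by
      have h1 : Real.log ℓ ≤ 4 * J := by
        calc Real.log ℓ ≤ Real.log (((J : ℝ) + 1) ^ 4) := Real.log_le_log (by linarith) hJupR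
          _ = 4 * Real.log (J + 1) := by rw [Real.log_pow]; norm_num
          _ ≤ 4 * J := by
            have := Real.log_le_sub_one_of_pos (show (0 : ℝ) < J + 1 by positivity)
            linarith
      calc M * Real.log ℓ ≤ M * (4 * J) := mul_le_mul_of_nonneg_left h1 hM
        _ = 4 * M * J := by ring
    rw [Real.rpow_def_of_pos (by linarith), Real.exp_le_exp]
    have hJbig : 16 * M ≤ c * J := by
      have h1 : (J₀ : ℝ) ≤ J := by exact_mod_cast (by omega : J₀ ≤ J)
      have h2 := hJ₀.trans h1
      rw [div_le_iff₀ hc0] at h2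
      linarith
    have hexp : c / 4 * J ^ 2 ≤ (k / 2 : ℝ) ^ 2 / (2 * ((ℓ + 1) * (C₃ * (J + 1) / 2) ^ 2)) := by
      rw [le_div_iff₀ (by positivity)]
      have h1 : (ε' * ℓ / (4 * r)) ^ 2 ≤ (k : ℝ) ^ 2 := by gcongr
      have h2 : c / 4 * J ^ 2 * (2 * ((ℓ + 1) * (C₃ * (J + 1) / 2) ^ 2)) ≤
          c / 4 * J ^ 2 * (2 * ((2 * ℓ) * (C₃ * (2 * J) / 2) ^ 2)) := by
        gcongr <;> linarith
      have h3 : c / 4 * J ^ 2 * (2 * ((2 * ℓ) * (C₃ * (2 * J) / 2) ^ 2)) =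
          (c * C₃ ^ 2) * (ℓ * J ^ 4) := by ring
      have h4 : c * C₃ ^ 2 = (ε' / (4 * r)) ^ 2 / 4 := by
        rw [hc]; field_simp; norm_num
      have h5 : (ℓ : ℝ) * J ^ 4 ≤ ℓ * ℓ := by gcongr
      calc _ ≤ (c * C₃ ^ 2) * (ℓ * J ^ 4) := h2.trans h3.le
        _ ≤ (c * C₃ ^ 2) * (ℓ * ℓ) := by gcongr
        _ = (ε' * ℓ / (4 * r)) ^ 2 / 4 := by rw [h4]; ring
        _ ≤ (k / 2 : ℝ) ^ 2 := by linarith [show (k / 2 : ℝ) ^ 2 = k ^ 2 / 4 by ring]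
    have h6 : 4 * M * J ≤ c / 4 * J ^ 2 := by
      have := mul_le_mul_of_nonneg_right hJbig (show (0 : ℝ) ≤ J by linarith)
      linarith [show c / 4 * (J : ℝ) ^ 2 = (c * J) * J / 4 by ring]
    rw [neg_div, mul_neg, neg_le_neg_iff, mul_comm]
    linarith

/-- At every large scale `ℓ`, the probability that the origin is reached from the half-plane at
level `b` drops from nearly `1` to nearly `0` when `b` decreases by `ε ℓ`. -/
theorem exists_sharp_transition (hT : T.LocallyRegular)
    (hfill : ∃ A : Set Site, A.Finite ∧ T.FillsSpace A) (hπ : ∃ p, IsPerturbation p π T)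
    {ε M : ℝ} (hε : 0 < ε) (hM : 0 ≤ M) :
    ∃ ℓ₀ : ℕ, 0 < ℓ₀ ∧ ∀ ℓ ≥ ℓ₀, ∀ ξ : Site → ℕ → Ω → Config N → Bool, IsSureNoise T π μ ξ →
      ∀ u : Plane, ‖u‖ = 1 → ∀ b : ℝ,
        μ.real {ω | (0 : Site) ∉ occupied (envOf ξ ω) (halfSites u b) ℓ} ≤ (ℓ : ℝ) ^ (-M) ∨
        μ.real {ω | (0 : Site) ∈ occupied (envOf ξ ω) (halfSites u (b - ε * ℓ)) ℓ} ≤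
          (ℓ : ℝ) ^ (-M) := by
  obtain ⟨t₁, q, hq0, hq1, hV⟩ := exists_meanVacant_le (μ := μ) hT hfill hπ
  obtain ⟨ℓ₀, hℓ₀, hround⟩ := exists_rounds hq0 hq1 hε hM t₁ (range N) range_pos
  refine ⟨ℓ₀, hℓ₀, fun ℓ hℓ ξ hξ u hu b => ?_⟩
  obtain ⟨J, k, D, hD0, hk1, hkℓ, hDle, hexp⟩ := hround ℓ hℓ
  lift D to NNReal using hD0.le
  have hsub : ∀ ζ : Site → ℕ → Ω → Config N → Bool, IsSureNoise T π μ ζ →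
      HasSubgaussianMGF (fun ω => vacantTime (ℓ + 1) (halfSites u b) (envOf ζ ω) -
        meanVacant μ ζ (ℓ + 1) (halfSites u b)) ((ℓ + 1 : ℕ) * (D / 2) ^ 2) μ := by
    intro ζ hζ
    refine hζ.hasSubgaussianMGF_vacantTime (D := D) (L := ℓ + 1) (fun A hA l hl => ?_) (ℓ + 1)
      le_rfl _ (reachable_halfSites T hu b)
    refine (hV ζ hζ A hA l J).trans (add_le_add le_rfl (le_trans ?_ hDle))
    have : (l : ℝ) ≤ ℓ := by exact_mod_cast Nat.lt_succ_iff.1 hl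
    gcongr
  have hk0 : (0 : ℝ) ≤ k / 2 := by positivity
  have hval : Real.exp (-(k / 2 : ℝ) ^ 2 / (2 * (((ℓ + 1 : ℕ) * (D / 2) ^ 2 : NNReal) : ℝ))) ≤
      (ℓ : ℝ) ^ (-M) := by
    refine le_trans (le_of_eq ?_) hexp
    push_cast; rfl
  rcases le_or_gt (meanVacant μ ξ (ℓ + 1) (halfSites u b)) (ℓ + 1 - k / 2) with hle | hgt
  · left
    refine (measureReal_mono fun ω hω => ?_).trans (((hsub ξ hξ).measure_ge_le hk0).trans hval)
    have := vacantTime_eq_of_notMem (hξ.sure ω) hω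
    change (k / 2 : ℝ) ≤ _
    rw [this]; linarith
  -- by the finite speed, after `k` steps the process from the lower half-plane is still contained
  -- in the higher one, so it hits the origin `k` steps later than the process from there
  · right
    have hs := hξ.shift 0 k
    refine (measureReal_mono fun ω hω => ?_).trans
      (((hsub _ hs).neg.measure_ge_le hk0).trans hval)
    have h1 : (0 : Site) ∈ occupied (envOf (shiftNoise 0 k ξ) ω) (halfSites u b) (ℓ - k) := by
      have h2 : (0 : Site) ∈ occupied (envOf ξ ω) (halfSites u (b - ε * ℓ)) (k + (ℓ - k)) := by
        rw [Nat.add_sub_cancel' hkℓ]; exact hω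
      rw [occupied_add] at h2
      refine occupied_subset (hs.sure ω).monotone (fun y hy => ?_) _ h2
      obtain ⟨a, ha, hya⟩ := exists_near_of_mem_occupied (hξ.sure ω) hy
      rw [mem_halfSites] at ha ⊢
      have h3 := (abs_le.1 (abs_inner_toPlane_le hu (y - a))).2
      rw [inner_toPlane_sub] at h3
      linarith
    have h2 := vacantTime_le_of_mem (hs.sure ω) (L := ℓ + 1) h1
    have h3 : meanVacant μ (shiftNoise 0 k ξ) (ℓ + 1) (halfSites u b) =
      meanVacant μ ξ (ℓ + 1) (halfSites u b) := hξ.noise.integral_shift_vacantTime 0 k _ _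
    rw [Nat.cast_sub hkℓ] at h2
    change (k / 2 : ℝ) ≤ -(_ - _)
    rw [h3]; linarith

variable {ξ : Site → ℕ → Ω → Config N → Bool}

/-! ### From one large scale to all times -/

lemma translate_halfSites (u : Plane) (b : ℝ) (x : Site) :
    {y | x + y ∈ halfSites u b} = halfSites u (b - inner ℝ (toPlane x) u) := by
  ext y
  rw [Set.mem_ofPred_eq, mem_halfSites, mem_halfSites, inner_toPlane_add]
  constructor <;> intro h <;> linarith

/-- By translation invariance, the probability that the process from a half-plane occupies `x`
depends only on the distance of `x` to the half-plane. -/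
lemma IsNoise.real_mem_halfSites {Ω' : Type*} [MeasurableSpace Ω'] {μ' : Measure Ω'}
    [IsProbabilityMeasure μ'] {ξ' : Site → ℕ → Ω' → Config N → Bool} (h : IsNoise π μ ξ)
    (h' : IsNoise π μ' ξ') (u : Plane) (b : ℝ) (t : ℕ) (x : Site) :
    μ.real {ω | x ∈ occupied (envOf ξ ω) (halfSites u b) t} =
      μ'.real {ω | (0 : Site) ∈ occupied (envOf ξ' ω)
        (halfSites u (b - inner ℝ (toPlane x) u)) t} := by
  have hE : MeasurableSet {B : Set Site | (0 : Site) ∈ B} :=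
    measurableSet_setOfPred.2 (measurable_set_iff.1 measurable_id (0 : Site))
  have h1 := real_occupied_eq (h.shift x 0) h' hE t (halfSites u (b - inner ℝ (toPlane x) u))
  have h3 : ∀ ω, ((0 : Site) ∈ occupied (envOf (shiftNoise x 0 ξ) ω)
      (halfSites u (b - inner ℝ (toPlane x) u)) t ↔
      x ∈ occupied (envOf ξ ω) (halfSites u b) t) := by
    intro ω
    rw [envOf_shiftNoise, ← translate_halfSites, occupied_shift, shiftEnv_zero]
    simp
  simp only [Set.mem_ofPred_eq, h3] at h1
  exact h1

lemma IsNoise.real_notMem (h : IsNoise π μ ξ) (A : Set Site) (t : ℕ) (x : Site) :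
    μ.real {ω | x ∉ occupied (envOf ξ ω) A t} = 1 - μ.real {ω | x ∈ occupied (envOf ξ ω) A t} := by
  rw [← probReal_compl_eq_one_sub (h.measurableSet_mem A t x)]
  rfl

/-- The front of a half-plane has speed at most `2 * range N`. -/
lemma halfSites_speed {η : Env N} (hη : T.IsAssignment η) {u : Plane} (hu : ‖u‖ = 1) {b : ℝ}
    {t : ℕ} {x : Site} (hx : x ∈ occupied η (halfSites u b) t) :
    inner ℝ (toPlane x) u ≤ b + 2 * range N * t := by
  obtain ⟨a, ha, hxa⟩ := exists_near_of_mem_occupied hη hx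
  have h3 := (abs_le.1 (abs_inner_toPlane_le hu (x - a))).2
  rw [inner_toPlane_sub] at h3
  have := mem_halfSites.1 ha
  linarith

/-- The transition level at a scale `ℓ` at which the transition is sharp. -/
lemma IsSureNoise.exists_threshold (h : IsSureNoise T π μ ξ) {u : Plane} (hu : ‖u‖ = 1) {ℓ : ℕ}
    (hℓ : 0 < ℓ) {ε δ : ℝ} (hδ0 : 0 ≤ δ) (hδ1 : δ < 1)
    (hsharp : ∀ b : ℝ,
      μ.real {ω | (0 : Site) ∉ occupied (envOf ξ ω) (halfSites u b) ℓ} ≤ δ ∨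
      μ.real {ω | (0 : Site) ∈ occupied (envOf ξ ω) (halfSites u (b - ε * ℓ)) ℓ} ≤ δ) :
    ∃ v : ℝ, 0 ≤ v ∧ v ≤ 2 * range N ∧
      (∀ b, -(v * ℓ) < b →
        μ.real {ω | (0 : Site) ∉ occupied (envOf ξ ω) (halfSites u b) ℓ} ≤ δ) ∧
      ∀ b, b < -((v + ε) * ℓ) →
        μ.real {ω | (0 : Site) ∈ occupied (envOf ξ ω) (halfSites u b) ℓ} ≤ δ := by
  have hℓ' : (0 : ℝ) < ℓ := by exact_mod_cast hℓ
  -- `v * ℓ` is the distance at which the probability of success drops below `1 - δ`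
  let S : Set ℝ := {b | μ.real {ω | (0 : Site) ∉ occupied (envOf ξ ω) (halfSites u b) ℓ} ≤ δ}
  have hS0 : (0 : ℝ) ∈ S := by
    change μ.real _ ≤ δ
    have : {ω | (0 : Site) ∉ occupied (envOf ξ ω) (halfSites u 0) ℓ} = ∅ := by
      ext ω
      simp only [Set.mem_ofPred_eq, Set.mem_empty_iff_false, iff_false, not_not]
      exact subset_occupied (h.sure ω) _ _ (by rw [mem_halfSites, toPlane_zero]; simp)
    rw [this]; simpa using hδ0
  have hSlow : ∀ b ∈ S, -(2 * range N * ℓ) ≤ b := by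
    intro b hb
    by_contra! hlt
    have : {ω | (0 : Site) ∉ occupied (envOf ξ ω) (halfSites u b) ℓ} = Set.univ := by
      ext ω
      simp only [Set.mem_ofPred_eq, Set.mem_univ, iff_true]
      intro hc
      have := halfSites_speed (h.sure ω) hu hc
      rw [toPlane_zero, inner_zero_left] at this
      linarith
    change μ.real _ ≤ δ at hb
    rw [this, probReal_univ] at hb
    linarith
  have hbdd : BddBelow S := ⟨_, fun b hb => hSlow b hb⟩
  have hinf0 : sInf S ≤ 0 := csInf_le hbdd hS0
  have hinfl : -(2 * range N * ℓ) ≤ sInf S := le_csInf ⟨0, hS0⟩ hSlow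
  refine ⟨-sInf S / ℓ, div_nonneg (by linarith) hℓ'.le, ?_, ?_, ?_⟩
  · rw [div_le_iff₀ hℓ']; linarith
  · intro b hb
    rw [div_mul_cancel₀ _ hℓ'.ne', neg_neg] at hb
    obtain ⟨b', hb', hlt⟩ := exists_lt_of_csInf_lt ⟨0, hS0⟩ hb
    have hb'' : μ.real {ω | (0 : Site) ∉ occupied (envOf ξ ω) (halfSites u b') ℓ} ≤ δ := hb'
    have hsub : {ω | (0 : Site) ∉ occupied (envOf ξ ω) (halfSites u b) ℓ} ⊆
        {ω | (0 : Site) ∉ occupied (envOf ξ ω) (halfSites u b') ℓ} := fun ω hω hc =>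
      hω (occupied_subset (h.sure ω).monotone (halfSites_mono hlt.le) _ hc)
    exact (measureReal_mono hsub).trans hb''
  · intro b hb
    rw [add_mul, div_mul_cancel₀ _ hℓ'.ne'] at hb
    rcases hsharp (b + ε * ℓ) with h1 | h1
    · have : sInf S ≤ b + ε * ℓ := csInf_le hbdd h1
      linarith
    · rwa [add_sub_cancel_right] at h1

/-- The sites that influence `x` within time `ℓ`. -/
noncomputable def nearSites (N : Finset Site) (ℓ : ℕ) (x : Site) : Finset Site :=
  (box (range N * ℓ)).map (addLeftEmbedding x)

lemma mem_nearSites {ℓ : ℕ} {x y : Site} :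
    y ∈ nearSites N ℓ x ↔ ‖y - x‖ ≤ range N * ℓ := by
  simp only [nearSites, Finset.mem_map, addLeftEmbedding_apply, mem_box]
  push_cast
  constructor
  · rintro ⟨z, hz, rfl⟩; simpa using hz
  · intro h; exact ⟨y - x, h, by abel⟩

lemma self_mem_nearSites {ℓ : ℕ} (x : Site) : x ∈ nearSites N ℓ x := by
  rw [mem_nearSites, sub_self, norm_zero]; positivity

lemma card_nearSites (ℓ : ℕ) (x : Site) :
    (nearSites N ℓ x).card = (2 * (range N * ℓ) + 1) ^ 2 := by
  rw [nearSites, Finset.card_map, card_box]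

/-- The tail of the number of defects for events that are determined by the noise in one time slab
of length `ℓ` each. -/
lemma IsSureNoise.real_defectCount_slab_le (h : IsSureNoise T π μ ξ) {ℓ : ℕ}
    {Bad : ℕ → Site → ℕ → Set Ω} {δ ε : ℝ} (hδ0 : 0 < δ) (hδ1 : δ ≤ 1)
    (hbefore : ∀ n x k, MeasurableSet[noiseσ ξ (before (n * ℓ + ℓ))] (Bad n x k))
    (hafter : ∀ n x k, MeasurableSet[noiseσ ξ (after (n * ℓ))] (Bad n x k))
    (hBad : ∀ n x k, μ.real (Bad n x k) ≤ δ)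
    (hε : 2 * ((2 * (range N * ℓ) + 1) ^ 2 : ℕ) * δ ^ ε ≤ Real.exp (-2)) (n : ℕ) (x : Site) :
    μ.real {ω | ε * n ≤ defectCount (nearSites N ℓ) Bad n x ω} ≤ Real.exp (-n) := by
  refine real_defectCount_ge_le (μ := μ) (nbr := nearSites N ℓ) (Bad := Bad)
    (F := fun n => noiseσ ξ (before (n * ℓ)))
    (fun a b hab => noiseσ_mono ξ (before_mono (Nat.mul_le_mul_right ℓ hab)))
    (fun n i k => ?_) (fun i => (card_nearSites ℓ i).le) (fun i => ⟨i, self_mem_nearSites i⟩)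
    hδ0 hδ1 (fun n i k E hE => ?_) hε n x
  · rw [add_one_mul]; exact hbefore n i k
  · rw [h.noise.real_inter_eq_mul hE (hafter n i k), mul_comm]
    exact mul_le_mul_of_nonneg_right (hBad n i k) measureReal_nonneg

/-- The process is not slower than at scale `ℓ`: apart from defects, in each slab of `ℓ` steps the
front advances by `a`. -/
lemma IsSureNoise.block_lower (h : IsSureNoise T π μ ξ) {u : Plane} {ℓ : ℕ}
    {a δ ε : ℝ} (ha : a ≤ 2 * range N * ℓ) (hδ0 : 0 < δ) (hδ1 : δ ≤ 1)
    (hadv : ∀ b, -a ≤ b →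
      μ.real {ω | (0 : Site) ∉ occupied (envOf ξ ω) (halfSites u b) ℓ} ≤ δ)
    (hε : 2 * ((2 * (range N * ℓ) + 1) ^ 2 : ℕ) * δ ^ ε ≤ Real.exp (-2)) (n : ℕ) {b : ℝ}
    (hb : 0 ≤ b + a * n - 2 * range N * ℓ * ε * n) :
    μ.real {ω | (0 : Site) ∉ occupied (envOf ξ ω) (halfSites u b) (n * ℓ)} ≤ Real.exp (-n) := by
  set ρ : ℝ := 2 * range N * ℓ with hρ
  have hρ0 : 0 ≤ ρ := by positivity
  let lev : ℕ → ℕ → ℝ := fun m k => b + a * m - ρ * k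
  let Bad : ℕ → Site → ℕ → Set Ω := fun m x k =>
    {ω | inner ℝ (toPlane x) u ≤ lev (m + 1) k ∧
      x ∉ occupied (envOf (shiftNoise 0 (m * ℓ) ξ) ω) (halfSites u (lev m k)) ℓ}
  have hmeas : ∀ x (P : Prop), MeasurableSet {B : Set Site | P ∧ x ∉ B} := fun x P =>
    (MeasurableSet.const P).inter
      (measurableSet_setOfPred.2 (measurable_set_iff.1 measurable_id (x : Site))).compl
  have htail := h.real_defectCount_slab_le (Bad := Bad) hδ0 hδ1
    (fun n x k => measurable_occupied_before ξ 0 (n * ℓ) ℓ (halfSites u (lev n k))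
      (hmeas x (inner ℝ (toPlane x) u ≤ lev (n + 1) k)))
    (fun n x k => measurable_occupied_after ξ 0 (n * ℓ) ℓ (halfSites u (lev n k))
      (hmeas x (inner ℝ (toPlane x) u ≤ lev (n + 1) k))) ?_ hε n 0
  · refine (measureReal_mono fun ω hω => ?_).trans htail
    change ε * n ≤ _
    by_contra! hlt
    have key : ∀ m x, inner ℝ (toPlane x) u ≤ lev m (defectCount (nearSites N ℓ) Bad m x ω) →
        x ∈ occupied (envOf ξ ω) (halfSites u b) (m * ℓ) := by
      intro m
      induction m with
      | zero =>
        intro x hx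
        rw [zero_mul]
        change inner ℝ (toPlane x) u ≤ b
        simpa [lev, defectCount] using hx
      | succ m ih =>
        intro x hx
        set K := (nearSites N ℓ x).sup fun j => defectCount (nearSites N ℓ) Bad m j ω with hK
        have hKle : ∀ y ∈ nearSites N ℓ x, defectCount (nearSites N ℓ) Bad m y ω ≤ K :=
          fun y hy => Finset.le_sup (f := fun j => defectCount (nearSites N ℓ) Bad m j ω) hy
        have hlev : ∀ y ∈ nearSites N ℓ x,
            lev m K ≤ lev m (defectCount (nearSites N ℓ) Bad m y ω) := by
          intro y hy
          have h1 : ((defectCount (nearSites N ℓ) Bad m y ω : ℕ) : ℝ) ≤ K := by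
            exact_mod_cast hKle y hy
          simp only [lev]
          have := mul_le_mul_of_nonneg_left h1 hρ0
          linarith
        by_cases hbad : ω ∈ Bad m x K
        · rw [defectCount_succ_of_mem hbad, ← hK] at hx
          refine occupied_monotone (h.sure ω) _ (by rw [add_one_mul]; omega) (ih x ?_)
          refine le_trans ?_ (hlev x (self_mem_nearSites x))
          simp only [lev] at hx ⊢
          push_cast at hx
          linarith
        · rw [defectCount_succ_of_notMem hbad, ← hK] at hx
          have h1 : x ∈ occupied (envOf (shiftNoise 0 (m * ℓ) ξ) ω) (halfSites u (lev m K)) ℓ := by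
            by_contra hc
            exact hbad ⟨hx, hc⟩
          rw [add_one_mul, occupied_add]
          exact mem_occupied_of_local ((h.sure ω).shift _ _) h1 fun y hy hyH =>
            ih y (le_trans hyH (hlev y (mem_nearSites.2 hy)))
    apply hω
    apply key n
    rw [toPlane_zero, inner_zero_left]
    simp only [lev]
    have := mul_le_mul_of_nonneg_left hlt.le hρ0
    linarith
  · intro m x k
    by_cases hx : inner ℝ (toPlane x) u ≤ lev (m + 1) k
    · refine (measureReal_mono (s₂ := {ω | x ∉ occupied (envOf (shiftNoise 0 (m * ℓ) ξ) ω)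
        (halfSites u (lev m k)) ℓ}) fun ω hω => hω.2).trans ?_
      rw [(h.noise.shift 0 (m * ℓ)).real_notMem,
        (h.noise.shift 0 (m * ℓ)).real_mem_halfSites h.noise, ← h.noise.real_notMem]
      apply hadv
      simp only [lev] at hx ⊢
      push_cast at hx
      linarith
    · have : Bad m x k = ∅ := by
        ext ω; simp only [Bad, Set.mem_ofPred_eq, hx, false_and, Set.mem_empty_iff_false]
      rw [this]; simpa using hδ0.le

/-- The process is not faster than at scale `ℓ`: apart from defects, in each slab of `ℓ` steps the
front advances by at most `a`. -/
lemma IsSureNoise.block_upper (h : IsSureNoise T π μ ξ) {u : Plane} (hu : ‖u‖ = 1) {ℓ : ℕ}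
    {a δ ε : ℝ} (ha : 0 ≤ a) (hδ0 : 0 < δ) (hδ1 : δ ≤ 1)
    (hadv : ∀ b, b < -a →
      μ.real {ω | (0 : Site) ∈ occupied (envOf ξ ω) (halfSites u b) ℓ} ≤ δ)
    (hε : 2 * ((2 * (range N * ℓ) + 1) ^ 2 : ℕ) * δ ^ ε ≤ Real.exp (-2)) (n : ℕ) {b : ℝ}
    (hb : b + a * n + 2 * range N * ℓ * ε * n < 0) :
    μ.real {ω | (0 : Site) ∈ occupied (envOf ξ ω) (halfSites u b) (n * ℓ)} ≤ Real.exp (-n) := by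
  set ρ : ℝ := 2 * range N * ℓ with hρ
  have hρ0 : 0 ≤ ρ := by positivity
  let lev : ℕ → ℕ → ℝ := fun m k => b + a * m + ρ * k
  let Bad : ℕ → Site → ℕ → Set Ω := fun m x k =>
    {ω | lev (m + 1) k < inner ℝ (toPlane x) u ∧
      x ∈ occupied (envOf (shiftNoise 0 (m * ℓ) ξ) ω) (halfSites u (lev m k)) ℓ}
  have hmeas : ∀ x (P : Prop), MeasurableSet {B : Set Site | P ∧ x ∈ B} := fun x P =>
    (MeasurableSet.const P).inter
      (measurableSet_setOfPred.2 (measurable_set_iff.1 measurable_id (x : Site)))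
  have htail := h.real_defectCount_slab_le (Bad := Bad) hδ0 hδ1
    (fun n x k => measurable_occupied_before ξ 0 (n * ℓ) ℓ (halfSites u (lev n k))
      (hmeas x (lev (n + 1) k < inner ℝ (toPlane x) u)))
    (fun n x k => measurable_occupied_after ξ 0 (n * ℓ) ℓ (halfSites u (lev n k))
      (hmeas x (lev (n + 1) k < inner ℝ (toPlane x) u))) ?_ hε n 0
  · refine (measureReal_mono fun ω hω => ?_).trans htail
    change ε * n ≤ _
    by_contra! hlt
    have key : ∀ m x, x ∈ occupied (envOf ξ ω) (halfSites u b) (m * ℓ) →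
        inner ℝ (toPlane x) u ≤ lev m (defectCount (nearSites N ℓ) Bad m x ω) := by
      intro m
      induction m with
      | zero =>
        intro x hx
        rw [zero_mul] at hx
        have hx' : inner ℝ (toPlane x) u ≤ b := hx
        simpa [lev, defectCount] using hx'
      | succ m ih =>
        intro x hx
        set K := (nearSites N ℓ x).sup fun j => defectCount (nearSites N ℓ) Bad m j ω with hK
        have hKle : ∀ y ∈ nearSites N ℓ x, defectCount (nearSites N ℓ) Bad m y ω ≤ K :=
          fun y hy => Finset.le_sup (f := fun j => defectCount (nearSites N ℓ) Bad m j ω) hy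
        have hlev : ∀ y ∈ nearSites N ℓ x,
            lev m (defectCount (nearSites N ℓ) Bad m y ω) ≤ lev m K := by
          intro y hy
          have h1 : ((defectCount (nearSites N ℓ) Bad m y ω : ℕ) : ℝ) ≤ K := by
            exact_mod_cast hKle y hy
          simp only [lev]
          have := mul_le_mul_of_nonneg_left h1 hρ0
          linarith
        rw [add_one_mul, occupied_add] at hx
        have h1 : x ∈ occupied (envOf (shiftNoise 0 (m * ℓ) ξ) ω) (halfSites u (lev m K)) ℓ :=
          mem_occupied_of_local ((h.sure ω).shift _ _) hx fun y hy hyA =>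
            (ih y hyA).trans (hlev y (mem_nearSites.2 hy))
        by_cases hbad : ω ∈ Bad m x K
        · rw [defectCount_succ_of_mem hbad, ← hK]
          have h2 := halfSites_speed ((h.sure ω).shift 0 (m * ℓ)) hu h1
          simp only [lev] at h2 ⊢
          push_cast
          linarith
        · rw [defectCount_succ_of_notMem hbad, ← hK]
          by_contra! hc
          exact hbad ⟨hc, h1⟩
    have h2 := key n 0 hω
    rw [toPlane_zero, inner_zero_left] at h2
    simp only [lev] at h2
    have := mul_le_mul_of_nonneg_left hlt.le hρ0
    linarith
  · intro m x k
    by_cases hx : lev (m + 1) k < inner ℝ (toPlane x) u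
    · refine (measureReal_mono (s₂ := {ω | x ∈ occupied (envOf (shiftNoise 0 (m * ℓ) ξ) ω)
        (halfSites u (lev m k)) ℓ}) fun ω hω => hω.2).trans ?_
      rw [(h.noise.shift 0 (m * ℓ)).real_mem_halfSites h.noise]
      apply hadv
      simp only [lev] at hx ⊢
      push_cast at hx
      linarith
    · have : Bad m x k = ∅ := by
        ext ω; simp only [Bad, Set.mem_ofPred_eq, hx, false_and, Set.mem_empty_iff_false]
      rw [this]; simpa using hδ0.le

/-! ### The half-space speed -/

/-- At a large scale `ℓ`, defects of any positive density are exponentially unlikely. -/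
lemma exists_scale_le {ε : ℝ} (hε : 0 < ε) {r : ℕ} (hr : 0 < r) :
    ∃ ℓ₀ : ℕ, 1 < ℓ₀ ∧ ∀ ℓ ≥ ℓ₀,
      2 * ((2 * (r * ℓ) + 1) ^ 2 : ℕ) * ((ℓ : ℝ) ^ (-(3 / ε))) ^ ε ≤ Real.exp (-2) := by
  obtain ⟨ℓ₀, h⟩ := exists_nat_ge (18 * r ^ 2 / Real.exp (-2))
  refine ⟨max ℓ₀ 2, lt_of_lt_of_le one_lt_two (le_max_right _ _), fun ℓ hℓ => ?_⟩
  have h1 : (2 : ℝ) ≤ ℓ := by exact_mod_cast (le_max_right _ _).trans hℓ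
  have h2 : 18 * r ^ 2 / Real.exp (-2) ≤ ℓ := h.trans (by exact_mod_cast (le_max_left _ _).trans hℓ)
  have hr' : (1 : ℝ) ≤ r := by exact_mod_cast hr
  rw [div_le_iff₀ (Real.exp_pos _)] at h2
  rw [← Real.rpow_mul (by linarith), neg_mul, div_mul_cancel₀ _ hε.ne', Real.rpow_neg (by linarith)]
  rw [show (3 : ℝ) = (3 : ℕ) by norm_num, Real.rpow_natCast]
  push_cast
  rw [← div_eq_mul_inv, div_le_iff₀ (by positivity)]
  have h3 : 2 * ((r : ℝ) * (ℓ : ℝ)) + 1 ≤ 3 * (r * ℓ) := by nlinarith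
  calc 2 * (2 * ((r : ℝ) * (ℓ : ℝ)) + 1) ^ 2 ≤ 2 * (3 * ((r : ℝ) * ℓ)) ^ 2 := by gcongr
    _ = 18 * (r : ℝ) ^ 2 * ℓ ^ 2 := by ring
    _ ≤ (ℓ * Real.exp (-2)) * ℓ ^ 2 := by gcongr
    _ = Real.exp (-2) * ℓ ^ 3 := by ring

/-- At a suitable scale, the front advances at an approximate speed with exponentially small
errors. -/
theorem IsSureNoise.exists_block_speed (h : IsSureNoise T π μ ξ) (hT : T.LocallyRegular)
    (hfill : ∃ A : Set Site, A.Finite ∧ T.FillsSpace A) (hπ : ∃ p, IsPerturbation p π T)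
    {ε : ℝ} (hε : 0 < ε) :
    ∃ ℓ : ℕ, 0 < ℓ ∧ ∀ u : Plane, ‖u‖ = 1 → ∃ v : ℝ, 0 ≤ v ∧ v ≤ 2 * range N ∧
      ∀ (n : ℕ) (b : ℝ),
        (0 ≤ b + n * ℓ * (v - ε) →
          μ.real {ω | (0 : Site) ∉ occupied (envOf ξ ω) (halfSites u b) (n * ℓ)} ≤
            Real.exp (-n)) ∧
        (b + n * ℓ * (v + ε) < 0 →
          μ.real {ω | (0 : Site) ∈ occupied (envOf ξ ω) (halfSites u b) (n * ℓ)} ≤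
            Real.exp (-n)) := by
  have hr1 : (1 : ℝ) ≤ range N := one_le_range
  set ε₁ := ε / 4 with hε₁
  have hε₁0 : 0 < ε₁ := by positivity
  set ε₂ := ε / (8 * range N) with hε₂
  have hε₂0 : 0 < ε₂ := by positivity
  obtain ⟨ℓ₁, hℓ₁, hscale⟩ := exists_scale_le hε₂0 (range_pos (N := N))
  obtain ⟨ℓ₂, hℓ₂, hsharp⟩ := exists_sharp_transition (μ := μ) hT hfill hπ hε₁0
    (show 0 ≤ 3 / ε₂ by positivity)
  set ℓ := max ℓ₁ ℓ₂ with hℓ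
  have hℓ1 : 1 < ℓ := lt_of_lt_of_le hℓ₁ (le_max_left _ _)
  have hℓ1' : (1 : ℝ) < ℓ := by exact_mod_cast hℓ1
  have hscale := hscale ℓ (le_max_left _ _)
  have hsharp := hsharp ℓ (le_max_right _ _) ξ h
  set δ : ℝ := (ℓ : ℝ) ^ (-(3 / ε₂)) with hδ
  have hδ0 : 0 < δ := by positivity
  have hδ1 : δ < 1 := Real.rpow_lt_one_of_one_lt_of_neg hℓ1' (by
    have : 0 < 3 / ε₂ := by positivity
    linarith)
  refine ⟨ℓ, by omega, fun u hu => ?_⟩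
  obtain ⟨v, hv0, hvle, hlow, hup⟩ := h.exists_threshold hu (by omega) hδ0.le hδ1 (hsharp u hu)
  have hρε : 2 * range N * ε₂ = ε / 4 := by
    rw [hε₂]; field_simp; norm_num
  refine ⟨v, hv0, hvle, fun n b => ⟨fun hb => ?_, fun hb => ?_⟩⟩
  · refine h.block_lower (a := (v - ε₁) * ℓ) ?_ hδ0 hδ1.le (fun b' hb' => hlow b' ?_) hscale n ?_
    · gcongr; linarith
    · nlinarith
    · have e1 : 2 * range N * ℓ * ε₂ * n = n * ℓ * (ε / 4) := by rw [← hρε]; ring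
      have e2 : 0 ≤ (n : ℝ) * ℓ * (ε / 2) := by positivity
      rw [e1, hε₁]
      linarith [show (v - ε / 4) * ℓ * n = n * ℓ * (v - ε) + n * ℓ * (ε / 4) + n * ℓ * (ε / 2) by
        ring]
  · refine h.block_upper (a := (v + 2 * ε₁) * ℓ) hu (by positivity) hδ0 hδ1.le
      (fun b' hb' => hup b' ?_) hscale n ?_
    · nlinarith
    · have e1 : 2 * range N * ℓ * ε₂ * n = n * ℓ * (ε / 4) := by rw [← hρε]; ring
      have e2 : 0 ≤ (n : ℝ) * ℓ * (ε / 4) := by positivity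
      rw [e1, hε₁]
      linarith [show (v + 2 * (ε / 4)) * ℓ * n =
        n * ℓ * (v + ε) - n * ℓ * (ε / 4) - n * ℓ * (ε / 4) by ring]

/-- An approximate speed, valid at all large times. -/
theorem IsSureNoise.exists_approx_speed (h : IsSureNoise T π μ ξ) (hT : T.LocallyRegular)
    (hfill : ∃ A : Set Site, A.Finite ∧ T.FillsSpace A) (hπ : ∃ p, IsPerturbation p π T)
    {ε : ℝ} (hε : 0 < ε) :
    ∃ (c : ℝ) (t₀ : ℕ), 0 < c ∧ ∀ u : Plane, ‖u‖ = 1 → ∃ v : ℝ, 0 ≤ v ∧ v ≤ 2 * range N ∧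
      ∀ t ≥ t₀, ∀ b : ℝ,
        (0 ≤ b + t * (v - ε) →
          μ.real {ω | (0 : Site) ∉ occupied (envOf ξ ω) (halfSites u b) t} ≤ Real.exp (-c * t)) ∧
        (b + t * (v + ε) ≤ 0 →
          μ.real {ω | (0 : Site) ∈ occupied (envOf ξ ω) (halfSites u b) t} ≤
            Real.exp (-c * t)) := by
  obtain ⟨ℓ, hℓ, hblock⟩ := h.exists_block_speed hT hfill hπ (half_pos hε)
  have hℓ' : (0 : ℝ) < ℓ := by exact_mod_cast hℓ
  obtain ⟨t₀, ht₀⟩ := exists_nat_gt (2 * ℓ * (2 * range N + ε) / ε + 2 * ℓ)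
  refine ⟨1 / (2 * ℓ), t₀, by positivity, fun u hu => ?_⟩
  obtain ⟨v, hv0, hv, hbd⟩ := hblock u hu
  refine ⟨v, hv0, hv, fun t ht b => ?_⟩
  have ht' : 2 * ℓ * (2 * range N + ε) / ε + 2 * ℓ < (t : ℝ) :=
    ht₀.trans_le (by exact_mod_cast ht)
  have hA : 0 ≤ 2 * ℓ * (2 * range N + ε) / ε := by positivity
  have ht2 : 2 * (ℓ : ℝ) < t := by linarith
  have htε : 2 * ℓ * (2 * range N + ε) < t * ε := by
    rw [← div_lt_iff₀ hε]; linarith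
  set n := t / ℓ with hn
  have hn1 : n * ℓ ≤ t := Nat.div_mul_le_self t ℓ
  have hn2 : t < (n + 1) * ℓ := by
    rw [hn, mul_comm]; exact Nat.lt_mul_div_succ t hℓ
  have hn1' : (n : ℝ) * ℓ ≤ t := by exact_mod_cast hn1
  have hn2' : (t : ℝ) < (n + 1) * ℓ := by exact_mod_cast hn2
  constructor
  · intro hb
    have hsub : {ω | (0 : Site) ∉ occupied (envOf ξ ω) (halfSites u b) t} ⊆
        {ω | (0 : Site) ∉ occupied (envOf ξ ω) (halfSites u b) (n * ℓ)} := fun ω hω hc =>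
      hω (occupied_monotone (h.sure ω) _ hn1 hc)
    refine (measureReal_mono hsub).trans (((hbd n b).1 ?_).trans ?_)
    · -- the rounding error is at most `ℓ` steps, paid for by the extra `ε / 2`
      have h1 : |v - ε / 2| ≤ 2 * range N + ε := by rw [abs_le]; constructor <;> linarith
      have h2 : (t - n * ℓ) * (v - ε / 2) ≤ ℓ * (2 * range N + ε) := by
        calc (t - n * ℓ) * (v - ε / 2) ≤ (t - n * ℓ) * (2 * range N + ε) :=
              mul_le_mul_of_nonneg_left ((le_abs_self _).trans h1) (by linarith)
          _ ≤ ℓ * (2 * range N + ε) :=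
              mul_le_mul_of_nonneg_right (by linarith) (by positivity)
      nlinarith
    · rw [Real.exp_le_exp, neg_mul, neg_le_neg_iff, one_div_mul_eq_div, div_le_iff₀ (by positivity)]
      nlinarith
  · intro hb
    have hsub : {ω | (0 : Site) ∈ occupied (envOf ξ ω) (halfSites u b) t} ⊆
        {ω | (0 : Site) ∈ occupied (envOf ξ ω) (halfSites u b) ((n + 1) * ℓ)} := fun ω hω =>
      occupied_monotone (h.sure ω) _ hn2.le hω
    refine (measureReal_mono hsub).trans (((hbd (n + 1) b).2 ?_).trans ?_)
    · have h2 : ((n + 1) * ℓ - t) * (v + ε / 2) ≤ ℓ * (2 * range N + ε) := by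
        calc ((n + 1) * ℓ - t) * (v + ε / 2) ≤ ((n + 1) * ℓ - t) * (2 * range N + ε) :=
              mul_le_mul_of_nonneg_left (by linarith) (by linarith)
          _ ≤ ℓ * (2 * range N + ε) :=
              mul_le_mul_of_nonneg_right (by linarith) (by positivity)
      have h3 : 0 < ℓ * (2 * range N + ε) := by positivity
      push_cast
      nlinarith
    · rw [Real.exp_le_exp, neg_mul, neg_le_neg_iff, one_div_mul_eq_div, div_le_iff₀ (by positivity)]
      push_cast
      nlinarith

lemma eventually_exp_lt {c : ℝ} (hc : 0 < c) {r : ℝ} (hr : 0 < r) :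
    ∀ᶠ t : ℕ in atTop, Real.exp (-c * t) < r := by
  have h1 : Tendsto (fun t : ℕ => Real.exp (-c * t)) atTop (𝓝 0) := by
    refine Real.tendsto_exp_atBot.comp ?_
    exact (tendsto_natCast_atTop_atTop).const_mul_atTop_of_neg (by linarith)
  exact h1.eventually_lt_const hr

/-- `w` is the speed of the front of half-planes in the sense of one-site bounds: with exponentially
small errors, uniformly in the direction, after `t` steps the process started from a half-plane has
occupied a site behind the front `t * (w u - ε)` and has not reached a site beyond
`t * (w u + ε)`. By translation invariance it is enough to consider the origin. -/
def IsSiteSpeed (μ : Measure Ω) (ξ : Site → ℕ → Ω → Config N → Bool) (w : Plane → ℝ) : Prop :=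
  ∀ ε > 0, ∃ (c : ℝ) (t₀ : ℕ), 0 < c ∧ ∀ u : Plane, ‖u‖ = 1 → ∀ t ≥ t₀, ∀ b : ℝ,
    (0 ≤ b + t * (w u - ε) →
      μ.real {ω | (0 : Site) ∉ occupied (envOf ξ ω) (halfSites u b) t} ≤ Real.exp (-c * t)) ∧
    (b + t * (w u + ε) ≤ 0 →
      μ.real {ω | (0 : Site) ∈ occupied (envOf ξ ω) (halfSites u b) t} ≤ Real.exp (-c * t))

/-- The speed of half-planes exists and is bounded below uniformly in the direction. -/
theorem IsSureNoise.exists_speed (h : IsSureNoise T π μ ξ) (hT : T.LocallyRegular)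
    (hfill : ∃ A : Set Site, A.Finite ∧ T.FillsSpace A) (hπ : ∃ p, IsPerturbation p π T) :
    ∃ (w : Plane → ℝ) (a : ℝ), 0 < a ∧ (∀ u, ‖u‖ = 1 → a ≤ w u) ∧ IsSiteSpeed μ ξ w := by
  have key := fun n : ℕ => h.exists_approx_speed hT hfill hπ
    (show (0 : ℝ) < 1 / ((n : ℝ) + 1) by positivity)
  choose c t₀ hc key using key
  choose! v hv0 hv hbd using key
  set e : ℕ → ℝ := fun n => 1 / ((n : ℝ) + 1) with he
  -- two contradictory estimates at one level cannot hold at a large time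
  have hcontra : ∀ (A : Set Site) (t : ℕ) (x y : ℝ), x < 1 / 2 → y < 1 / 2 →
      μ.real {ω | (0 : Site) ∉ occupied (envOf ξ ω) A t} ≤ x →
      μ.real {ω | (0 : Site) ∈ occupied (envOf ξ ω) A t} ≤ y → False := by
    intro A t x y hx hy h1 h2
    rw [h.noise.real_notMem] at h1
    linarith
  have hcomp : ∀ u, ‖u‖ = 1 → ∀ n m, v n u - e n ≤ v m u + e m := by
    intro u hu n m
    by_contra! hlt
    obtain ⟨t, ⟨⟨ht1, ht2⟩, ht3⟩, ht4⟩ :=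
      (((eventually_exp_lt (hc n) one_half_pos).and (eventually_exp_lt (hc m) one_half_pos)).and
      (eventually_ge_atTop (t₀ n))).and (eventually_ge_atTop (t₀ m)) |>.exists
    refine hcontra _ t _ _ ht1 ht2
      ((hbd n u hu t ht3 (-(t * (v n u - e n)))).1 (by simp [he]))
      ((hbd m u hu t ht4 (-(t * (v n u - e n)))).2 ?_)
    have : (t : ℝ) * (v m u + e m) ≤ t * (v n u - e n) := by gcongr
    simp only [he] at this ⊢
    linarith
  have hbdd : ∀ u, ‖u‖ = 1 → BddAbove (Set.range fun n => v n u - e n) := by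
    intro u hu
    refine ⟨v 0 u + e 0, ?_⟩
    rintro _ ⟨n, rfl⟩
    exact hcomp u hu n 0
  let w : Plane → ℝ := fun u => ⨆ n, (v n u - e n)
  have hw1 : ∀ u, ‖u‖ = 1 → ∀ n, v n u - e n ≤ w u := fun u hu n => le_ciSup (hbdd u hu) n
  have hw2 : ∀ u, ‖u‖ = 1 → ∀ n, w u ≤ v n u + e n := fun u hu n =>
    ciSup_le fun m => hcomp u hu m n
  have hspeed : IsSiteSpeed μ ξ w := by
    intro ε hε
    obtain ⟨n, hn⟩ := exists_nat_one_div_lt (half_pos hε)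
    have hn' : e n < ε / 2 := hn
    refine ⟨c n, t₀ n, hc n, fun u hu t ht b => ⟨fun hb => ?_, fun hb => ?_⟩⟩
    · refine (hbd n u hu t ht b).1 ?_
      have h1 := hw2 u hu n
      have h2 : (t : ℝ) * (w u - ε) ≤ t * (v n u - e n) :=
        mul_le_mul_of_nonneg_left (by linarith) (by positivity)
      simp only [he] at h2 ⊢
      linarith
    · refine (hbd n u hu t ht b).2 ?_
      have h1 := hw1 u hu n
      have h2 : (t : ℝ) * (v n u + e n) ≤ t * (w u + ε) :=
        mul_le_mul_of_nonneg_left (by linarith) (by positivity)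
      simp only [he] at h2 ⊢
      linarith
  -- linear growth of a finite filling set gives a positive lower bound
  obtain ⟨R, τ, hτ, hlin⟩ := exists_linear_growth (μ := μ) hπ hfill
  have hτ' : (0 : ℝ) < τ := by exact_mod_cast hτ
  refine ⟨w, 1 / (8 * τ), by positivity, fun u hu => ?_, hspeed⟩
  by_contra! hlt
  obtain ⟨c', t', hc', hup⟩ := hspeed (1 / (8 * τ)) (by positivity)
  have hn3 : ∀ᶠ n : ℕ in atTop, Real.exp (-(c' * τ) * n) < 1 / 2 :=
    eventually_exp_lt (by positivity) one_half_pos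
  obtain ⟨n, ⟨⟨hn1, hn2⟩, hn3⟩, hn4⟩ :=
    (((eventually_exp_lt one_pos one_half_pos).and (eventually_ge_atTop t')).and hn3).and
    (eventually_ge_atTop (8 * R + 8)) |>.exists
  have hn4' : 8 * (R : ℝ) + 8 ≤ n := by exact_mod_cast hn4
  obtain ⟨z, hz1, hz2⟩ := exists_site_direction hu (-(n / 4 : ℝ) - 2 * R - 1)
  refine hcontra (halfSites u (-(n / 4 : ℝ))) (n * τ) _ _ hn1 hn3 ?_ ?_
  · refine (hlin ξ h (halfSites u (-(n / 4 : ℝ))) z 0 n (fun x hx => ?_) ?_).trans (by simp)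
    · rw [mem_halfSites, show x = (x - z) + z by abel, inner_toPlane_add]
      have h1 := (abs_le.1 (abs_inner_toPlane_le hu (x - z))).2
      have h2 := (abs_le.1 hz1).2
      linarith
    · rw [zero_sub, norm_neg]
      rw [abs_of_nonpos (by linarith [show (0 : ℝ) ≤ R by positivity])] at hz2
      linarith
  · have h1 := (hup u hu (n * τ) (hn2.trans (Nat.le_mul_of_pos_right n hτ)) (-(n / 4 : ℝ))).2 (by
      have h2 : ((n * τ : ℕ) : ℝ) * (w u + 1 / (8 * τ)) ≤
          (n * τ : ℕ) * (1 / (8 * τ) + 1 / (8 * τ)) := by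
        gcongr
      have h3 : ((n * τ : ℕ) : ℝ) * (1 / (8 * τ) + 1 / (8 * τ)) = n / 4 := by
        push_cast; field_simp; ring
      linarith)
    refine h1.trans (le_of_eq ?_)
    push_cast; congr 1; ring

/-! ### The half-space bounds -/

/-- The speed of half-planes is at most the speed of propagation. -/
lemma IsSiteSpeed.le_range {w : Plane → ℝ} (hw : IsSiteSpeed μ ξ w) (h : IsSureNoise T π μ ξ)
    {u : Plane} (hu : ‖u‖ = 1) : w u ≤ 2 * range N := by
  by_contra! hlt
  set ε := (w u - 2 * range N) / 2 with hε
  have hε0 : 0 < ε := by linarith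
  obtain ⟨c, t₀, hc, hb⟩ := hw ε hε0
  obtain ⟨t, ⟨ht1, ht2⟩, ht3⟩ := (((eventually_exp_lt hc one_pos).and
    (eventually_ge_atTop t₀)).and (eventually_ge_atTop 1)).exists
  have ht3' : (1 : ℝ) ≤ t := by exact_mod_cast ht3
  have h1 := (hb u hu t ht2 (-(t * (w u - ε)))).1 (by linarith)
  have h2 : {ω | (0 : Site) ∉ occupied (envOf ξ ω) (halfSites u (-(t * (w u - ε)))) t} =
      Set.univ := by
    ext ω
    simp only [Set.mem_ofPred_eq, Set.mem_univ, iff_true]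
    intro hc
    have := halfSites_speed (h.sure ω) hu hc
    rw [toPlane_zero, inner_zero_left] at this
    nlinarith
  rw [h2, probReal_univ] at h1
  linarith

/-- Sites up to distance `w u` from a half-plane see a sufficient configuration: otherwise the
deterministic upper bound on the front would be slower than `w u`. -/
lemma IsSiteSpeed.suff_localConfig {w : Plane → ℝ} (hw : IsSiteSpeed μ ξ w)
    (h : IsSureNoise T π μ ξ) {u : Plane} (hu : ‖u‖ = 1) {b : ℝ} {x : Site}
    (hx : inner ℝ (toPlane x) u ≤ b + w u) : T.suff (localConfig N (halfSites u b) x) := by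
  by_contra hns
  set d := inner ℝ (toPlane x) u - b with hd
  -- the configuration seen at a slightly smaller displacement `d'` is the same
  have hfin : ∀ᶠ d' in 𝓝[<] d, ∀ y ∈ N, -d < inner ℝ (toPlane y) u →
      -d' < inner ℝ (toPlane y) u := by
    rw [Filter.eventually_all_finset]
    intro y _
    by_cases hy : -d < inner ℝ (toPlane y) u
    · have : ∀ᶠ d' in 𝓝[<] d, -inner ℝ (toPlane y) u < d' :=
        mem_nhdsWithin_of_mem_nhds (Ioi_mem_nhds (by linarith))
      filter_upwards [this] with d' hd' _
      linarith
    · exact Filter.Eventually.of_forall fun _ h => absurd h hy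
  obtain ⟨d', hd'1, hd'2⟩ := (hfin.and self_mem_nhdsWithin).exists
  have hd'2 : d' < d := hd'2
  have hstep : ∀ b' : ℝ, ∀ x' : Site, b' + d' ≤ inner ℝ (toPlane x') u →
      ¬ T.suff (localConfig N (halfSites u b') x') := by
    intro b' x' hx' hs
    refine hns (T.mono _ _ (localConfig_mono fun y hy hyH => ?_) hs)
    rw [mem_halfSites, inner_toPlane_add] at hyH ⊢
    by_contra hc
    have := hd'1 y hy (by rw [hd]; linarith)
    linarith
  have hocc : ∀ (ω : Ω) (b' : ℝ) (t : ℕ),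
      occupied (envOf ξ ω) (halfSites u b') t ⊆ halfSites u (b' + t * d') := by
    intro ω b' t
    induction t with
    | zero => simp [occupied]
    | succ t ih =>
      intro y hy
      rw [mem_occupied_succ] at hy
      have hs := T.mono _ _ (localConfig_mono fun z _ hz => ih hz) ((h.sure ω y t).2.1 _ hy)
      by_contra hc
      rw [mem_halfSites, not_le] at hc
      push_cast at hc
      exact hstep _ y (by linarith) hs
  have hdw : d ≤ w u := by rw [hd]; linarith
  set ε := (w u - d') / 2 with hε
  obtain ⟨c, t₀, hc, hb⟩ := hw ε (by linarith)
  obtain ⟨t, ⟨ht1, ht2⟩, ht3⟩ := (((eventually_exp_lt hc one_pos).and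
    (eventually_ge_atTop t₀)).and (eventually_ge_atTop 1)).exists
  have ht3' : (1 : ℝ) ≤ t := by exact_mod_cast ht3
  have h1 := (hb u hu t ht2 (-(t * (w u - ε)))).1 (by linarith)
  have h2 : {ω | (0 : Site) ∉ occupied (envOf ξ ω) (halfSites u (-(t * (w u - ε)))) t} =
      Set.univ := by
    ext ω
    simp only [Set.mem_ofPred_eq, Set.mem_univ, iff_true]
    intro hc
    have := mem_halfSites.1 (hocc _ _ _ hc)
    rw [toPlane_zero, inner_zero_left] at this
    nlinarith
  rw [h2, probReal_univ] at h1
  linarith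

/-- Sites at distance more than `w u` from a half-plane may stay vacant: otherwise the front would
almost surely be faster than `w u`. -/
lemma IsSiteSpeed.prob_localConfig_lt_one {w : Plane → ℝ} (hw : IsSiteSpeed μ ξ w)
    (h : IsSureNoise T π μ ξ) {u : Plane} (hu : ‖u‖ = 1) {b : ℝ} {x : Site}
    (hx : b + w u < inner ℝ (toPlane x) u) : π.prob (localConfig N (halfSites u b) x) < 1 := by
  by_contra! hge
  have hone := le_antisymm (π.le_one _) hge
  set S := localConfig N (halfSites u b) x with hS
  set d := inner ℝ (toPlane x) u - b with hd
  have hae : ∀ᵐ ω ∂μ, ∀ (y : Site) (t : ℕ), ξ y t ω S = true := by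
    rw [ae_all_iff]; intro y
    rw [ae_all_iff]; intro t
    have hb := h.noise.bernoulli y t S
    rw [hone, measureReal_def, ← ENNReal.toReal_one,
      ENNReal.toReal_eq_toReal_iff' (measure_ne_top _ _) ENNReal.one_ne_top] at hb
    exact (mem_ae_iff_prob_eq_one (h.noise.measurableSet_eq y t S true)).2 hb
  have hocc : ∀ᵐ ω ∂μ, ∀ (b' : ℝ) (t : ℕ),
      halfSites u (b' + t * d) ⊆ occupied (envOf ξ ω) (halfSites u b') t := by
    filter_upwards [hae] with ω hω b' t
    induction t with
    | zero => simp [occupied]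
    | succ t ih =>
      intro y hy
      rw [mem_occupied_succ]
      refine eq_true_of_monotone ((h.sure ω).monotone y t) ?_ (hω y t)
      refine localConfig_mono fun z _ hz => ih ?_
      rw [mem_halfSites, inner_toPlane_add] at hz ⊢
      have := mem_halfSites.1 hy
      push_cast at this
      linarith
  set ε := (d - w u) / 2 with hε
  have hε0 : 0 < ε := by linarith
  obtain ⟨c, t₀, hc, hb⟩ := hw ε hε0
  obtain ⟨t, ⟨ht1, ht2⟩, ht3⟩ := (((eventually_exp_lt hc one_pos).and
    (eventually_ge_atTop t₀)).and (eventually_ge_atTop 1)).exists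
  have ht3' : (1 : ℝ) ≤ t := by exact_mod_cast ht3
  have h1 := (hb u hu t ht2 (-(t * (w u + ε)))).2 (by linarith)
  have h2 : μ.real {ω | (0 : Site) ∈ occupied (envOf ξ ω) (halfSites u (-(t * (w u + ε)))) t} =
      1 := by
    rw [← probReal_univ (μ := μ)]
    refine measureReal_congr (eventuallyEq_univ.2 ?_)
    filter_upwards [hocc] with ω hω
    refine hω _ t ?_
    rw [mem_halfSites, toPlane_zero, inner_zero_left]
    nlinarith
  linarith

/-- The positive probabilities of the two outcomes of the updates have a common lower bound. -/
lemma exists_prob_lower_bound (π : RandomRule N) :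
    ∃ q : ℝ, 0 < q ∧ q ≤ 1 ∧ ∀ S, (0 < π.prob S → q ≤ π.prob S) ∧
      (π.prob S < 1 → q ≤ 1 - π.prob S) := by
  have h1 : ∀ᶠ q : ℝ in 𝓝[>] 0, ∀ S, (0 < π.prob S → q ≤ π.prob S) ∧
      (π.prob S < 1 → q ≤ 1 - π.prob S) := by
    rw [Filter.eventually_all]
    intro S
    have hle : ∀ r : ℝ, ∀ᶠ q : ℝ in 𝓝[>] 0, 0 < r → q ≤ r := by
      intro r
      by_cases hr : 0 < r
      · filter_upwards [mem_nhdsWithin_of_mem_nhds (Iic_mem_nhds hr)] with q hq _ using hq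
      · exact Filter.Eventually.of_forall fun _ h => absurd h hr
    filter_upwards [hle (π.prob S), hle (1 - π.prob S)] with q h1 h2
    exact ⟨h1, fun h => h2 (by linarith)⟩
  obtain ⟨q, ⟨hq, hq1⟩, hq0⟩ := ((h1.and (mem_nhdsWithin_of_mem_nhds
    (Iic_mem_nhds (one_pos : (0 : ℝ) < 1)))).and self_mem_nhdsWithin).exists
  exact ⟨q, hq0, hq1, hq⟩

/-- With a positive probability that does not depend on the direction, the process from a half-plane
moves at each step exactly with the speed `w u`, inside a given window. -/
lemma IsSiteSpeed.exists_exact_front {w : Plane → ℝ} (hw : IsSiteSpeed μ ξ w)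
    (h : IsSureNoise T π μ ξ) (hπ : ∃ p, IsPerturbation p π T) (K t : ℕ) :
    ∃ q : ℝ, 0 < q ∧ ∀ u : Plane, ‖u‖ = 1 →
      q ≤ μ.real {ω | ∀ x : Site, ‖x‖ ≤ K →
        (x ∈ occupied (envOf ξ ω) (halfSites u 0) t ↔ x ∈ halfSites u (t * w u))} := by
  classical
  obtain ⟨p, hp⟩ := hπ
  obtain ⟨q, hq0, -, hq⟩ := exists_prob_lower_bound π
  set W : Finset (Site × ℕ) := box (K + range N * t) ×ˢ Finset.range t with hW
  refine ⟨q ^ W.card, by positivity, fun u hu => ?_⟩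
  refine (h.noise.pow_card_le_pattern W (fun i => localConfig N (halfSites u (i.2 * w u)) i.1)
    (fun i => decide (i.1 ∈ halfSites u ((i.2 + 1) * w u))) hq0.le ?_).trans
    (measureReal_mono fun ω hω => ?_)
  · rintro ⟨x, s⟩ -
    by_cases hx : x ∈ halfSites u ((s + 1) * w u)
    · simp only [hx, decide_true]
      rw [h.noise.bernoulli]
      refine (hq _).1 ((hp.1 _).1 (hw.suff_localConfig h hu ?_))
      have := mem_halfSites.1 hx
      linarith
    · simp only [hx, decide_false]
      have h1 : {ω | ξ x s ω (localConfig N (halfSites u (s * w u)) x) = false} =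
          {ω | ξ x s ω (localConfig N (halfSites u (s * w u)) x) = true}ᶜ := by
        ext ω; simp
      rw [h1, probReal_compl_eq_one_sub (h.noise.measurableSet_eq _ _ _ _), h.noise.bernoulli]
      refine (hq _).2 (hw.prob_localConfig_lt_one h hu ?_)
      rw [mem_halfSites, not_le] at hx
      linarith
  · have key : ∀ s ≤ t, ∀ x : Site, ‖x‖ ≤ K + range N * ((t : ℝ) - s) →
        (x ∈ occupied (envOf ξ ω) (halfSites u 0) s ↔ x ∈ halfSites u (s * w u)) := by
      intro s
      induction s with
      | zero => intro _ x _; simp [occupied]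
      | succ s ih =>
        intro hs x hx
        have hr : (0 : ℝ) ≤ range N := by positivity
        have hst : (s : ℝ) + 1 ≤ t := by exact_mod_cast hs
        push_cast at hx
        have hxW : (x, s) ∈ W := by
          rw [hW, Finset.mem_product, mem_box, Finset.mem_range]
          refine ⟨?_, hs⟩
          push_cast
          have : (range N : ℝ) * (t - (s + 1)) ≤ range N * t := by
            gcongr
            have : (0 : ℝ) ≤ s := by positivity
            linarith
          linarith
        have h1 : localConfig N (occupied (envOf ξ ω) (halfSites u 0) s) x =
            localConfig N (halfSites u (s * w u)) x := by
          refine localConfig_congr fun y hy => ih (by omega) _ ?_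
          have := norm_add_le x y
          have := norm_le_range hy
          linarith
        have h2 := hω _ hxW
        rw [mem_occupied_succ, h1]
        push_cast
        change ξ x s ω _ = true ↔ _
        rw [h2, decide_eq_true_eq]
    intro x hx
    exact key t le_rfl x (by simpa using hx)

/-- The exponential half-space bounds for all times and for all sites within distance `t ^ 2`. -/
theorem IsSiteSpeed.exists_halfSpace_bounds {w : Plane → ℝ} (hw : IsSiteSpeed μ ξ w)
    (h : IsSureNoise T π μ ξ) (hπ : ∃ p, IsPerturbation p π T) {ε : ℝ} (hε : 0 < ε) :
    ∃ c : ℝ, 0 < c ∧ ∀ u : Plane, ‖u‖ = 1 → ∀ t : ℕ,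
      1 - Real.exp (-c * t) ≤ μ.real {ω | ∀ x : Site, ‖toPlane x‖ ≤ (t : ℝ) ^ 2 →
        (x ∈ halfSites u (t * (w u - ε)) → x ∈ occupied (envOf ξ ω) (halfSites u 0) t) ∧
        (x ∈ occupied (envOf ξ ω) (halfSites u 0) t → x ∈ halfSites u (t * (w u + ε)))} := by
  set E : Plane → ℕ → Set Ω := fun u t => {ω | ∀ x : Site, ‖toPlane x‖ ≤ (t : ℝ) ^ 2 →
        (x ∈ halfSites u (t * (w u - ε)) → x ∈ occupied (envOf ξ ω) (halfSites u 0) t) ∧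
        (x ∈ occupied (envOf ξ ω) (halfSites u 0) t → x ∈ halfSites u (t * (w u + ε)))} with hE
  obtain ⟨c, t₀, hc, hb⟩ := hw ε hε
  -- large times: a union bound over the ball
  have hlarge : ∀ u : Plane, ‖u‖ = 1 → ∀ t ≥ t₀,
      1 - 2 * (2 * (t : ℝ) ^ 2 + 1) ^ 2 * Real.exp (-c * t) ≤ μ.real (E u t) := by
    intro u hu t ht
    have h1 : (E u t)ᶜ ⊆ ⋃ x ∈ box (t ^ 2),
        ({ω | x ∈ halfSites u (t * (w u - ε)) ∧ x ∉ occupied (envOf ξ ω) (halfSites u 0) t} ∪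
        {ω | x ∉ halfSites u (t * (w u + ε)) ∧ x ∈ occupied (envOf ξ ω) (halfSites u 0) t}) := by
      intro ω hω
      simp only [hE, Set.mem_compl_iff, Set.mem_ofPred_eq, not_forall] at hω
      obtain ⟨x, hx, hx'⟩ := hω
      simp only [Set.mem_iUnion]
      refine ⟨x, mem_box.2 ?_, ?_⟩
      · push_cast; exact (norm_le_norm_toPlane x).trans hx
      · simp only [Set.mem_union, Set.mem_ofPred_eq]
        tauto
    have h2 : μ.real (E u t)ᶜ ≤ ∑ x ∈ box (t ^ 2), 2 * Real.exp (-c * t) := by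
      refine (measureReal_mono h1 (measure_ne_top _ _)).trans
        ((measureReal_biUnion_finset_le _ _).trans (Finset.sum_le_sum fun x _ => ?_))
      refine (measureReal_union_le _ _).trans ?_
      rw [two_mul]
      refine add_le_add ?_ ?_
      · by_cases hx : x ∈ halfSites u (t * (w u - ε))
        · simp only [hx, true_and]
          rw [h.noise.real_notMem, h.noise.real_mem_halfSites h.noise, ← h.noise.real_notMem]
          refine (hb u hu t ht _).1 ?_
          have := mem_halfSites.1 hx
          linarith
        · simp only [hx, false_and, Set.ofPred_false, measureReal_empty]
          positivity
      · by_cases hx : x ∈ halfSites u (t * (w u + ε))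
        · simp only [hx, not_true_eq_false, false_and, Set.ofPred_false, measureReal_empty]
          positivity
        · simp only [hx, not_false_eq_true, true_and]
          rw [h.noise.real_mem_halfSites h.noise]
          refine (hb u hu t ht _).2 ?_
          rw [mem_halfSites, not_le] at hx
          linarith
    rw [Finset.sum_const, card_box, nsmul_eq_mul] at h2
    push_cast at h2
    have h3 : 1 ≤ μ.real (E u t) + μ.real (E u t)ᶜ := by
      rw [← probReal_univ (μ := μ), ← Set.union_compl_self (E u t)]
      exact measureReal_union_le _ _
    linarith
  have hpoly : Tendsto (fun t : ℕ => 2 * (2 * (t : ℝ) ^ 2 + 1) ^ 2 * Real.exp (-(c / 2) * t))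
      atTop (𝓝 0) := by
    have hp := fun k : ℕ =>
      (Real.summable_pow_mul_exp_neg_nat_mul k (half_pos hc)).tendsto_atTop_zero
    have := (((hp 4).const_mul 8).add ((hp 2).const_mul 8)).add ((hp 0).const_mul 2)
    simp only [mul_zero, add_zero] at this
    refine this.congr fun t => ?_
    ring
  obtain ⟨t₁, ht₁⟩ := eventually_atTop.1 ((hpoly.eventually_le_const one_pos).and
    ((eventually_ge_atTop t₀).and (eventually_ge_atTop 1)))
  have ht₁0 : 1 ≤ t₁ := (ht₁ t₁ le_rfl).2.2
  have ht₁0' : (1 : ℝ) ≤ t₁ := by exact_mod_cast ht₁0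
  -- small times: the front moves exactly with positive probability
  choose q hq0 hq using fun t : ℕ => hw.exists_exact_front h hπ (t ^ 2) t
  obtain ⟨r, hr0, hr⟩ : ∃ r : ℝ, 0 < r ∧ ∀ t < t₁, r ≤ q t := by
    have : ∀ᶠ r : ℝ in 𝓝[>] 0, ∀ t ∈ Finset.range t₁, r ≤ q t := by
      rw [Filter.eventually_all_finset]
      exact fun t _ => mem_nhdsWithin_of_mem_nhds (Iic_mem_nhds (hq0 t))
    obtain ⟨r, hr, hr0⟩ := (this.and self_mem_nhdsWithin).exists
    exact ⟨r, hr0, fun t ht => hr t (Finset.mem_range.2 ht)⟩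
  refine ⟨min (c / 2) (r / t₁), by positivity, fun u hu t => ?_⟩
  change _ ≤ μ.real (E u t)
  rcases lt_or_ge t t₁ with ht | ht
  · have ht' : (t : ℝ) ≤ t₁ := by exact_mod_cast ht.le
    have h1 : 1 - Real.exp (-min (c / 2) (r / t₁) * t) ≤ r := by
      have h2 := Real.add_one_le_exp (-min (c / 2) (r / t₁) * t)
      have h3 : min (c / 2) (r / t₁) * t ≤ r / t₁ * t₁ := by
        gcongr
        exact min_le_right _ _
      rw [div_mul_cancel₀ _ (by positivity)] at h3
      linarith
    refine h1.trans ((hr t ht).trans ((hq t u hu).trans (measureReal_mono fun ω hω x hx => ?_)))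
    have hx' := hω x (by push_cast; exact (norm_le_norm_toPlane x).trans hx)
    have ht0 : (0 : ℝ) ≤ t * ε := by positivity
    exact ⟨fun hm => hx'.2 (halfSites_mono (by linarith) hm),
      fun hm => halfSites_mono (by linarith) (hx'.1 hm)⟩
  · obtain ⟨h1, h2, -⟩ := ht₁ t ht
    refine le_trans ?_ (hlarge u hu t h2)
    have h3 : 2 * (2 * (t : ℝ) ^ 2 + 1) ^ 2 * Real.exp (-c * t) ≤ Real.exp (-(c / 2) * t) := by
      calc _ = (2 * (2 * (t : ℝ) ^ 2 + 1) ^ 2 * Real.exp (-(c / 2) * t)) *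
            Real.exp (-(c / 2) * t) := by
            rw [mul_assoc _ (Real.exp _) (Real.exp _), ← Real.exp_add]; congr 2; ring
        _ ≤ 1 * Real.exp (-(c / 2) * t) := by gcongr
        _ = _ := one_mul _
    have h4 : Real.exp (-(c / 2) * t) ≤ Real.exp (-min (c / 2) (r / t₁) * t) := by
      rw [Real.exp_le_exp]
      have : min (c / 2) (r / t₁) * t ≤ c / 2 * t := by
        gcongr
        exact min_le_left _ _
      linarith
    linarith

/-! ### The shape theorem -/

/-- The Borel–Cantelli lemma for a summable bound that holds from some index on. -/
lemma ae_eventually_notMem_of_le {f : ℕ → ℝ} (hf : Summable f) {s : ℕ → Set Ω} (n₀ : ℕ)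
    (hs : ∀ n ≥ n₀, μ.real (s n) ≤ f n) : ∀ᵐ ω ∂μ, ∀ᶠ n in atTop, ω ∉ s n := by
  have hf' : Summable fun n => f (n + n₀) := (summable_nat_add_iff n₀).2 hf
  have h1 : ∑' n, μ (s (n + n₀)) ≠ ⊤ := by
    refine ne_top_of_le_ne_top hf'.tsum_ofReal_ne_top (ENNReal.tsum_le_tsum fun n => ?_)
    rw [← ofReal_measureReal (measure_ne_top _ _)]
    exact ENNReal.ofReal_le_ofReal (hs _ (by omega))
  filter_upwards [ae_eventually_notMem h1] with ω hω
  obtain ⟨m, hm⟩ := eventually_atTop.1 hω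
  refine eventually_atTop.2 ⟨m + n₀, fun n hn => ?_⟩
  have := hm (n - n₀) (by omega)
  rwa [Nat.sub_add_cancel (by omega)] at this

/-- Exponential decay wins over the number of sites in a box of linear size. -/
lemma summable_box_mul_exp (C : ℝ) {c : ℝ} (hc : 0 < c) :
    Summable fun n : ℕ => (C * (n : ℝ) + C) ^ 2 * Real.exp (-c * n) := by
  have hp := fun k : ℕ => Real.summable_pow_mul_exp_neg_nat_mul k hc
  have := (((hp 2).mul_left (C ^ 2)).add ((hp 1).mul_left (2 * C ^ 2))).add ((hp 0).mul_left (C ^ 2))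
  refine this.congr fun n => ?_
  ring

/-- The points `x` with `⟨x, u⟩ ≤ w u` for all unit vectors `u`: the polar of the region of
inverse speeds. -/
def wulffShape (w : Plane → ℝ) : Set Plane := {x | ∀ u : Plane, ‖u‖ = 1 → inner ℝ x u ≤ w u}

lemma norm_le_of_forall_inner_le {x : Plane} {M : ℝ} (hM : 0 ≤ M)
    (h : ∀ u : Plane, ‖u‖ = 1 → inner ℝ x u ≤ M) : ‖x‖ ≤ M := by
  rcases eq_or_ne x 0 with rfl | hx
  · simpa using hM
  · have hx' : ‖x‖ ≠ 0 := norm_ne_zero_iff.2 hx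
    have h1 := h (‖x‖⁻¹ • x) (by rw [norm_smul, norm_inv, norm_norm, inv_mul_cancel₀ hx'])
    rw [inner_smul_right, real_inner_self_eq_norm_sq, sq, inv_mul_cancel_left₀ hx'] at h1
    exact h1

/-- Upper bound of the shape theorem in one direction. -/
lemma IsSiteSpeed.ae_eventually_inner_le {w : Plane → ℝ} (hw : IsSiteSpeed μ ξ w)
    (h : IsSureNoise T π μ ξ) {A₀ : Set Site} (hA₀ : A₀.Finite) {u : Plane} (hu : ‖u‖ = 1) {δ : ℝ}
    (hδ : 0 < δ) : ∀ᵐ ω ∂μ, ∀ᶠ t : ℕ in atTop, ∀ x ∈ occupied (envOf ξ ω) A₀ t,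
      inner ℝ (toPlane x) u ≤ t * (w u + δ) := by
  obtain ⟨b, hb⟩ : ∃ b : ℕ, ∀ y ∈ A₀, ‖y‖ ≤ b := by
    obtain ⟨b, hb⟩ := (hA₀.image norm).bddAbove
    obtain ⟨m, hm⟩ := exists_nat_ge b
    exact ⟨m, fun y hy => (hb ⟨y, hy, rfl⟩).trans hm⟩
  obtain ⟨c, t₀, hc, hup⟩ := hw (δ / 2) (half_pos hδ)
  obtain ⟨t₁, ht₁⟩ := exists_nat_ge (2 * b / (δ / 2))
  set C : ℕ := 2 * (b + range N) + 1 with hC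
  have hbad := ae_eventually_notMem_of_le (μ := μ) (summable_box_mul_exp C hc)
    (s := fun t : ℕ => {ω | ∃ x ∈ box (b + range N * t), x ∈ occupied (envOf ξ ω) A₀ t ∧
      t * (w u + δ) < inner ℝ (toPlane x) u}) (max t₀ t₁) (fun t ht => ?_)
  · filter_upwards [hbad] with ω hω
    filter_upwards [hω] with t ht x hx
    by_contra! hlt
    refine ht ⟨x, ?_, hx, hlt⟩
    obtain ⟨y, hy, hxy⟩ := exists_near_of_mem_occupied (h.sure ω) hx
    rw [mem_box]
    have h1 : ‖x‖ ≤ ‖y‖ + ‖x - y‖ := norm_le_norm_add_norm_sub' x y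
    have h2 := hb y hy
    push_cast
    linarith
  · have htb : 2 * (b : ℝ) ≤ t * (δ / 2) := by
      rw [div_le_iff₀ (half_pos hδ)] at ht₁
      refine ht₁.trans ?_
      have : (t₁ : ℝ) ≤ t := by exact_mod_cast (le_max_right _ _).trans ht
      gcongr
    have hsub : {ω | ∃ x ∈ box (b + range N * t), x ∈ occupied (envOf ξ ω) A₀ t ∧
        t * (w u + δ) < inner ℝ (toPlane x) u} ⊆ ⋃ x ∈ box (b + range N * t),
        {ω | x ∈ occupied (envOf ξ ω) (halfSites u (2 * b)) t ∧
          t * (w u + δ) < inner ℝ (toPlane x) u} := by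
      rintro ω ⟨x, hx, hxo, hxl⟩
      simp only [Set.mem_iUnion]
      refine ⟨x, hx, occupied_subset (h.sure ω).monotone (fun y hy => ?_) t hxo, hxl⟩
      have h1 := (abs_le.1 (abs_inner_toPlane_le hu y)).2
      have := hb y hy
      rw [mem_halfSites]
      linarith
    refine (measureReal_mono hsub (measure_ne_top _ _)).trans
      ((measureReal_biUnion_finset_le _ _).trans
      ((Finset.sum_le_sum (g := fun _ => Real.exp (-c * t)) fun x _ => ?_).trans ?_))
    · by_cases hx : t * (w u + δ) < inner ℝ (toPlane x) u
      · simp only [hx, and_true]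
        rw [h.noise.real_mem_halfSites h.noise]
        refine (hup u hu t ((le_max_left _ _).trans ht) _).2 ?_
        linarith
      · simp only [hx, and_false, Set.ofPred_false, measureReal_empty]
        positivity
    · rw [Finset.sum_const, card_box, nsmul_eq_mul]
      gcongr
      rw [hC]
      push_cast
      have h1 : (0 : ℝ) ≤ b * t := by positivity
      have h2 : (0 : ℝ) ≤ range N := by positivity
      have h3 : (0 : ℝ) ≤ t := by positivity
      rw [← sub_nonneg]
      ring_nf
      positivity

/-- Upper bound of the shape theorem: by compactness, finitely many directions suffice. -/
theorem IsSiteSpeed.ae_eventually_subset_thickening {w : Plane → ℝ} (hw : IsSiteSpeed μ ξ w)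
    (h : IsSureNoise T π μ ξ) {A₀ : Set Site} (hA₀ : A₀.Finite) {ε : ℝ} (hε : 0 < ε) :
    ∀ᵐ ω ∂μ, ∀ᶠ t : ℕ in atTop, ∀ x ∈ occupied (envOf ξ ω) A₀ t,
      (t : ℝ)⁻¹ • toPlane x ∈ Metric.thickening ε (wulffShape w) := by
  obtain ⟨b, hb⟩ := (hA₀.image norm).bddAbove
  set M : ℝ := 2 * (range N + 1) with hM
  have hcpt : IsCompact (Metric.closedBall (0 : Plane) M \ Metric.thickening ε (wulffShape w)) :=
    (isCompact_closedBall _ _).diff Metric.isOpen_thickening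
  obtain ⟨F, hF⟩ := hcpt.elim_finite_subcover
    (fun i : Metric.sphere (0 : Plane) 1 × {δ : ℝ // 0 < δ} =>
      {x : Plane | w i.1 + i.2 < inner ℝ x (i.1 : Plane)})
    (fun i => isOpen_lt continuous_const (by fun_prop)) (fun x hx => by
      have hx2 : x ∉ wulffShape w := fun hc => hx.2 (Metric.self_subset_thickening hε _ hc)
      simp only [wulffShape, Set.mem_ofPred_eq, not_forall, not_le] at hx2
      obtain ⟨u, hu, hlt⟩ := hx2
      refine Set.mem_iUnion.2 ⟨⟨⟨u, by simpa using hu⟩,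
        ⟨(inner ℝ x u - w u) / 2, by linarith⟩⟩, ?_⟩
      simp only [Set.mem_ofPred_eq]
      linarith)
  have hall : ∀ᵐ ω ∂μ, ∀ i ∈ F, ∀ᶠ t : ℕ in atTop, ∀ x ∈ occupied (envOf ξ ω) A₀ t,
      inner ℝ (toPlane x) (i.1 : Plane) ≤ t * (w i.1 + i.2) := by
    rw [Filter.eventually_all_finset]
    exact fun i _ => hw.ae_eventually_inner_le h hA₀ (by simp) i.2.2
  filter_upwards [hall] with ω hω
  obtain ⟨t₁, ht₁⟩ := exists_nat_ge b
  filter_upwards [(Filter.eventually_all_finset F).2 hω, eventually_ge_atTop t₁,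
    eventually_ge_atTop 1] with t ht ht₁' ht1 x hx
  have ht1' : (1 : ℝ) ≤ t := by exact_mod_cast ht1
  have ht0 : (0 : ℝ) < t := by linarith
  by_contra hnot
  have hball : (t : ℝ)⁻¹ • toPlane x ∈ Metric.closedBall (0 : Plane) M := by
    rw [mem_closedBall_zero_iff, norm_smul, norm_inv, Real.norm_natCast, inv_mul_le_iff₀ ht0]
    obtain ⟨y, hy, hxy⟩ := exists_near_of_mem_occupied (h.sure ω) hx
    have h1 : ‖x‖ ≤ ‖y‖ + ‖x - y‖ := norm_le_norm_add_norm_sub' x y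
    have h2 : ‖y‖ ≤ b := hb ⟨y, hy, rfl⟩
    have h3 := norm_toPlane_le x
    have h4 : (t₁ : ℝ) ≤ t := by exact_mod_cast ht₁'
    rw [hM]
    linarith
  obtain ⟨i, hi⟩ := Set.mem_iUnion.1 (hF ⟨hball, hnot⟩)
  obtain ⟨hiF, hi⟩ := Set.mem_iUnion.1 hi
  simp only [Set.mem_ofPred_eq, inner_smul_left, map_inv₀, conj_trivial] at hi
  rw [lt_inv_mul_iff₀ ht0] at hi
  exact absurd (ht i hiF x hx) (not_le.2 hi)

/-- The discrete version of `R • wulffShape w`, slightly shrunk and with a boundary of curvature at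
most `1 / (R * r)`: the sites in a union of balls of radius `R * r`. -/
def roundedShape (w : Plane → ℝ) (r R : ℝ) : Set Site :=
  {y | ∃ c : Plane, (∀ u : Plane, ‖u‖ = 1 → inner ℝ c u + r ≤ w u) ∧ ‖toPlane y - R • c‖ ≤ R * r}

/-- A ball contains the part of a slightly smaller half-plane that is close to the point of
tangency. -/
lemma norm_le_of_inner_le {e n : Plane} (hn : ‖n‖ = 1) {l E k ρ : ℝ} (hl : 0 ≤ l) (he : ‖e‖ ≤ E)
    (hk : 0 ≤ k) (h : inner ℝ (e + l • n) n ≤ ρ - k) (h1 : E + k ≤ ρ) (h2 : E ^ 2 ≤ k * ρ) :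
    ‖e + l • n‖ ≤ ρ := by
  have hE : 0 ≤ E := (norm_nonneg e).trans he
  have h3 : inner ℝ (e + l • n) n = inner ℝ e n + l := by
    rw [inner_add_left, inner_smul_left, real_inner_self_eq_norm_sq, hn]; simp
  have h4 : |inner ℝ e n| ≤ E := by
    have := abs_real_inner_le_norm e n
    rw [hn, mul_one] at this
    exact this.trans he
  have h5 := (abs_le.1 h4).1
  rw [h3] at h
  have h6 : ‖e + l • n‖ ^ 2 = ‖e‖ ^ 2 + 2 * (l * inner ℝ e n) + l ^ 2 := by
    rw [norm_add_sq_real, inner_smul_right, norm_smul, hn, mul_one, Real.norm_eq_abs, sq_abs]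
  have h7 : ‖e‖ ^ 2 ≤ E ^ 2 := by gcongr
  have h8 : (inner ℝ e n + l) ^ 2 ≤ (ρ - k) ^ 2 := by
    apply sq_le_sq'
    · linarith
    · exact h
  refine abs_le_of_sq_le_sq' ?_ (by linarith) |>.2
  rw [h6]
  have h9 : k * k ≤ k * ρ := by gcongr; linarith
  nlinarith [sq_nonneg (inner ℝ e n)]

lemma norm_toPlane_le_of_mem_roundedShape {w : Plane → ℝ} (hw : IsSiteSpeed μ ξ w)
    (h : IsSureNoise T π μ ξ) {r R : ℝ} (hr : 0 ≤ r) (hR : 0 ≤ R) {y : Site}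
    (hy : y ∈ roundedShape w r R) : ‖toPlane y‖ ≤ R * (2 * range N + r) := by
  obtain ⟨c, hc, hy⟩ := hy
  have h1 : ‖c‖ ≤ 2 * range N := norm_le_of_forall_inner_le (by positivity) fun u hu => by
    have := hc u hu
    have := hw.le_range h hu
    linarith
  have h2 : ‖toPlane y‖ ≤ ‖toPlane y - R • c‖ + ‖R • c‖ := norm_le_norm_sub_add _ _
  rw [norm_smul, Real.norm_of_nonneg hR] at h2
  have h3 := mul_le_mul_of_nonneg_left h1 hR
  linarith

/-- The rounded shape grows linearly: seen from one of its boundary points it is, up to a small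
error, a half-plane. -/
theorem IsSiteSpeed.exists_roundedShape_growth {w : Plane → ℝ} (hw : IsSiteSpeed μ ξ w)
    (h : IsSureNoise T π μ ξ) {a : ℝ} (ha : 0 < a) (haw : ∀ u : Plane, ‖u‖ = 1 → a ≤ w u) {r ε : ℝ}
    (hr : 0 < r) (hε : 0 < ε) (hε1 : ε < 1) :
    ∃ (c δ : ℝ) (t₀ : ℕ), 0 < c ∧ 0 < δ ∧ ∀ ξ' : Site → ℕ → Ω → Config N → Bool,
      IsSureNoise T π μ ξ' → ∀ s ≥ t₀, ∀ R : ℝ, s ≤ δ * R →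
      ∀ y ∈ roundedShape w r (R + (1 - ε) * s),
        μ.real {ω | y ∉ occupied (envOf ξ' ω) (roundedShape w r R) s} ≤ Real.exp (-c * s) := by
  set ε₁ := ε * a / 2 with hε₁
  have hε₁0 : 0 < ε₁ := by positivity
  obtain ⟨c, t₀, hc, hb⟩ := hw ε₁ hε₁0
  have hr1 : (1 : ℝ) ≤ range N := one_le_range
  set E : ℝ := 4 * range N with hE
  have hE0 : 0 < E := by positivity
  refine ⟨c, min (r / (E + ε₁)) (ε₁ * r / E ^ 2), t₀, hc, by positivity,
    fun ξ' h' s hs R hsR y hy => ?_⟩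
  obtain ⟨z, hz, hyz⟩ := hy
  have hs0 : (0 : ℝ) ≤ s := by positivity
  have hδ0 : 0 < min (r / (E + ε₁)) (ε₁ * r / E ^ 2) := by positivity
  have hR0 : 0 ≤ R := by
    by_contra! hneg
    have := mul_neg_of_pos_of_neg hδ0 hneg
    linarith
  have hs1 : (E + ε₁) * s ≤ R * r := by
    have : (s : ℝ) ≤ r / (E + ε₁) * R := hsR.trans (by gcongr; exact min_le_left _ _)
    rw [div_mul_eq_mul_div, le_div_iff₀ (by positivity)] at this
    linarith
  have hs2 : E ^ 2 * s ≤ ε₁ * (R * r) := by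
    have : (s : ℝ) ≤ ε₁ * r / E ^ 2 * R := hsR.trans (by gcongr; exact min_le_right _ _)
    rw [div_mul_eq_mul_div, le_div_iff₀ (by positivity)] at this
    linarith
  have hznorm : ‖z‖ ≤ 2 * range N := norm_le_of_forall_inner_le (by positivity) fun u hu => by
    have := hz u hu
    have := hw.le_range h hu
    linarith
  set R' := R + (1 - ε) * s with hR'
  -- the outer normal `n` of the ball at `y`
  obtain ⟨n, hn, hyn⟩ : ∃ n : Plane, ‖n‖ = 1 ∧
      toPlane y - R' • z = ‖toPlane y - R' • z‖ • n := by
    rcases eq_or_ne (toPlane y - R' • z) 0 with h0 | h0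
    · obtain ⟨n, hn⟩ := exists_norm_eq Plane (zero_le_one (α := ℝ))
      exact ⟨n, hn, by rw [h0]; simp⟩
    · have h0' := norm_ne_zero_iff.2 h0
      exact ⟨‖toPlane y - R' • z‖⁻¹ • (toPlane y - R' • z),
        by rw [norm_smul, norm_inv, norm_norm, inv_mul_cancel₀ h0'],
        by rw [smul_smul, mul_inv_cancel₀ h0', one_smul]⟩
  set l := ‖toPlane y - R' • z‖ with hl
  have hl0 : 0 ≤ l := norm_nonneg _
  set b := R * inner ℝ z n + (R * r - ε₁ * s) with hbdef
  have hsub : {ω | y ∉ occupied (envOf ξ' ω) (roundedShape w r R) s} ⊆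
      {ω | y ∉ occupied (envOf ξ' ω) (halfSites n b) s} := by
    intro ω hω hcon
    refine hω (mem_occupied_of_local (h'.sure ω) hcon fun x hx hxH => ⟨z, hz, ?_⟩)
    have hdec : toPlane x - R • z = (toPlane (x - y) + ((1 - ε) * s) • z) + l • n := by
      rw [← hyn, toPlane_sub, hR', add_smul]; abel
    rw [hdec]
    refine norm_le_of_inner_le (E := E * s) (k := ε₁ * s) hn hl0 ?_ (by positivity) ?_
      (by linarith) ?_
    · have h1 := norm_toPlane_le (x - y)
      have h2 : ‖((1 - ε) * s) • z‖ ≤ s * (2 * range N) := by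
        rw [norm_smul, Real.norm_of_nonneg (mul_nonneg (by linarith) hs0)]
        gcongr
        nlinarith
      have := norm_add_le (toPlane (x - y)) (((1 - ε) * (s : ℝ)) • z)
      rw [hE]
      linarith
    · rw [← hdec, inner_sub_left, inner_smul_left]
      have := mem_halfSites.1 hxH
      simp only [conj_trivial]
      linarith
    · calc (E * s) ^ 2 = E ^ 2 * s * s := by ring
        _ ≤ ε₁ * (R * r) * s := by gcongr
        _ = _ := by ring
  refine (measureReal_mono hsub).trans ?_
  rw [h'.noise.real_notMem, h'.noise.real_mem_halfSites h.noise, ← h.noise.real_notMem]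
  refine (hb n hn s hs _).1 ?_
  have hyn' : inner ℝ (toPlane y) n = R' * inner ℝ z n + l := by
    have h1 : toPlane y = R' • z + l • n := by rw [← hyn]; abel
    rw [h1, inner_add_left, inner_smul_left, inner_smul_left, real_inner_self_eq_norm_sq, hn]
    simp
  have h2 := hz n hn
  have h3 := haw n hn
  have h4 : (1 - ε) * s * (inner ℝ z n + r) ≤ (1 - ε) * s * w n :=
    mul_le_mul_of_nonneg_left h2 (mul_nonneg (by linarith) hs0)
  have h5 : ε * s * a ≤ ε * s * w n := mul_le_mul_of_nonneg_left h3 (by positivity)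
  rw [hyn', hbdef]
  have h6 : l ≤ R' * r := hyz
  rw [hR'] at h6 ⊢
  rw [hε₁]
  linarith [show R * inner ℝ z n + (R * r - ε * a / 2 * s) - ((R + (1 - ε) * s) * inner ℝ z n + l) +
    s * (w n - ε * a / 2) = ((R + (1 - ε) * s) * r - l) +
      ((1 - ε) * s * w n - (1 - ε) * s * (inner ℝ z n + r)) + (ε * s * w n - ε * s * a) by ring]

/-- From a finite set that fills space the process fills large boxes in linear time. -/
theorem IsSureNoise.exists_initial_growth (h : IsSureNoise T π μ ξ)
    (hπ : ∃ p, IsPerturbation p π T) {A₀ : Set Site} (hA₀ : A₀.Finite) (hfill : T.FillsSpace A₀) :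
    ∃ σ : ℕ, ∀ᵐ ω ∂μ, ∀ᶠ n : ℕ in atTop, ∀ y : Site, 2 * ‖y‖ ≤ n →
      y ∈ occupied (envOf ξ ω) A₀ (n * σ) := by
  obtain ⟨R, τ, hτ, hlin⟩ := exists_linear_growth (μ := μ) hπ ⟨A₀, hA₀, hfill⟩
  obtain ⟨C, hC⟩ : ∃ C : ℕ, ∀ y ∈ A₀, ‖y‖ ≤ C := by
    obtain ⟨b, hb⟩ := (hA₀.image norm).bddAbove
    obtain ⟨m, hm⟩ := exists_nat_ge b
    exact ⟨m, fun y hy => (hb ⟨y, hy, rfl⟩).trans hm⟩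
  obtain ⟨t₁, q, -, hq0, hq1, htry⟩ := exists_tries (μ := μ) hπ C R
  refine ⟨t₁ + τ, ?_⟩
  have h1 := ae_eventually_notMem_of_le (μ := μ) (summable_geometric_of_lt_one hq0 hq1)
    (s := fun n => {ω | ¬ ∀ y : Site, ‖y - 0‖ ≤ R → y ∈ occupied (envOf ξ ω) A₀ (n * t₁)}) 0
    (fun n _ => htry ξ h A₀ 0 ⟨A₀, subset_rfl, by simpa using hC, hfill⟩ n)
  have h2 := ae_eventually_notMem_of_le (μ := μ) (summable_box_mul_exp 2 one_pos)
    (s := fun n => {ω | ∃ y ∈ box n, 2 * ‖y‖ ≤ n ∧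
      y ∉ occupied (envOf (shiftNoise 0 (n * t₁) ξ) ω) {y | ‖y‖ ≤ R} (n * τ)}) 0 (fun n _ => ?_)
  · filter_upwards [h1, h2] with ω hω1 hω2
    filter_upwards [hω1, hω2] with n hn1 hn2 y hy
    simp only [not_not, sub_zero, not_exists, not_and] at hn1 hn2
    have hy0 : ‖y‖ ≤ n := by linarith [norm_nonneg y]
    rw [mul_add, occupied_add]
    exact occupied_subset ((h.sure ω).shift _ _).monotone (fun x hx => hn1 x hx) _
      (hn2 y (mem_box.2 hy0) hy)
  · have hsub : {ω | ∃ y ∈ box n, 2 * ‖y‖ ≤ n ∧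
        y ∉ occupied (envOf (shiftNoise 0 (n * t₁) ξ) ω) {y | ‖y‖ ≤ R} (n * τ)} ⊆
        ⋃ y ∈ box n, {ω | 2 * ‖y‖ ≤ n ∧
          y ∉ occupied (envOf (shiftNoise 0 (n * t₁) ξ) ω) {y | ‖y‖ ≤ R} (n * τ)} := by
      rintro ω ⟨y, hy, hy'⟩
      exact Set.mem_biUnion (Finset.mem_coe.2 hy) hy'
    refine (measureReal_mono hsub (measure_ne_top _ _)).trans
      ((measureReal_biUnion_finset_le _ _).trans
      ((Finset.sum_le_sum (g := fun _ => Real.exp (-1 * n)) fun y _ => ?_).trans ?_))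
    · by_cases hy : 2 * ‖y‖ ≤ n
      · simp only [hy, true_and]
        rw [neg_one_mul]
        exact hlin _ (h.shift 0 (n * t₁)) _ 0 y n (fun x hx => by simpa using hx) (by simpa using hy)
      · simp only [hy, false_and, Set.ofPred_false, measureReal_empty]
        positivity
    · rw [Finset.sum_const, card_box, nsmul_eq_mul]
      push_cast
      gcongr
      norm_num

/-- The process from a finite filling set contains, at the times `s * q`, rounded shapes of radius
almost `s * q`. -/
theorem IsSiteSpeed.exists_roundedShape_subset {w : Plane → ℝ} (hw : IsSiteSpeed μ ξ w)
    (h : IsSureNoise T π μ ξ) (hπ : ∃ p, IsPerturbation p π T) {a : ℝ} (ha : 0 < a)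
    (haw : ∀ u : Plane, ‖u‖ = 1 → a ≤ w u) {A₀ : Set Site} (hA₀ : A₀.Finite)
    (hfill : T.FillsSpace A₀) {r ε : ℝ} (hr : 0 < r) (hε : 0 < ε) (hε1 : ε < 1) :
    ∃ (q : ℕ) (ρ : ℝ), 0 < q ∧ 0 < ρ ∧ (1 - ε) * q ≤ (1 + ε) * ρ ∧
      ∀ᵐ ω ∂μ, ∀ᶠ s : ℕ in atTop,
        roundedShape w r (ρ * s) ⊆ occupied (envOf ξ ω) A₀ (s * q) := by
  obtain ⟨c, δ, t₀, hc, hδ, hstep⟩ := hw.exists_roundedShape_growth h ha haw hr hε hε1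
  obtain ⟨σ, hσ⟩ := h.exists_initial_growth hπ hA₀ hfill
  have hr1 : (1 : ℝ) ≤ range N := one_le_range
  set B : ℝ := 2 * range N + r with hB
  have hB0 : 0 < B := by positivity
  -- the initial radius `m / (2 * B)` is large compared to the time `1` of one growth step
  obtain ⟨m, hm⟩ := exists_nat_ge (2 * B / δ)
  have hm0 : (0 : ℝ) < m := lt_of_lt_of_le (by positivity) hm
  have hm0' : 0 < m := by exact_mod_cast hm0
  -- the number `J` of growth steps is large compared to the initial time `m * σ`
  obtain ⟨J, hJ⟩ := exists_nat_ge (m * σ / ε + 1)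
  have hJ0 : (1 : ℝ) ≤ J := le_trans (by linarith [show 0 ≤ m * σ / ε by positivity]) hJ
  have hJε : m * σ ≤ ε * J := by
    have : m * σ / ε ≤ J := by linarith
    rwa [div_le_iff₀' hε] at this
  set ρ : ℕ → ℝ := fun j => m / (2 * B) + (1 - ε) * j with hρ
  have hρ0 : ∀ j, m / (2 * B) ≤ ρ j := fun j => by
    have : 0 ≤ (1 - ε) * j := mul_nonneg (by linarith) (by positivity)
    simp only [hρ]; linarith
  have hmB : 0 < m / (2 * B) := by positivity
  have hρpos : ∀ j, 0 < ρ j := fun j => hmB.trans_le (hρ0 j)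
  have hρmono : ∀ {i j : ℕ}, i ≤ j → ρ i ≤ ρ j := fun {i j} hij => by
    have : (i : ℝ) ≤ j := by exact_mod_cast hij
    have := mul_le_mul_of_nonneg_left this (show 0 ≤ 1 - ε by linarith)
    simp only [hρ]; linarith
  refine ⟨m * σ + J, ρ J, ?_, hρpos J, ?_, ?_⟩
  · have : 0 < J := by exact_mod_cast (zero_lt_one.trans_le hJ0)
    omega
  · push_cast
    have h1 : (1 - ε) * (m * σ) ≤ (1 - ε) * (ε * J) :=
      mul_le_mul_of_nonneg_left hJε (by linarith)
    have h2 : (1 + ε) * ((1 - ε) * J) ≤ (1 + ε) * ρ J := by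
      gcongr
      simp only [hρ]
      linarith
    linarith
  obtain ⟨K, hK⟩ := exists_nat_ge (ρ J * B)
  set bad : ℕ → Set Ω := fun s => {ω | ∃ j ∈ Finset.range J, ∃ y ∈ box (K * s),
    y ∈ roundedShape w r (ρ (j + 1) * s) ∧ y ∉ occupied
      (envOf (shiftNoise 0 (s * (m * σ + j)) ξ) ω) (roundedShape w r (ρ j * s)) s} with hbad
  have hbad0 := ae_eventually_notMem_of_le (μ := μ) (s := bad)
    ((summable_box_mul_exp (2 * (K : ℝ) + 1) hc).mul_left (J : ℝ)) t₀ (fun s hs => ?_)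
  · have hms : Tendsto (fun s : ℕ => s * m) atTop atTop :=
      tendsto_id.atTop_mul_const' hm0'
    filter_upwards [hσ, hbad0] with ω hω1 hω2
    filter_upwards [hms.eventually hω1, hω2] with s hs1 hs2
    have hs0 : (0 : ℝ) ≤ s := by positivity
    have key : ∀ j ≤ J, roundedShape w r (ρ j * s) ⊆
        occupied (envOf ξ ω) A₀ (s * (m * σ + j)) := by
      intro j
      induction j with
      | zero =>
        intro _ y hy
        have h1 := norm_toPlane_le_of_mem_roundedShape hw h hr.le
          (mul_nonneg (hρpos 0).le hs0) hy
        have h2 := norm_le_norm_toPlane y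
        rw [add_zero, ← mul_assoc]
        refine hs1 y ?_
        have h3 : ρ 0 * s * B = s * m / 2 := by
          simp only [hρ]; field_simp; simp
        push_cast
        linarith
      | succ j ih =>
        intro hj y hy
        have h1 := norm_toPlane_le_of_mem_roundedShape hw h hr.le
          (mul_nonneg (hρpos (j + 1)).le hs0) hy
        have h2 := norm_le_norm_toPlane y
        have h3 : ρ (j + 1) * s * B ≤ K * s := by
          calc ρ (j + 1) * s * B ≤ ρ J * s * B := by gcongr; exact hρmono hj
            _ = ρ J * B * s := by ring
            _ ≤ K * s := by gcongr
        have hyK : y ∈ box (K * s) := by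
          rw [mem_box]; push_cast; linarith
        rw [← add_assoc, mul_add_one, occupied_add]
        by_contra hcon
        refine hs2 ⟨j, Finset.mem_range.2 hj, y, hyK, hy, fun hy' => hcon ?_⟩
        exact occupied_subset ((h.sure ω).shift _ _).monotone (ih (by omega)) _ hy'
    exact key J le_rfl
  · have hsub : bad s ⊆ ⋃ j ∈ Finset.range J, ⋃ y ∈ box (K * s),
        {ω | y ∈ roundedShape w r (ρ (j + 1) * s) ∧ y ∉ occupied
          (envOf (shiftNoise 0 (s * (m * σ + j)) ξ) ω) (roundedShape w r (ρ j * s)) s} := by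
      rintro ω ⟨j, hj, y, hy, hy'⟩
      exact Set.mem_biUnion (Finset.mem_coe.2 hj) (Set.mem_biUnion (Finset.mem_coe.2 hy) hy')
    have hsingle : ∀ (j : ℕ) (y : Site), μ.real {ω | y ∈ roundedShape w r (ρ (j + 1) * s) ∧
        y ∉ occupied (envOf (shiftNoise 0 (s * (m * σ + j)) ξ) ω) (roundedShape w r (ρ j * s)) s}
        ≤ Real.exp (-c * s) := by
      intro j y
      by_cases hy : y ∈ roundedShape w r (ρ (j + 1) * s)
      · simp only [hy, true_and]
        refine hstep _ (h.shift _ _) s hs (ρ j * s) ?_ y ?_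
        · have h1 : 1 ≤ δ * (m / (2 * B)) := by
            rw [mul_div_assoc', le_div_iff₀ (by positivity), one_mul]
            rwa [div_le_iff₀' hδ] at hm
          have h2 : 1 ≤ δ * ρ j := h1.trans (mul_le_mul_of_nonneg_left (hρ0 j) hδ.le)
          have := mul_le_mul_of_nonneg_right h2 (show (0 : ℝ) ≤ s by positivity)
          linarith
        · rw [← add_mul]
          convert hy using 2
          simp only [hρ]; push_cast; ring
      · simp only [hy, false_and, Set.ofPred_false, measureReal_empty]
        positivity
    calc μ.real (bad s) ≤ ∑ j ∈ Finset.range J, ∑ y ∈ box (K * s), Real.exp (-c * s) := by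
          refine (measureReal_mono hsub (measure_ne_top _ _)).trans
            ((measureReal_biUnion_finset_le _ _).trans (Finset.sum_le_sum fun j _ => ?_))
          exact (measureReal_biUnion_finset_le _ _).trans
            (Finset.sum_le_sum fun y _ => hsingle j y)
      _ = J * ((2 * (K * s) + 1) ^ 2 * Real.exp (-c * s)) := by
          rw [Finset.sum_const, Finset.sum_const, card_box, Finset.card_range, nsmul_eq_mul,
            nsmul_eq_mul]
          push_cast; ring
      _ ≤ J * (((2 * K + 1) * s + (2 * K + 1)) ^ 2 * Real.exp (-c * s)) := by
          refine mul_le_mul_of_nonneg_left (mul_le_mul_of_nonneg_right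
            (pow_le_pow_left₀ (by positivity) ?_ 2) (by positivity)) (by positivity)
          have h1 : (0 : ℝ) ≤ K := by positivity
          have h2 : (0 : ℝ) ≤ s := by positivity
          linarith

/-- Lower bound of the shape theorem. -/
theorem IsSiteSpeed.ae_eventually_exists_near {w : Plane → ℝ} (hw : IsSiteSpeed μ ξ w)
    (h : IsSureNoise T π μ ξ) (hπ : ∃ p, IsPerturbation p π T) {a : ℝ} (ha : 0 < a)
    (haw : ∀ u : Plane, ‖u‖ = 1 → a ≤ w u) {A₀ : Set Site} (hA₀ : A₀.Finite)
    (hfill : T.FillsSpace A₀) {ε : ℝ} (hε : 0 < ε) :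
    ∀ᵐ ω ∂μ, ∀ᶠ t : ℕ in atTop, ∀ z ∈ wulffShape w, ∃ x ∈ occupied (envOf ξ ω) A₀ t,
      dist ((t : ℝ)⁻¹ • toPlane x) z ≤ ε := by
  have hr1 : (1 : ℝ) ≤ range N := one_le_range
  set M : ℝ := 2 * range N with hM
  have hM0 : 0 < M := by positivity
  set η : ℝ := min (1 / 2) (ε / (8 * M)) with hη
  have hη0 : 0 < η := by positivity
  have hη1 : η < 1 := lt_of_le_of_lt (min_le_left _ _) (by norm_num)
  have hηM : 4 * η * M ≤ ε / 2 := by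
    have := min_le_right (1 / 2) (ε / (8 * M))
    rw [← hη, le_div_iff₀ (by positivity)] at this
    linarith
  set r := η * a with hr
  have hr0 : 0 < r := by positivity
  obtain ⟨q, ρ, hq, hρ, hqρ, hae⟩ :=
    hw.exists_roundedShape_subset h hπ ha haw hA₀ hfill hr0 hη0 hη1
  have hq' : (0 : ℝ) < q := by exact_mod_cast hq
  -- the slightly smaller copy `θ • z` of a point `z` is approximated
  set θ : ℝ := (1 - η) ^ 4 with hθ
  have hθ0 : 0 < θ := by have : 0 < 1 - η := by linarith
                         positivity
  have hθ1 : 1 - θ ≤ 4 * η := by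
    have := one_add_mul_le_pow (show (-2 : ℝ) ≤ -η by linarith) 4
    rw [hθ]
    push_cast at this
    rw [← sub_eq_add_neg] at this
    linarith
  have hθ2 : θ ≤ 1 := pow_le_one₀ (by linarith) (by linarith)
  filter_upwards [hae] with ω hω
  obtain ⟨s₀, hs₀⟩ := exists_nat_ge (1 / η + 1 / (ρ * r))
  obtain ⟨t₁, ht₁⟩ := exists_nat_ge (2 / ε)
  have hdiv : Tendsto (fun t : ℕ => t / q) atTop atTop := Nat.tendsto_div_const_atTop hq.ne'
  filter_upwards [hdiv.eventually (hω.and (eventually_ge_atTop s₀)), eventually_ge_atTop t₁]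
    with t ⟨hsub, hs⟩ ht z hz
  set s := t / q with hsdef
  have hs' : 1 / η + 1 / (ρ * r) ≤ (s : ℝ) := hs₀.trans (by exact_mod_cast hs)
  have hsη : 1 ≤ η * s := by
    have : 1 / η ≤ (s : ℝ) := by linarith [show 0 < 1 / (ρ * r) by positivity]
    rwa [div_le_iff₀' hη0] at this
  have hsr : 1 ≤ ρ * r * s := by
    have : 1 / (ρ * r) ≤ (s : ℝ) := by linarith [show 0 < 1 / η by positivity]
    rwa [div_le_iff₀' (by positivity)] at this
  have hs0 : (0 : ℝ) < s := by
    by_contra! hneg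
    have := mul_nonpos_of_nonneg_of_nonpos hη0.le hneg
    linarith
  have hst : s * q ≤ t := Nat.div_mul_le_self t q
  have htε : 2 / ε ≤ (t : ℝ) := ht₁.trans (by exact_mod_cast ht)
  have ht0 : (0 : ℝ) < t := lt_of_lt_of_le (by positivity) htε
  have hts : (t : ℝ) ≤ (s + 1) * q := by
    have : t < q * (s + 1) := Nat.lt_mul_div_succ t hq
    have h2 : (t : ℝ) < q * (s + 1) := by exact_mod_cast this
    linarith
  have hR0 : 0 < ρ * s := by positivity
  -- `θ * t` is at most `(1 - η)` times the radius of the rounded shape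
  have hθt : θ * t ≤ (1 - η) * (ρ * s) := by
    have hη' : 0 ≤ 1 - η := by linarith
    have h1 : (1 - η) * (s + 1) ≤ s := by linarith
    have h2 : (1 - η) * q * (1 - η) ≤ ρ := by
      calc (1 - η) * q * (1 - η) ≤ (1 + η) * ρ * (1 - η) := by gcongr
        _ = ρ - η ^ 2 * ρ := by ring
        _ ≤ ρ := by linarith [show 0 ≤ η ^ 2 * ρ by positivity]
    calc θ * t ≤ (1 - η) ^ 4 * ((s + 1) * q) := by rw [hθ]; gcongr
      _ = (1 - η) * (((1 - η) * q * (1 - η)) * ((1 - η) * (s + 1))) := by ring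
      _ ≤ (1 - η) * (ρ * s) := by gcongr
  have hznorm : ‖z‖ ≤ M := norm_le_of_forall_inner_le hM0.le fun u hu =>
    (hz u hu).trans (hw.le_range h hu)
  have hround := norm_toPlane_roundSite_sub ((θ * t) • z)
  refine ⟨roundSite ((θ * t) • z), occupied_monotone (h.sure ω) _ hst (hsub
    ⟨(θ * t / (ρ * s)) • z, fun u hu => ?_, ?_⟩), ?_⟩
  · rw [inner_smul_left, conj_trivial]
    have h1 : θ * t / (ρ * s) ≤ 1 - η := by rwa [div_le_iff₀ hR0]
    have h2 : 0 ≤ θ * t / (ρ * s) := by positivity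
    have h3 := haw u hu
    have h4 : θ * t / (ρ * s) * inner ℝ z u ≤ θ * t / (ρ * s) * w u :=
      mul_le_mul_of_nonneg_left (hz u hu) h2
    have h5 : θ * t / (ρ * s) * w u ≤ (1 - η) * w u :=
      mul_le_mul_of_nonneg_right h1 (by linarith)
    have h6 : η * a ≤ η * w u := by gcongr
    rw [hr]
    linarith
  · rw [smul_smul, mul_div_cancel₀ _ hR0.ne']
    linarith
  · have hdec : (t : ℝ)⁻¹ • toPlane (roundSite ((θ * t) • z)) - z =
        (t : ℝ)⁻¹ • (toPlane (roundSite ((θ * t) • z)) - (θ * t) • z) - (1 - θ) • z := by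
      rw [smul_sub, smul_smul, sub_smul, one_smul, mul_comm θ, inv_mul_cancel_left₀ ht0.ne']
      abel
    rw [dist_eq_norm, hdec]
    refine (norm_sub_le _ _).trans ?_
    rw [norm_smul, norm_smul, norm_inv, Real.norm_natCast, Real.norm_of_nonneg (by linarith)]
    have h1 : (t : ℝ)⁻¹ ≤ ε / 2 := by
      rw [inv_le_comm₀ ht0 (by positivity), inv_div]; exact htε
    have h2 : (t : ℝ)⁻¹ * ‖toPlane (roundSite ((θ * t) • z)) - (θ * t) • z‖ ≤ ε / 2 * 1 := by
      gcongr
    have h3 : (1 - θ) * ‖z‖ ≤ 4 * η * M := by gcongr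
    linarith

lemma polarSet_inverseSpeedRegion {w : Plane → ℝ} (hw : ∀ u : Plane, ‖u‖ = 1 → 0 < w u) :
    polarSet (inverseSpeedRegion fun u => w u) = wulffShape w := by
  ext x
  simp only [polarSet, inverseSpeedRegion, wulffShape, Set.mem_iUnion, Set.mem_image,
    Set.mem_ofPred_eq]
  constructor
  · intro hx u hu
    have hwu := hw u hu
    have h1 := hx ((1 / w u) • u) ⟨⟨u, by simp [hu]⟩, 1 / w u, ⟨by positivity, le_rfl⟩, rfl⟩
    rw [inner_smul_right, one_div_mul_eq_div, div_le_one hwu] at h1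
    exact h1
  · rintro hx _ ⟨u, s, hs, rfl⟩
    have hu : ‖(u : Plane)‖ = 1 := by simp
    have hwu := hw u hu
    rw [inner_smul_right]
    calc s * inner ℝ x (u : Plane) ≤ s * w u := mul_le_mul_of_nonneg_left (hx u hu) hs.1
      _ ≤ 1 / w u * w u := by gcongr; exact hs.2
      _ = 1 := one_div_mul_cancel hwu.ne'

/-- The shape theorem. -/
theorem IsSiteSpeed.ae_tendsto_hausdorffEDist {w : Plane → ℝ} (hw : IsSiteSpeed μ ξ w)
    (h : IsSureNoise T π μ ξ) (hπ : ∃ p, IsPerturbation p π T) {a : ℝ} (ha : 0 < a)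
    (haw : ∀ u : Plane, ‖u‖ = 1 → a ≤ w u) {A₀ : Set Site} (hA₀ : A₀.Finite)
    (hfill : T.FillsSpace A₀) :
    ∀ᵐ ω ∂μ, Tendsto (fun t : ℕ => Metric.hausdorffEDist
      (rescaled (occupied (envOf ξ ω) A₀ t) t) (wulffShape w)) atTop (𝓝 0) := by
  have key : ∀ᵐ ω ∂μ, ∀ k : ℕ, ∀ᶠ t : ℕ in atTop, Metric.hausdorffEDist
      (rescaled (occupied (envOf ξ ω) A₀ t) t) (wulffShape w) ≤
        ENNReal.ofReal (1 / ((k : ℝ) + 1)) := by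
    rw [ae_all_iff]
    intro k
    have hk : (0 : ℝ) < 1 / ((k : ℝ) + 1) := by positivity
    filter_upwards [hw.ae_eventually_subset_thickening h hA₀ hk,
      hw.ae_eventually_exists_near h hπ ha haw hA₀ hfill hk] with ω h1 h2
    filter_upwards [h1, h2] with t ht1 ht2
    refine Metric.hausdorffEDist_le_of_mem_edist ?_ fun z hz => ?_
    · rintro _ ⟨x, hx, rfl⟩
      obtain ⟨z, hz, hxz⟩ := Metric.mem_thickening_iff.1 (ht1 x hx)
      exact ⟨z, hz, by rw [edist_dist]; exact ENNReal.ofReal_le_ofReal hxz.le⟩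
    · obtain ⟨x, hx, hxz⟩ := ht2 z hz
      exact ⟨_, ⟨x, hx, rfl⟩, by
        rw [edist_comm, edist_dist]; exact ENNReal.ofReal_le_ofReal hxz⟩
  filter_upwards [key] with ω hω
  refine ENNReal.tendsto_nhds_zero.2 fun ε hε => ?_
  have hlim : Tendsto (fun k : ℕ => ENNReal.ofReal (1 / ((k : ℝ) + 1))) atTop (𝓝 0) := by
    simpa using ENNReal.tendsto_ofReal tendsto_one_div_add_atTop_nhds_zero_nat
  obtain ⟨k, hk⟩ := (hlim.eventually_le_const hε).exists
  filter_upwards [hω k] with t ht using ht.trans hk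

/-! ### Independence of the realization of the noise -/

/-- One-site bounds depend on the noise only through the rule. -/
lemma IsSiteSpeed.transfer {Ω' : Type*} [MeasurableSpace Ω'] {μ' : Measure Ω'}
    [IsProbabilityMeasure μ'] {ξ' : Site → ℕ → Ω' → Config N → Bool} {w : Plane → ℝ}
    (hw : IsSiteSpeed μ ξ w) (h : IsNoise π μ ξ) (h' : IsNoise π μ' ξ') :
    IsSiteSpeed μ' ξ' w := by
  intro ε hε
  obtain ⟨c, t₀, hc, hb⟩ := hw ε hε
  have hE : MeasurableSet {B : Set Site | (0 : Site) ∈ B} :=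
    measurableSet_setOfPred.2 (measurable_set_iff.1 measurable_id (0 : Site))
  refine ⟨c, t₀, hc, fun u hu t ht b => ⟨fun hb' => ?_, fun hb' => ?_⟩⟩
  · exact (real_occupied_eq h' h hE.compl t (halfSites u b)).trans_le ((hb u hu t ht b).1 hb')
  · exact (real_occupied_eq h' h hE t (halfSites u b)).trans_le ((hb u hu t ht b).2 hb')

/-- The half-space speed and the shape theorem for an arbitrary noise. -/
theorem IsSiteSpeed.isHalfSpaceSpeed_and_tendsto {w : Plane → ℝ} (hw : IsSiteSpeed μ ξ w)
    (h : IsNoise π μ ξ) {p : ℝ} (hπ : IsPerturbation p π T) {a : ℝ} (ha : 0 < a)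
    (haw : ∀ u : Plane, ‖u‖ = 1 → a ≤ w u) :
    IsHalfSpaceSpeed μ ξ (fun u => w u) ∧
      ∀ A₀ : Set Site, A₀.Finite → T.FillsSpace A₀ →
        ∀ᵐ ω ∂μ, Tendsto (fun t : ℕ => Metric.hausdorffEDist
          (rescaled (occupied (fun x s => ξ x s ω) A₀ t) t)
          (polarSet (inverseSpeedRegion fun u => w u))) atTop (𝓝 0) := by
  obtain ⟨ξ', h', hae⟩ := h.exists_sure hπ
  have hw' : IsSiteSpeed μ ξ' w := hw.transfer h h'.noise
  have hpos : ∀ u : Plane, ‖u‖ = 1 → 0 < w u := fun u hu => ha.trans_le (haw u hu)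
  refine ⟨⟨fun u => hpos u (by simp), fun ε hε => ?_⟩, fun A₀ hA₀ hfill => ?_⟩
  · obtain ⟨c, hc, hb⟩ := hw'.exists_halfSpace_bounds h' ⟨p, hπ⟩ hε
    refine ⟨c, hc, fun u t => (hb u (by simp) t).trans_eq (measureReal_congr ?_)⟩
    filter_upwards [hae] with ω hω
    refine propext ?_
    change (∀ x : Site, _ → (_ → x ∈ occupied (envOf ξ' ω) _ t) ∧
      (x ∈ occupied (envOf ξ' ω) _ t → _)) ↔ _
    rw [hω]
    rfl
  · rw [polarSet_inverseSpeedRegion hpos]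
    filter_upwards [hae, hw'.ae_tendsto_hausdorffEDist h' ⟨p, hπ⟩ ha haw hA₀ hfill] with ω hω hlim
    rw [hω] at hlim
    exact hlim

end RandomGrowth

theorem corollary1p1 {N : Finset Site} (T : CellularAutomaton N) (hT : T.LocallyRegular)
    (hfill : ∃ A : Set Site, A.Finite ∧ T.FillsSpace A)
    (p : ℝ) (π : RandomRule N) (hπ : IsPerturbation p π T) :
    ∃ w : Metric.sphere (0 : Plane) 1 → ℝ,
      ∀ {Ω : Type*} [MeasurableSpace Ω] (μ : Measure Ω) [IsProbabilityMeasure μ]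
        (ξ : Site → ℕ → Ω → Config N → Bool), IsNoise π μ ξ →
        IsHalfSpaceSpeed μ ξ w ∧
        ∀ A₀ : Set Site, A₀.Finite → T.FillsSpace A₀ →
          ∀ᵐ ω ∂μ, Tendsto
            (fun t : ℕ => Metric.hausdorffEDist
              (rescaled (occupied (fun x s => ξ x s ω) A₀ t) t)
              (polarSet (inverseSpeedRegion w)))
            atTop (𝓝 0) := by
  classical
  by_cases hex : ∃ (Ω : Type _) (_ : MeasurableSpace Ω) (μ : Measure Ω) (_ : IsProbabilityMeasure μ)
      (ξ : Site → ℕ → Ω → Config N → Bool), IsNoise π μ ξ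
  -- the speed is taken from one realization of the noise, and transferred to all others
  · obtain ⟨Ω, _, μ, _, ξ, h⟩ := hex
    obtain ⟨ξ', h', -⟩ := h.exists_sure hπ
    obtain ⟨w, a, ha, haw, hw⟩ := h'.exists_speed hT hfill ⟨p, hπ⟩
    refine ⟨fun u => w u, fun {Ω₁} _ μ₁ _ ξ₁ h₁ => ?_⟩
    exact (hw.transfer h'.noise h₁).isHalfSpaceSpeed_and_tendsto h₁ hπ ha haw
  -- if no noise existed in this universe, nothing would be claimed
  · exact ⟨fun _ => 1, fun {Ω₁} mΩ₁ μ₁ hμ₁ ξ₁ h₁ => absurd ⟨Ω₁, mΩ₁, μ₁, hμ₁, ξ₁, h₁⟩ hex⟩
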